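/- **Theorem (Darboux–Jouanolou).** A (one-dimensional) holomorphic foliation $\mathcal F$ with isolated singularities on $\mathbb{C}P(2)$ is given by an open cover $\{U_j\}$ of $\mathbb{C}P(2)$, holomorphic vector fields $X_j$ on $U_j$ with isolated zeros, and nowhere vanishing holomorphic functions $g_{ij}$ on $U_i\cap U_j$ such that $X_i=g_{ij}X_j$ there. Its singular set $\operatorname{sing}(\mathcal F)$ is the set of zeros of the $X_j$, and its leaves are the classes of nonsingular points obtained by glueing the local complex orbits of the $X_j$. A leaf $L$ is *algebraic* if its closure $\overline L$ is an algebraic curve in $\mathbb{C}P(2)$ (the zero set of a nonzero homogeneous polynomial of positive degree). An irreducible algebraic curve is *invariant* if it contains every leaf that it meets. A *rational first integral* of $\mathcal F$ is a nonconstant rational function $P/Q$, where $P,Q\in\mathbb{C}[x_0,x_1,x_2]$ are homogeneous of the same degree and have no common factor, such that every leaf is contained in a curve $aP+bQ=0$ for some $(a,b)\in\mathbb{C}^2\setminus\{(0,0)\}$. Finally, $\mathcal F$ *has degree* $k$ if off its singular set it is defined by $\Omega=0$ for a one-form $\Omega=A_0\,dx_0+A_1\,dx_1+A_2\,dx_2$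 on $\mathbb{C}^3$ whose coefficients are homogeneous polynomials of degree $k$; that is, if $\pi\colon\mathbb{C}^3\setminus\{0\}\to\mathbb{C}P(2)$ is the projection, then for every $v$ with $\pi(v)\in U_j\setminus\operatorname{sing}(\mathcal F)$ one has $\ker\Omega_v=d\pi_v^{-1}\big(\mathbb{C}\,X_j(\pi(v))\big)$. 1. If a holomorphic foliation $\mathcal F$ with isolated singularities on $\mathbb{C}P(2)$ has infinitely many algebraic leaves, then $\mathcal F$ has a rational first integral, and all leaves of $\mathcal F$ are algebraic. 2. For each $k\in\mathbb{N}$ there is $N(k)\in\mathbb{N}$ such that every holomorphic foliation with isolated singularities and of degree $k$ on $\mathbb{C}P(2)$ which has more than $N(k)$ algebraic leaves, or more than $N(k)$ invariant irreducible algebraic curves, has a rational first integral. -/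

import Mathlib

open Set Filter Topology
open scoped Manifold ContDiff LinearAlgebra.Projectivization

/-- The complex projective plane: the space of lines through the origin of `ℂ³`. -/
abbrev CP2 : Type := ℙ ℂ (Fin 3 → ℂ)

namespace CP2

/-- The quotient topology of `ℂ³ ∖ {0}`. -/
instance instTopologicalSpace : TopologicalSpace CP2 :=
  inferInstanceAs (TopologicalSpace (Quotient (projectivizationSetoid ℂ (Fin 3 → ℂ))))

/-- The affine coordinates `(v_k / v_i)_{k ≠ i}` of the point `[v]`. -/
noncomputable def affineCoord (i : Fin 3) : CP2 → (Fin 2 → ℂ) :=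
  Projectivization.lift (fun v k => v.1 (i.succAbove k) / v.1 i) (by
    rintro ⟨a, ha⟩ ⟨b, hb⟩ t h
    dsimp only at h
    subst h
    have ht : t ≠ 0 := by rintro rfl; simp at ha
    funext k
    simp [mul_div_mul_left _ _ ht])

/-- The affine open set `{[v] | v_i ≠ 0}`. -/
def affineSet (i : Fin 3) : Set CP2 :=
  {p | Projectivization.lift (fun v : {v : Fin 3 → ℂ // v ≠ 0} => v.1 i ≠ 0) (by
    rintro ⟨a, ha⟩ ⟨b, hb⟩ t h
    dsimp only at h
    subst h
    have ht : t ≠ 0 := by rintro rfl; simp at ha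
    simp [ht]) p}

lemma insertNth_ne_zero (i : Fin 3) (u : Fin 2 → ℂ) :
    (i.insertNth (1 : ℂ) u : Fin 3 → ℂ) ≠ 0 := fun h => by
  simpa using congrFun h i

lemma continuous_mk : Continuous fun v : {v : Fin 3 → ℂ // v ≠ 0} =>
    (Projectivization.mk ℂ v.1 v.2 : CP2) :=
  continuous_quotient_mk'

lemma isOpen_affineSet (i : Fin 3) : IsOpen (affineSet i) := by
  change IsOpen ((Quotient.mk (projectivizationSetoid ℂ (Fin 3 → ℂ))) ⁻¹' (affineSet i))
  exact isOpen_ne.preimage ((continuous_apply i).comp continuous_subtype_val)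

/-- The `i`-th affine chart `{v_i ≠ 0} → ℂ²`. -/
noncomputable def affineChart (i : Fin 3) : OpenPartialHomeomorph CP2 (Fin 2 → ℂ) where
  toFun := affineCoord i
  invFun u := Projectivization.mk ℂ (i.insertNth (1 : ℂ) u) (insertNth_ne_zero i u)
  source := affineSet i
  target := univ
  map_source' _ _ := mem_univ _
  map_target' u _ := by
    change (i.insertNth (1 : ℂ) u : Fin 3 → ℂ) i ≠ 0
    simp
  left_inv' := by
    intro p hp
    induction p using Projectivization.ind with
    | h v hv =>
      replace hp : v i ≠ 0 := hp
      refine (Projectivization.mk_eq_mk_iff' ℂ _ _ _ _).2 ⟨(v i)⁻¹, ?_⟩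
      funext k
      refine Fin.succAboveCases i ?_ (fun k => ?_) k
      · simp [hp]
      · simp [affineCoord, div_eq_inv_mul]
  right_inv' u _ := by
    funext k
    simp [affineCoord]
  open_source := isOpen_affineSet i
  open_target := isOpen_univ
  continuousOn_toFun := by
    rw [continuousOn_open_iff (isOpen_affineSet i)]
    intro t ht
    change IsOpen ((Quotient.mk (projectivizationSetoid ℂ (Fin 3 → ℂ))) ⁻¹'
      (affineSet i ∩ affineCoord i ⁻¹' t))
    have hc : ContinuousOn (fun (v : {v : Fin 3 → ℂ // v ≠ 0}) (k : Fin 2) =>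
        v.1 (i.succAbove k) / v.1 i) {v | v.1 i ≠ 0} := by
      refine continuousOn_pi.2 fun k => ContinuousOn.div ?_ ?_ fun v hv => hv
      · exact ((continuous_apply _).comp continuous_subtype_val).continuousOn
      · exact ((continuous_apply _).comp continuous_subtype_val).continuousOn
    exact hc.isOpen_inter_preimage
      (isOpen_ne.preimage ((continuous_apply i).comp continuous_subtype_val)) ht
  continuousOn_invFun := by
    refine Continuous.continuousOn (continuous_mk.comp (f := fun u : Fin 2 → ℂ =>
      (⟨i.insertNth (1 : ℂ) u, insertNth_ne_zero i u⟩ : {v : Fin 3 → ℂ // v ≠ 0})) ?_)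
    refine Continuous.subtype_mk (continuous_pi fun l => ?_) _
    refine Fin.succAboveCases i ?_ (fun k => ?_) l
    · simpa using continuous_const
    · simpa using continuous_apply k

lemma exists_mem_affineSet (p : CP2) : ∃ i, p ∈ affineSet i := by
  induction p using Projectivization.ind with
  | h v hv => exact Function.ne_iff.1 hv

/-- The atlas of the three affine charts. -/
noncomputable instance instChartedSpace : ChartedSpace (Fin 2 → ℂ) CP2 where
  atlas := range affineChart
  chartAt p := affineChart (exists_mem_affineSet p).choose
  mem_chart_source p := (exists_mem_affineSet p).choose_spec
  chart_mem_atlas _ := mem_range_self _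

/-- `CP2` is a complex analytic manifold of dimension two. -/
instance instIsManifold : IsManifold 𝓘(ℂ, Fin 2 → ℂ) ω CP2 := by
  apply isManifold_of_contDiffOn
  rintro _ _ ⟨i, rfl⟩ ⟨j, rfl⟩
  have hc : ∀ l : Fin 3, ContDiff ℂ ω fun u : Fin 2 → ℂ =>
      (i.insertNth (1 : ℂ) u : Fin 3 → ℂ) l := by
    intro l
    refine Fin.succAboveCases i ?_ (fun k => ?_) l
    · simpa using contDiff_const
    · simpa using contDiff_apply ℂ ℂ k
  refine contDiffOn_pi.2 fun k => ContDiffOn.div (hc _).contDiffOn (hc j).contDiffOn ?_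
  rintro u ⟨hu, -⟩
  exact hu.2

/-- The canonical projection `π : ℂ³ ∖ {0} → CP2`, with an irrelevant value at the origin. -/
noncomputable def proj (v : Fin 3 → ℂ) : CP2 :=
  open Classical in
  if h : v ≠ 0 then Projectivization.mk ℂ v h else Classical.arbitrary _

/-- The zero set in `CP2` of a homogeneous polynomial. -/
def zeroSet (f : MvPolynomial (Fin 3) ℂ) : Set CP2 :=
  {p | MvPolynomial.eval p.rep f = 0}

/-- An algebraic curve, possibly reducible and singular: the zero set of a nonzero homogeneous
polynomial of positive degree. -/
def IsAlgebraicCurve (C : Set CP2) : Prop :=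
  ∃ (d : ℕ) (f : MvPolynomial (Fin 3) ℂ),
    0 < d ∧ f ≠ 0 ∧ f.IsHomogeneous d ∧ C = zeroSet f

/-- An irreducible algebraic curve. -/
def IsIrreducibleAlgebraicCurve (C : Set CP2) : Prop :=
  ∃ (d : ℕ) (f : MvPolynomial (Fin 3) ℂ),
    Irreducible f ∧ f.IsHomogeneous d ∧ C = zeroSet f

end CP2

/-- A (one-dimensional) holomorphic foliation with isolated singularities on `CP2`: an open cover
`U`, on each `U j` a holomorphic vector field `X j` with isolated zeros, and on each overlap a
nowhere vanishing holomorphic function `g` with `X i = g • X j`. Only the values of `X j` on `U j`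
matter. -/
structure HolomorphicFoliation where
  /-- the index set of the cover -/
  ι : Type
  /-- the members of the cover -/
  U : ι → Set CP2
  isOpen_U : ∀ j, IsOpen (U j)
  iUnion_U : ⋃ j, U j = univ
  /-- the local vector fields -/
  X : ι → (p : CP2) → TangentSpace 𝓘(ℂ, Fin 2 → ℂ) p
  holomorphic_X : ∀ j, ContMDiffOn 𝓘(ℂ, Fin 2 → ℂ) (𝓘(ℂ, Fin 2 → ℂ).tangent) ω
    (fun p => (⟨p, X j p⟩ : TangentBundle 𝓘(ℂ, Fin 2 → ℂ) CP2)) (U j)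
  isolated_zeros : ∀ j, ∀ p ∈ U j, X j p = 0 → ∀ᶠ q in 𝓝[≠] p, X j q ≠ 0
  compatible : ∀ i j, ∃ g : CP2 → ℂ,
    ContMDiffOn 𝓘(ℂ, Fin 2 → ℂ) 𝓘(ℂ, ℂ) ω g (U i ∩ U j) ∧
    ∀ p ∈ U i ∩ U j, g p ≠ 0 ∧ X i p = g p • X j p

namespace HolomorphicFoliation

open CP2

variable (F : HolomorphicFoliation)

/-- The singular set. -/
def sing : Set CP2 := {p | ∃ j, p ∈ F.U j ∧ F.X j p = 0}

/-- `q` is reached from `p` along a (complex time) integral curve, defined on a disc, of one of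
the local vector fields. -/
def FlowStep (p q : CP2) : Prop :=
  ∃ (j : F.ι) (γ : ℂ → CP2) (r : ℝ) (z : ℂ), z ∈ Metric.ball (0 : ℂ) r ∧ γ 0 = p ∧ γ z = q ∧
    ∀ w ∈ Metric.ball (0 : ℂ) r, γ w ∈ F.U j ∧
      HasMFDerivAt 𝓘(ℂ, ℂ) 𝓘(ℂ, Fin 2 → ℂ) γ w
        ((1 : ℂ →L[ℂ] ℂ).smulRight (F.X j (γ w)))

/-- The leaf through `p`: all points joined to `p` by a finite chain of local integral curves. -/
def leafThrough (p : CP2) : Set CP2 := {q | Relation.EqvGen F.FlowStep p q}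

/-- The leaves of the foliation, i.e. those through its nonsingular points. -/
def leaves : Set (Set CP2) := F.leafThrough '' (F.sing)ᶜ

/-- The algebraic leaves: those whose closure is an algebraic curve. -/
def algebraicLeaves : Set (Set CP2) := {L ∈ F.leaves | IsAlgebraicCurve (closure L)}

/-- The irreducible algebraic curves that are invariant: every leaf that meets the curve is
contained in it. -/
def invariantCurves : Set (Set CP2) :=
  {C | IsIrreducibleAlgebraicCurve C ∧ ∀ L ∈ F.leaves, (L ∩ C).Nonempty → L ⊆ C}

/-- There is a nonconstant rational function `P / Q` on `CP2`, in lowest terms, that is constant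
along the leaves: each leaf lies in a member `a P + b Q = 0` of the pencil of its levels. -/
def HasRationalFirstIntegral : Prop :=
  ∃ (n : ℕ) (P Q : MvPolynomial (Fin 3) ℂ),
    P.IsHomogeneous n ∧ Q.IsHomogeneous n ∧ IsRelPrime P Q ∧ LinearIndependent ℂ ![P, Q] ∧
    ∀ L ∈ F.leaves, ∃ a b : ℂ, (a ≠ 0 ∨ b ≠ 0) ∧
      L ⊆ zeroSet (MvPolynomial.C a * P + MvPolynomial.C b * Q)

/-- The foliation is defined, in homogeneous coordinates, by a polynomial one-form
`Ω = A₀ dx₀ + A₁ dx₁ + A₂ dx₂` on `ℂ³` whose coefficients are homogeneous of degree `k`: over each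
nonsingular point the kernel of `Ω` is the preimage under `dπ` of the tangent line of the
foliation. In particular `Ω` vanishes only over the finite singular set, so that the `Aᵢ` have
no common factor, and `Ω` annihilates the radial vector field. -/
def HasDegree (k : ℕ) : Prop :=
  ∃ A : Fin 3 → MvPolynomial (Fin 3) ℂ, (∀ i, (A i).IsHomogeneous k) ∧
    ∀ v : Fin 3 → ℂ, v ≠ 0 → proj v ∉ F.sing → ∀ j, proj v ∈ F.U j → ∀ w : Fin 3 → ℂ,
      (∑ i, MvPolynomial.eval v (A i) * w i = 0 ↔
        ∃ c : ℂ, mfderiv 𝓘(ℂ, Fin 3 → ℂ) 𝓘(ℂ, Fin 2 → ℂ) proj v w = c • F.X j (proj v))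

end HolomorphicFoliation

/-!
The heart of the matter is Darboux's counting argument. Suppose that a foliation is defined in
homogeneous coordinates by a polynomial one-form `A` of degree `k`, and that the irreducible curves
`f i = 0` are invariant. Then `f i` divides `A ∧ d(f i)`, and the quotient `θ i` lies in a vector
space whose dimension depends on `k` alone. With more curves than this dimension plus one there are
two independent linear relations `∑ a i • θ i = 0` and `∑ b i • θ i = 0`, and these say that the
closed logarithmic forms `∑ a i • d(f i) / f i` and `∑ b i • d(f i) / f i` are proportional to `A`.
They are independent by their residues along the curves. The quotient of two proportional closed
forms is constant along their common kernel, and so it is a rational first integral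
(`MvPolynomial.exists_first_integral_of_relations`, `MvPolynomial.exists_first_integral`).
One-forms on `ℂ³` are written as vectors of coefficients, and `∧` and `d` as cross product and curl.

Leaves and curves are related as follows. If `f` divides `A ∧ df`, then `f` solves a linear
differential equation along integral curves, and a leaf that meets `f = 0` stays inside
(`HolomorphicFoliation.leafThrough_subset_zeroSet`). Conversely, along a curve that contains a leaf
densely, or all leaves that it meets, `df` is proportional to `A`, so that `f` divides `A ∧ df`
(`IsDefinedBy.exists_of_mem_algebraicLeaves`, `IsDefinedBy.exists_of_mem_invariantCurves`). An
irreducible curve minus finitely many points is connected (`CP2.of_locally_constant`). As an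
invariant curve is locally a single leaf, it is the closure of one leaf. Hence different algebraic
leaves lie on different curves, so that infinitely many leaves give infinitely many curves; and once
there is a first integral, every leaf is dense in a component of one of its levels and is therefore
algebraic. Connectedness is proved by projecting the curve from a point to a line: the power sums of
those roots that belong to a union of components are holomorphic off a finite set and of polynomial
growth, hence polynomials, and out of them one builds a polynomial that vanishes on exactly one part
of the curve up to finitely many points; this contradicts the weak form of Bézout's theorem
`CP2.finite_inter_zeroSet`.

The first assertion does not presuppose a degree, and so it has to be shown that every holomorphic
foliation is defined by a polynomial one-form (`HolomorphicFoliation.exists_hasDegree`). The ratios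
of the coefficients of the local one-forms of the foliation are well-defined meromorphic functions on
`CP2`. Restricted to a line they are meromorphic on the Riemann sphere, hence rational. At a
base point where they are holomorphic, their Taylor series along the lines of slope `τ` have
coefficients that are polynomials in `τ`, and such a series that is rational for every `τ` is
rational in both variables (`exists_rational_of_forall_rational`). This gives a polynomial one-form
proportional to the local ones near one point, hence everywhere by the identity theorem. One of
minimal degree has no zeros along curves, and therefore none off the singular set.
-/

/-! ### Complex analysis in one and two variables -/

/-- Uniqueness for linear differential inequalities: Grönwall on the segments issuing from `w₀`. -/
lemma eventually_eq_zero_of_norm_deriv_le {E : Type*} [NormedAddCommGroup E] [NormedSpace ℂ E]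
    {φ φ' : ℂ → E} {w₀ : ℂ} {C : ℝ}
    (h : ∀ᶠ w in 𝓝 w₀, HasDerivAt φ (φ' w) w ∧ ‖φ' w‖ ≤ C * ‖φ w‖) (h0 : φ w₀ = 0) :
    ∀ᶠ w in 𝓝 w₀, φ w = 0 := by
  let _ : NormedSpace ℝ E := NormedSpace.restrictScalars ℝ ℂ E
  obtain ⟨r, hr, hball⟩ := Metric.eventually_nhds_iff_ball.1 h
  filter_upwards [Metric.ball_mem_nhds w₀ hr] with w hw
  have hseg : ∀ t ∈ Icc (0 : ℝ) 1, w₀ + (t : ℂ) * (w - w₀) ∈ Metric.ball w₀ r := by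
    intro t ht
    rw [Metric.mem_ball, dist_eq_norm] at hw ⊢
    have : ‖w₀ + (t : ℂ) * (w - w₀) - w₀‖ = t * ‖w - w₀‖ := by
      rw [add_sub_cancel_left, norm_mul, Complex.norm_real, Real.norm_of_nonneg ht.1]
    rw [this]
    nlinarith [norm_nonneg (w - w₀), ht.1, ht.2]
  have hd : ∀ t ∈ Icc (0 : ℝ) 1, HasDerivAt (fun t : ℝ => φ (w₀ + (t : ℂ) * (w - w₀)))
      ((w - w₀) • φ' (w₀ + (t : ℂ) * (w - w₀))) t := by
    intro t ht
    have h1 : HasDerivAt (fun t : ℝ => w₀ + (t : ℂ) * (w - w₀)) (w - w₀) t := by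
      simpa using ((Complex.ofRealCLM.hasDerivAt (x := t)).mul_const (w - w₀)).const_add w₀
    exact (hball _ (hseg t ht)).1.scomp t h1
  have := eq_zero_of_abs_deriv_le_mul_abs_self_of_eq_zero_right
    (f := fun t : ℝ => φ (w₀ + (t : ℂ) * (w - w₀)))
    (f' := fun t : ℝ => (w - w₀) • φ' (w₀ + (t : ℂ) * (w - w₀))) (K := ‖w - w₀‖ * C)
    (a := 0) (b := 1) (fun t ht => (hd t ht).continuousAt.continuousWithinAt)
    (fun t ht => (hd t (Ico_subset_Icc_self ht)).hasDerivWithinAt) (by simpa using h0)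
    (fun t ht => by
      rw [norm_smul, mul_assoc]
      exact mul_le_mul_of_nonneg_left (hball _ (hseg t (Ico_subset_Icc_self ht))).2
        (norm_nonneg _)) 1 (by simp)
  simpa using this

/-- An entire function of polynomial growth is a polynomial. -/
lemma exists_polynomial_of_differentiable (m : ℕ) : ∀ {f : ℂ → ℂ} {C : ℝ}, Differentiable ℂ f →
    (∀ z, ‖f z‖ ≤ C * (1 + ‖z‖) ^ m) → ∃ p : Polynomial ℂ, ∀ z, f z = p.eval z := by
  induction m with
  | zero =>
    intro f C hf hb
    obtain ⟨c, hc⟩ := hf.exists_const_forall_eq_of_bounded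
      ((Metric.isBounded_closedBall (x := (0 : ℂ)) (r := C)).subset (by
        rintro _ ⟨z, rfl⟩; simpa using hb z))
    exact ⟨Polynomial.C c, fun z => by simp [hc]⟩
  | succ m ih =>
    intro f C hf hb
    have hg : Differentiable ℂ (dslope f 0) := by
      rw [← differentiableOn_univ]
      exact (Complex.differentiableOn_dslope univ_mem).2 hf.differentiableOn
    obtain ⟨M, hM⟩ := (isCompact_closedBall (0 : ℂ) 1).exists_bound_of_continuousOn
      hg.continuous.continuousOn
    have hC : 0 ≤ C := by
      have := (norm_nonneg _).trans (hb 0)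
      simpa using this
    have hM0 : 0 ≤ M := (norm_nonneg _).trans (hM 0 (by simp))
    obtain ⟨p, hp⟩ := ih (C := 4 * C + M) hg (by
      intro z
      have h1 : (1 : ℝ) ≤ (1 + ‖z‖) ^ m := one_le_pow₀ (by linarith [norm_nonneg z])
      rcases le_or_gt ‖z‖ 1 with hz | hz
      · have := hM z (by simpa using hz)
        nlinarith
      · have hz0 : z ≠ 0 := by rintro rfl; simp at hz; linarith
        rw [dslope_of_ne _ hz0, slope_def_field, norm_div, sub_zero, div_le_iff₀ (by linarith)]
        calc ‖f z - f 0‖ ≤ ‖f z‖ + ‖f 0‖ := norm_sub_le _ _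
          _ ≤ C * (1 + ‖z‖) ^ (m + 1) + C := add_le_add (hb z) (by simpa using hb 0)
          _ ≤ (4 * C + M) * (1 + ‖z‖) ^ m * ‖z‖ := by
            rw [pow_succ]
            nlinarith [mul_nonneg hC (sub_nonneg.2 h1), mul_nonneg hM0 (norm_nonneg z),
              mul_nonneg (mul_nonneg hC (zero_le_one.trans h1)) (sub_nonneg.2 hz.le),
              mul_nonneg (mul_nonneg hM0 (zero_le_one.trans h1)) (norm_nonneg z)])
    refine ⟨Polynomial.C (f 0) + Polynomial.X * p, fun z => ?_⟩
    simp only [Polynomial.eval_add, Polynomial.eval_C, Polynomial.eval_mul, Polynomial.eval_X, ← hp]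
    have := sub_smul_dslope f 0 z
    simp only [sub_zero, smul_eq_mul] at this
    rw [this]; ring

/-- A function holomorphic off a finite set and of polynomial growth there is a polynomial: the
singularities are removable. -/
lemma exists_polynomial_of_differentiableOn_compl {B : Set ℂ} (hB : B.Finite) :
    ∀ {f : ℂ → ℂ} {C : ℝ} {m : ℕ}, DifferentiableOn ℂ f Bᶜ →
    (∀ z ∉ B, ‖f z‖ ≤ C * (1 + ‖z‖) ^ m) → ∃ p : Polynomial ℂ, ∀ z ∉ B, f z = p.eval z := by
  induction B, hB using Set.Finite.induction_on with
  | empty =>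
    intro f C m hf hb
    obtain ⟨p, hp⟩ := exists_polynomial_of_differentiable m
      (differentiableOn_univ.1 (by simpa using hf)) (fun z => hb z (by simp))
    exact ⟨p, fun z _ => hp z⟩
  | @insert c B hc hB ih =>
    intro f C m hf hb
    have hn : Bᶜ ∈ 𝓝 c := hB.isClosed.isOpen_compl.mem_nhds hc
    have hset : (insert c B)ᶜ = Bᶜ \ {c} := by ext z; simp; tauto
    rw [hset] at hf
    have hmem : ∀ᶠ z in 𝓝[≠] c, z ∉ insert c B := by
      filter_upwards [nhdsWithin_le_nhds hn, self_mem_nhdsWithin] with z h1 h2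
      simp only [mem_insert_iff, not_or]
      exact ⟨h2, h1⟩
    have hbd : ∀ᶠ z in 𝓝[≠] c, ‖f z‖ ≤ C * (1 + ‖z‖) ^ m := hmem.mono hb
    have hcont : Tendsto (fun z : ℂ => C * (1 + ‖z‖) ^ m) (𝓝[≠] c) (𝓝 (C * (1 + ‖c‖) ^ m)) :=
      (Continuous.tendsto (by fun_prop) c).mono_left nhdsWithin_le_nhds
    have ho : (fun z => f z - f c) =o[𝓝[≠] c] fun z => (z - c)⁻¹ := by
      have h1 : (fun z => f z - f c) =O[𝓝[≠] c] fun _ => (1 : ℝ) := by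
        refine Asymptotics.IsBigO.of_bound (C * (1 + ‖c‖) ^ m + 1 + ‖f c‖) ?_
        filter_upwards [hbd, hcont.eventually_lt_const (lt_add_one _)] with z h2 h3
        simp only [norm_one, mul_one]
        exact (norm_sub_le _ _).trans (by linarith)
      refine h1.trans_isLittleO ?_
      rw [Asymptotics.isLittleO_one_left_iff]
      refine (tendsto_norm_inv_nhdsNE_zero_atTop (α := ℂ)).comp ?_
      refine tendsto_nhdsWithin_iff.2 ⟨?_, ?_⟩
      · have : Tendsto (fun z : ℂ => z - c) (𝓝 c) (𝓝 (c - c)) :=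
          (continuous_id.sub continuous_const).tendsto c
        rw [sub_self] at this
        exact this.mono_left nhdsWithin_le_nhds
      · filter_upwards [self_mem_nhdsWithin] with z hz
        exact sub_ne_zero.2 hz
    have hd := Complex.differentiableOn_update_limUnder_of_isLittleO hn hf ho
    set g := Function.update f c (limUnder (𝓝[≠] c) f) with hgdef
    have hgf : ∀ z ≠ c, g z = f z := fun z hz => Function.update_of_ne hz _ _
    obtain ⟨p, hp⟩ := ih (C := C) (m := m) hd (by
      intro z hz
      by_cases hzc : z = c
      · subst hzc
        have hg : Tendsto (fun z => ‖g z‖) (𝓝[≠] z) (𝓝 ‖g z‖) :=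
          ((hd.continuousOn.continuousAt hn).norm.tendsto).mono_left nhdsWithin_le_nhds
        refine le_of_tendsto_of_tendsto hg hcont ?_
        filter_upwards [hbd, self_mem_nhdsWithin] with w h1 h2
        rwa [hgf w h2]
      · rw [hgf z hzc]
        exact hb z (by simp [hzc, hz]))
    refine ⟨p, fun z hz => ?_⟩
    simp only [mem_insert_iff, not_or] at hz
    rw [← hgf z hz.1, hp z hz.2]

/-- A function meromorphic on the Riemann sphere is rational. -/
lemma exists_polynomial_mul_eq_of_meromorphic {Φ : ℂ → ℂ} (h : ∀ z, MeromorphicAt Φ z)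
    (hinf : MeromorphicAt (fun s => Φ s⁻¹) 0) :
    ∃ (p q : Polynomial ℂ) (B : Set ℂ), q ≠ 0 ∧ B.Finite ∧
      ∀ z ∉ B, q.eval z * Φ z = p.eval z := by
  -- near infinity `Φ` is holomorphic and of polynomial growth
  obtain ⟨R, n, C₁, hR, hC₁, hfar⟩ : ∃ (R : ℝ) (n : ℕ) (C₁ : ℝ), 0 < R ∧ 0 ≤ C₁ ∧
      ∀ z, R < ‖z‖ → DifferentiableAt ℂ Φ z ∧ ‖Φ z‖ ≤ C₁ * (1 + ‖z‖) ^ n := by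
    obtain ⟨n, hn⟩ := id hinf
    have h1 := hinf.eventually_analyticAt
    have h2 := hn.continuousAt.norm.eventually_lt_const (lt_add_one _)
    set C₁ := ‖(0 - 0 : ℂ) ^ n • Φ 0⁻¹‖ + 1
    have h3 := (eventually_nhdsWithin_iff.1 h1).and h2
    obtain ⟨ε, hε, hball⟩ := Metric.eventually_nhds_iff_ball.1 h3
    refine ⟨ε⁻¹, n, C₁, inv_pos.2 hε, by positivity, fun z hz => ?_⟩
    have hz0 : z ≠ 0 := by
      rintro rfl; simp at hz; linarith
    have hzn : 0 < ‖z‖ := norm_pos_iff.2 hz0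
    have hmem : z⁻¹ ∈ Metric.ball (0 : ℂ) ε := by
      rw [mem_ball_zero_iff, norm_inv]
      exact inv_lt_of_inv_lt₀ hε hz
    obtain ⟨h4, h5⟩ := hball _ hmem
    constructor
    · have h6 := (h4 (by simpa using hz0)).differentiableAt
      have h7 : DifferentiableAt ℂ (fun w : ℂ => Φ (w⁻¹)⁻¹) z :=
        DifferentiableAt.comp z (g := fun s => Φ s⁻¹) h6 (differentiableAt_inv hz0)
      simpa using h7
    · simp only [sub_zero, inv_inv, smul_eq_mul, norm_mul, norm_pow, norm_inv] at h5
      have h8 : ‖Φ z‖ ≤ C₁ * ‖z‖ ^ n := by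
        rw [inv_pow, inv_mul_lt_iff₀ (by positivity)] at h5
        linarith
      refine h8.trans ?_
      gcongr
      linarith
  -- on the remaining disc the finitely many poles are cancelled by a polynomial
  obtain ⟨q, B, C₂, hq, hB, hnear⟩ : ∃ (q : Polynomial ℂ) (B : Set ℂ) (C₂ : ℝ), q ≠ 0 ∧
      B.Finite ∧ ∀ z ∈ Metric.closedBall (0 : ℂ) R ∩ Metric.closedBall 0 R, z ∉ B →
        DifferentiableAt ℂ Φ z ∧ ‖q.eval z * Φ z‖ ≤ C₂ := by
    refine (isCompact_closedBall (0 : ℂ) R).induction_on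
      (p := fun s => ∃ (q : Polynomial ℂ) (B : Set ℂ) (C₂ : ℝ), q ≠ 0 ∧
        B.Finite ∧ ∀ z ∈ s ∩ Metric.closedBall 0 R, z ∉ B →
        DifferentiableAt ℂ Φ z ∧ ‖q.eval z * Φ z‖ ≤ C₂)
      ⟨1, ∅, 0, one_ne_zero, finite_empty, by simp⟩ ?_ ?_ ?_
    · rintro s t hst ⟨q, B, C₂, hq, hB, H⟩
      exact ⟨q, B, C₂, hq, hB, fun z hz => H z ⟨hst hz.1, hz.2⟩⟩
    · rintro s t ⟨q, B, C, hq, hB, H⟩ ⟨q', B', C', hq', hB', H'⟩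
      obtain ⟨M, hM⟩ := (isCompact_closedBall (0 : ℂ) R).exists_bound_of_continuousOn
        (f := fun z => q.eval z) q.continuous.continuousOn
      obtain ⟨M', hM'⟩ := (isCompact_closedBall (0 : ℂ) R).exists_bound_of_continuousOn
        (f := fun z => q'.eval z) q'.continuous.continuousOn
      refine ⟨q * q', B ∪ B', max (C * M') (C' * M), mul_ne_zero hq hq', hB.union hB', ?_⟩
      rintro z ⟨hz | hz, hzR⟩ hzB
      · simp only [mem_union, not_or] at hzB
        obtain ⟨h1, h2⟩ := H z ⟨hz, hzR⟩ hzB.1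
        refine ⟨h1, le_max_of_le_left ?_⟩
        rw [Polynomial.eval_mul, mul_right_comm, norm_mul]
        exact mul_le_mul h2 (hM' z hzR) (norm_nonneg _) ((norm_nonneg _).trans h2)
      · simp only [mem_union, not_or] at hzB
        obtain ⟨h1, h2⟩ := H' z ⟨hz, hzR⟩ hzB.2
        refine ⟨h1, le_max_of_le_right ?_⟩
        rw [Polynomial.eval_mul, mul_assoc, mul_comm, norm_mul]
        exact mul_le_mul h2 (hM z hzR) (norm_nonneg _) ((norm_nonneg _).trans h2)
    · intro x _
      obtain ⟨n, hn⟩ := id (h x)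
      have h1 := eventually_nhdsWithin_iff.1 (h x).eventually_analyticAt
      have h2 := hn.continuousAt.norm.eventually_lt_const (lt_add_one _)
      refine ⟨_, nhdsWithin_le_nhds (h1.and h2), (Polynomial.X - Polynomial.C x) ^ n, {x},
        ‖(x - x) ^ n • Φ x‖ + 1, pow_ne_zero _ (Polynomial.X_sub_C_ne_zero x),
        finite_singleton x, ?_⟩
      rintro z ⟨⟨h3, h4⟩, -⟩ hzx
      exact ⟨(h3 hzx).differentiableAt, by simpa using h4.le⟩
  have hC₂ : ∀ z ∈ Metric.closedBall (0 : ℂ) R, z ∉ B →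
      DifferentiableAt ℂ Φ z ∧ ‖q.eval z * Φ z‖ ≤ C₂ := fun z hz => hnear z ⟨hz, hz⟩
  obtain ⟨C₃, k, hC₃, hqk⟩ : ∃ (C₃ : ℝ) (k : ℕ), 0 ≤ C₃ ∧
      ∀ z, ‖q.eval z‖ ≤ C₃ * (1 + ‖z‖) ^ k := by
    refine ⟨∑ i ∈ Finset.range (q.natDegree + 1), ‖q.coeff i‖, q.natDegree,
      Finset.sum_nonneg fun _ _ => norm_nonneg _, fun z => ?_⟩
    rw [Polynomial.eval_eq_sum_range, Finset.sum_mul]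
    refine (norm_sum_le _ _).trans (Finset.sum_le_sum fun i hi => ?_)
    rw [norm_mul, norm_pow]
    refine mul_le_mul_of_nonneg_left ?_ (norm_nonneg _)
    calc ‖z‖ ^ i ≤ (1 + ‖z‖) ^ i := by gcongr; linarith
      _ ≤ (1 + ‖z‖) ^ q.natDegree :=
        pow_le_pow_right₀ (by linarith [norm_nonneg z]) (by simpa [Nat.lt_succ_iff] using hi)
  obtain ⟨p, hp⟩ := exists_polynomial_of_differentiableOn_compl hB
    (f := fun z => q.eval z * Φ z) (C := |C₂| + C₃ * C₁) (m := k + n) (by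
      intro z hz
      refine DifferentiableAt.differentiableWithinAt (q.differentiable.differentiableAt.mul ?_)
      rcases le_or_gt ‖z‖ R with h1 | h1
      · exact (hC₂ z (by simpa using h1) hz).1
      · exact (hfar z h1).1) (by
      intro z hz
      have h1 : (1 : ℝ) ≤ (1 + ‖z‖) ^ (k + n) := one_le_pow₀ (by linarith [norm_nonneg z])
      have h2 : 0 ≤ C₃ * C₁ := mul_nonneg hC₃ hC₁
      rcases le_or_gt ‖z‖ R with h3 | h3
      · have h4 := (hC₂ z (by simpa using h3) hz).2
        have h5 := le_abs_self C₂
        nlinarith [abs_nonneg C₂]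
      · rw [norm_mul]
        calc ‖q.eval z‖ * ‖Φ z‖ ≤ (C₃ * (1 + ‖z‖) ^ k) * (C₁ * (1 + ‖z‖) ^ n) :=
              mul_le_mul (hqk z) (hfar z h3).2 (norm_nonneg _) (by positivity)
          _ = C₃ * C₁ * (1 + ‖z‖) ^ (k + n) := by rw [pow_add]; ring
          _ ≤ _ := by nlinarith [abs_nonneg C₂])
  exact ⟨p, q, B, hq, hB, hp⟩

/-- The zeros of a holomorphic function of two variables are not isolated: otherwise the maximum
principle for `1 / h` on the slices `y = const` bounds `|h|` from below near the zero. -/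
lemma frequently_eq_zero_of_two_variables {h : ℂ × ℂ → ℂ} {u : ℂ × ℂ}
    (hd : ∀ᶠ v in 𝓝 u, DifferentiableAt ℂ h v) (hu : h u = 0) : ∃ᶠ v in 𝓝[≠] u, h v = 0 := by
  intro hne
  have hev := hd.and (eventually_nhdsWithin_iff.1 hne)
  obtain ⟨r, hr, hball⟩ := (Metric.nhds_basis_closedBall (x := u)).eventually_iff.1 hev
  have hdiff : ∀ v ∈ Metric.closedBall u r, DifferentiableAt ℂ h v := fun v hv => (hball hv).1
  have hnz : ∀ v ∈ Metric.closedBall u r, v ≠ u → h v ≠ 0 := fun v hv => (hball hv).2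
  obtain ⟨x₀, y₀⟩ := u
  have hprod : ∀ x ∈ Metric.closedBall x₀ r, ∀ y ∈ Metric.closedBall y₀ r,
      (x, y) ∈ Metric.closedBall (x₀, y₀) r := by
    intro x hx y hy
    rw [← closedBall_prod_same]
    exact ⟨hx, hy⟩
  have hK : IsCompact (Metric.sphere x₀ r ×ˢ Metric.closedBall y₀ r) :=
    (isCompact_sphere _ _).prod (isCompact_closedBall _ _)
  have hcK : ContinuousOn (fun v => ‖(h v)⁻¹‖) (Metric.sphere x₀ r ×ˢ Metric.closedBall y₀ r) := by
    rintro ⟨x, y⟩ ⟨hx, hy⟩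
    have h1 := hprod x (Metric.sphere_subset_closedBall hx) y hy
    refine ((hdiff _ h1).continuousAt.inv₀ (hnz _ h1 ?_)).norm.continuousWithinAt
    intro he
    simp only [Prod.mk.injEq] at he
    rw [he.1] at hx
    simp only [mem_sphere_iff_norm, sub_self, norm_zero] at hx
    exact hr.ne hx
  obtain ⟨M, hM⟩ := hK.exists_bound_of_continuousOn hcK
  have hy : ∀ᶠ y in 𝓝[≠] y₀, (1 : ℝ) ≤ M * ‖h (x₀, y)‖ := by
    filter_upwards [nhdsWithin_le_nhds (Metric.closedBall_mem_nhds y₀ hr), self_mem_nhdsWithin]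
      with y hy hyne
    have hnz' : ∀ x ∈ Metric.closedBall x₀ r, h (x, y) ≠ 0 := fun x hx =>
      hnz _ (hprod x hx y hy) (by simp only [ne_eq, Prod.mk.injEq, not_and]; exact fun _ => hyne)
    have hdx : ∀ x ∈ Metric.closedBall x₀ r, DifferentiableAt ℂ (fun x => (h (x, y))⁻¹) x := by
      intro x hx
      refine DifferentiableAt.inv ?_ (hnz' x hx)
      exact DifferentiableAt.comp x (g := h) (f := fun x => (x, y)) (hdiff _ (hprod x hx y hy))
        (differentiableAt_id.prodMk (differentiableAt_const y))
    have := Complex.norm_le_of_forall_mem_frontier_norm_le (f := fun x => (h (x, y))⁻¹)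
      (U := Metric.ball x₀ r) Metric.isBounded_ball (C := M)
      (by
        refine DifferentiableOn.diffContOnCl ?_
        rw [closure_ball _ hr.ne']
        exact fun x hx => (hdx x hx).differentiableWithinAt)
      (by
        intro x hx
        rw [frontier_ball _ hr.ne'] at hx
        simpa using hM (x, y) ⟨hx, hy⟩)
      (z := x₀) (subset_closure (Metric.mem_ball_self hr))
    have hpos : 0 < ‖h (x₀, y)‖ := norm_pos_iff.2 (hnz' x₀ (Metric.mem_closedBall_self hr.le))
    rw [norm_inv] at this
    rwa [inv_le_iff_one_le_mul₀ hpos] at this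
  have hlim : Tendsto (fun y => M * ‖h (x₀, y)‖) (𝓝[≠] y₀) (𝓝 (M * ‖h (x₀, y₀)‖)) := by
    refine Tendsto.mono_left ?_ nhdsWithin_le_nhds
    refine Tendsto.const_mul _ (Tendsto.norm ?_)
    have h1 : ContinuousAt (fun y => (x₀, y)) y₀ := by fun_prop
    exact ContinuousAt.comp (g := h) (f := fun y => (x₀, y)) (x := y₀)
      (hdiff _ (Metric.mem_closedBall_self hr.le)).continuousAt h1
  have := ge_of_tendsto hlim hy
  rw [hu] at this
  norm_num at this

/-- Local existence for holomorphic autonomous differential equations in complex time. The Picard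
iterates are formed with primitives on a disc and converge uniformly there. -/
lemma exists_hasDerivAt_of_contDiffAt {E : Type*} [NormedAddCommGroup E] [NormedSpace ℂ E]
    [CompleteSpace E] {V : E → E} {u : E} (hV : ContDiffAt ℂ 1 V u) :
    ∃ (r : ℝ) (g : ℂ → E), 0 < r ∧ g 0 = u ∧
      ∀ z ∈ Metric.ball (0 : ℂ) r, HasDerivAt g (V (g z)) z := by
  obtain ⟨L, s, hs, hL⟩ := hV.exists_lipschitzOnWith
  have hdV : ∀ᶠ v in 𝓝 u, DifferentiableAt ℂ V v :=
    (hV.eventually (by simp)).mono fun v hv => hv.differentiableAt (by simp)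
  obtain ⟨ρ, hρ, hball⟩ :=
    (Metric.nhds_basis_closedBall (x := u)).eventually_iff.1 (hdV.and hs)
  have hlip : ∀ v ∈ Metric.closedBall u ρ, ∀ w ∈ Metric.closedBall u ρ,
      ‖V v - V w‖ ≤ L * ‖v - w‖ := fun v hv w hw => by
    simpa [dist_eq_norm] using hL.dist_le_mul v (hball hv).2 w (hball hw).2
  set M : ℝ := ‖V u‖ + L * ρ with hM
  have hbd : ∀ v ∈ Metric.closedBall u ρ, ‖V v‖ ≤ M := fun v hv => by
    have h1 := hlip v hv u (Metric.mem_closedBall_self hρ.le)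
    have h2 : ‖v - u‖ ≤ ρ := by simpa [dist_eq_norm] using hv
    have h3 : ‖V v‖ ≤ ‖V v - V u‖ + ‖V u‖ := by simpa using norm_add_le (V v - V u) (V u)
    nlinarith [mul_le_mul_of_nonneg_left h2 L.coe_nonneg]
  have hM0 : 0 ≤ M := by positivity
  obtain ⟨r, hr, hrM, hrL⟩ : ∃ r : ℝ, 0 < r ∧ r * M ≤ ρ ∧ r * L ≤ 1 / 2 := by
    refine ⟨min (ρ / (M + 1)) (1 / (2 * (L + 1))), lt_min (by positivity) (by positivity), ?_, ?_⟩
    · refine (mul_le_mul_of_nonneg_right (min_le_left _ _) hM0).trans ?_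
      rw [div_mul_eq_mul_div, div_le_iff₀ (by positivity)]
      nlinarith
    · refine (mul_le_mul_of_nonneg_right (min_le_right _ _) L.coe_nonneg).trans ?_
      rw [div_mul_eq_mul_div, div_le_iff₀ (by positivity)]
      nlinarith [L.coe_nonneg]
  -- the Picard iteration
  let S : Type _ := {g : ℂ → E // DifferentiableOn ℂ g (Metric.ball 0 r) ∧ g 0 = u ∧
    ∀ z ∈ Metric.ball (0 : ℂ) r, g z ∈ Metric.closedBall u ρ}
  have hdist : ∀ {g : ℂ → E} {g' : ℂ → E} {K : ℝ}, g 0 = 0 →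
      (∀ z ∈ Metric.ball (0 : ℂ) r, HasDerivAt g (g' z) z) →
      (∀ z ∈ Metric.ball (0 : ℂ) r, ‖g' z‖ ≤ K) → 0 ≤ K →
      ∀ z ∈ Metric.ball (0 : ℂ) r, ‖g z‖ ≤ r * K := by
    intro g g' K h0 h1 h2 hK z hz
    have := (convex_ball (0 : ℂ) r).norm_image_sub_le_of_norm_hasDerivWithin_le
      (fun w hw => (h1 w hw).hasDerivWithinAt) h2 (Metric.mem_ball_self hr) hz
    rw [h0, sub_zero, sub_zero] at this
    have hz' : ‖z‖ < r := by simpa using hz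
    nlinarith
  have hstep : ∀ g : S, ∃ g' : S, ∀ z ∈ Metric.ball (0 : ℂ) r,
      HasDerivAt g'.1 (V (g.1 z)) z := by
    rintro ⟨g, hg, hg0, hgb⟩
    have hVg : DifferentiableOn ℂ (fun z => V (g z)) (Metric.ball 0 r) := fun z hz =>
      (DifferentiableAt.comp z (hball (hgb z hz)).1
        (hg.differentiableAt (Metric.isOpen_ball.mem_nhds hz))).differentiableWithinAt
    obtain ⟨G, hG0, hG⟩ := hVg.isExactOn_ball.with_val_at 0 u
    refine ⟨⟨G, fun z hz => (hG z hz).differentiableAt.differentiableWithinAt, hG0, ?_⟩, hG⟩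
    intro z hz
    rw [Metric.mem_closedBall, dist_eq_norm]
    refine (hdist (g := fun z => G z - u) (by simp [hG0]) (fun z hz => (hG z hz).sub_const u)
      (fun z hz => hbd _ (hgb z hz)) hM0 z hz).trans hrM
  choose T hT using hstep
  let g : ℕ → S := fun n => T^[n] ⟨fun _ => u, differentiableOn_const u, rfl,
    fun _ _ => Metric.mem_closedBall_self hρ.le⟩
  have hgsucc : ∀ n, g (n + 1) = T (g n) := fun n => Function.iterate_succ_apply' _ _ _
  have hgd : ∀ n, ∀ z ∈ Metric.ball (0 : ℂ) r, HasDerivAt (g (n + 1)).1 (V ((g n).1 z)) z := by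
    intro n
    rw [hgsucc]
    exact hT _
  have hgeom : ∀ n, ∀ z ∈ Metric.ball (0 : ℂ) r,
      dist ((g n).1 z) ((g (n + 1)).1 z) ≤ 2 * ρ * (1 / 2) ^ n := by
    intro n
    induction n with
    | zero =>
      intro z hz
      have h1 := (g 0).2.2.2 z hz
      have h2 := (g (0 + 1)).2.2.2 z hz
      rw [Metric.mem_closedBall] at h1 h2
      have := dist_triangle_right ((g 0).1 z) ((g (0 + 1)).1 z) u
      simp only [pow_zero, mul_one]
      linarith
    | succ n ih =>
      intro z hz
      rw [dist_comm, dist_eq_norm]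
      have := hdist (g := fun z => (g (n + 1 + 1)).1 z - (g (n + 1)).1 z)
        (g' := fun z => V ((g (n + 1)).1 z) - V ((g n).1 z))
        (K := L * (2 * ρ * (1 / 2) ^ n)) (by simp [(g _).2.2.1])
        (fun z hz => (hgd (n + 1) z hz).sub (hgd n z hz)) (by
          intro z hz
          refine (hlip _ ((g _).2.2.2 z hz) _ ((g _).2.2.2 z hz)).trans ?_
          refine mul_le_mul_of_nonneg_left ?_ L.coe_nonneg
          rw [← dist_eq_norm, dist_comm]
          exact ih z hz) (by positivity) z hz
      refine this.trans ?_
      rw [← mul_assoc, pow_succ]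
      have hp : 0 ≤ 2 * ρ * (1 / 2 : ℝ) ^ n := by positivity
      nlinarith
  have hlim : ∀ z ∈ Metric.ball (0 : ℂ) r, ∃ y, Tendsto (fun n => (g n).1 z) atTop (𝓝 y) :=
    fun z hz => cauchySeq_tendsto_of_complete
      (cauchySeq_of_le_geometric (1 / 2) (2 * ρ) (by norm_num) fun n => hgeom n z hz)
  choose! f hf using hlim
  have hunif : TendstoUniformlyOn (fun n => (g n).1) f atTop (Metric.ball (0 : ℂ) r) := by
    rw [Metric.tendstoUniformlyOn_iff]
    intro ε hε
    have h1 : Tendsto (fun n : ℕ => 2 * ρ * (1 / 2 : ℝ) ^ n / (1 - 1 / 2)) atTop (𝓝 0) := by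
      have := (tendsto_pow_atTop_nhds_zero_of_lt_one (r := (1 / 2 : ℝ)) (by norm_num)
        (by norm_num)).const_mul (2 * ρ)
      simpa using this.div_const (1 - 1 / 2)
    filter_upwards [h1.eventually_lt_const hε] with n hn z hz
    rw [dist_comm]
    exact (dist_le_of_le_geometric_of_tendsto (1 / 2) (2 * ρ) (by norm_num)
      (fun n => hgeom n z hz) (hf z hz) n).trans_lt hn
  have hlu := hunif.tendstoLocallyUniformlyOn
  have hgdiff : ∀ᶠ n in atTop, DifferentiableOn ℂ (g n).1 (Metric.ball (0 : ℂ) r) :=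
    Eventually.of_forall fun n => (g n).2.1
  have hfd := hlu.differentiableOn hgdiff Metric.isOpen_ball
  have hder := hlu.deriv hgdiff Metric.isOpen_ball
  refine ⟨r, f, hr, ?_, fun z hz => ?_⟩
  · refine tendsto_nhds_unique (hf 0 (Metric.mem_ball_self hr)) ?_
    simp only [(g _).2.2.1]
    exact tendsto_const_nhds
  · have h1 : Tendsto (fun n => deriv (g (n + 1)).1 z) atTop (𝓝 (deriv f z)) :=
      (hder.tendsto_at hz).comp (tendsto_add_atTop_nat 1)
    have hmem : f z ∈ Metric.closedBall u ρ :=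
      Metric.isClosed_closedBall.mem_of_tendsto (hf z hz)
        (Eventually.of_forall fun n => (g n).2.2.2 z hz)
    have h2 : Tendsto (fun n => deriv (g (n + 1)).1 z) atTop (𝓝 (V (f z))) := by
      have := (hball hmem).1.continuousAt.tendsto.comp (hf z hz)
      refine this.congr fun n => ?_
      exact (hgd n z hz).deriv.symm
    rw [← tendsto_nhds_unique h1 h2]
    exact (hfd.differentiableAt (Metric.isOpen_ball.mem_nhds hz)).hasDerivAt

/-! ### Homogeneous polynomials -/

namespace MvPolynomial

/-- The substitution `X i ↦ X i * T`, which makes the grading by degree visible as the grading by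
powers of the auxiliary variable `T`. -/
noncomputable def gradingHom (σ R : Type*) [CommRing R] :
    MvPolynomial σ R →ₐ[R] Polynomial (MvPolynomial σ R) :=
  aeval fun i => Polynomial.C (X i) * Polynomial.X

lemma IsHomogeneous.gradingHom_eq {σ R : Type*} [CommRing R] {f : MvPolynomial σ R} {n : ℕ}
    (hf : f.IsHomogeneous n) : gradingHom σ R f = Polynomial.C f * Polynomial.X ^ n := by
  have key : ∀ s ∈ f.support, gradingHom σ R (monomial s (f.coeff s)) =
      Polynomial.C (monomial s (f.coeff s)) * Polynomial.X ^ n := by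
    intro s hs
    have hdeg := hf.degree_eq_sum_deg_support hs
    rw [gradingHom, aeval_monomial, monomial_eq, hdeg, Finsupp.prod, Finsupp.prod,
      Finset.prod_congr rfl fun i _ => mul_pow _ _ _, Finset.prod_mul_distrib,
      Finset.prod_pow_eq_pow_sum, map_mul, map_prod, ← mul_assoc]
    simp only [map_pow]
    rfl
  conv_lhs => rw [f.as_sum, map_sum, Finset.sum_congr rfl key, ← Finset.sum_mul, ← map_sum,
    ← f.as_sum]

lemma coeff_gradingHom {σ R : Type*} [CommRing R] (f : MvPolynomial σ R) (k : ℕ) :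
    (gradingHom σ R f).coeff k = homogeneousComponent k f := by
  conv_lhs => rw [← f.sum_homogeneousComponent, map_sum, Polynomial.finsetSum_coeff]
  have key : ∀ i ∈ Finset.range (f.totalDegree + 1),
      (gradingHom σ R (homogeneousComponent i f)).coeff k =
        if i = k then homogeneousComponent k f else 0 := by
    intro i _
    rw [(homogeneousComponent_isHomogeneous i f).gradingHom_eq, Polynomial.coeff_C_mul_X_pow]
    by_cases h : i = k
    · simp [h]
    · simp [h, Ne.symm h]
  rw [Finset.sum_congr rfl key, Finset.sum_ite_eq']
  split_ifs with h
  · rfl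
  · exact (homogeneousComponent_eq_zero k f (by simpa [Nat.lt_succ_iff] using h)).symm

/-- The factors of a nonzero homogeneous polynomial are homogeneous. -/
lemma IsHomogeneous.exists_of_mul {σ R : Type*} [CommRing R] [IsDomain R] {f g : MvPolynomial σ R}
    {n : ℕ} (h : (f * g).IsHomogeneous n) (hf : f ≠ 0) (hg : g ≠ 0) :
    ∃ a, f.IsHomogeneous a := by
  have hinj : ∀ p : MvPolynomial σ R, p ≠ 0 → gradingHom σ R p ≠ 0 := by
    intro p hp h0
    apply hp
    rw [← p.sum_homogeneousComponent]
    refine Finset.sum_eq_zero fun i _ => ?_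
    rw [← coeff_gradingHom, h0, Polynomial.coeff_zero]
  have hfg := mul_ne_zero hf hg
  have h1 := h.gradingHom_eq
  rw [map_mul] at h1
  have hd := congrArg Polynomial.natDegree h1
  have ht := congrArg Polynomial.natTrailingDegree h1
  rw [Polynomial.natDegree_mul (hinj f hf) (hinj g hg), Polynomial.natDegree_C_mul_X_pow _ _ hfg]
    at hd
  rw [Polynomial.natTrailingDegree_mul (hinj f hf) (hinj g hg), Polynomial.C_mul_X_pow_eq_monomial,
    Polynomial.natTrailingDegree_monomial hfg] at ht
  have h2 := Polynomial.natTrailingDegree_le_natDegree (gradingHom σ R f)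
  have h3 := Polynomial.natTrailingDegree_le_natDegree (gradingHom σ R g)
  refine ⟨(gradingHom σ R f).natDegree, ?_⟩
  have h4 : f = homogeneousComponent (gradingHom σ R f).natDegree f := by
    conv_lhs => rw [← f.sum_homogeneousComponent]
    refine (Finset.sum_eq_single _ (fun i _ hi => ?_) fun hi => ?_)
    · rw [← coeff_gradingHom]
      rcases lt_or_gt_of_ne hi with hi | hi
      · exact Polynomial.coeff_eq_zero_of_lt_natTrailingDegree (by omega)
      · exact Polynomial.coeff_eq_zero_of_natDegree_lt hi
    · exact homogeneousComponent_eq_zero _ f (by simpa [Nat.lt_succ_iff] using hi)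
  have h5 := homogeneousComponent_isHomogeneous (gradingHom σ R f).natDegree f
  rwa [← h4] at h5

lemma IsHomogeneous.exists_of_dvd {σ R : Type*} [CommRing R] [IsDomain R] {f g : MvPolynomial σ R}
    {n : ℕ} (hg : g.IsHomogeneous n) (h0 : g ≠ 0) (h : f ∣ g) : ∃ a, f.IsHomogeneous a := by
  obtain ⟨q, rfl⟩ := h
  exact hg.exists_of_mul (left_ne_zero_of_mul h0) (right_ne_zero_of_mul h0)

lemma IsHomogeneous.eval_smul {σ R : Type*} [CommRing R] {f : MvPolynomial σ R}
    {n : ℕ} (hf : f.IsHomogeneous n) (c : R) (v : σ → R) :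
    eval (c • v) f = c ^ n * eval v f := by
  rw [eval_eq, eval_eq, Finset.mul_sum]
  refine Finset.sum_congr rfl fun s hs => ?_
  simp only [Pi.smul_apply, smul_eq_mul, mul_pow, Finset.prod_mul_distrib,
    Finset.prod_pow_eq_pow_sum, hf.degree_eq_sum_deg_support hs]
  ring

end MvPolynomial

/-- Elimination of the variable: by Gauss's lemma an irreducible `f` that does not divide `g` is
coprime to `g` over the field of fractions, and denominators can be cleared. -/
lemma Polynomial.exists_mul_add_mul_eq_C_of_irreducible {R : Type*} [CommRing R] [IsDomain R]
    [UniqueFactorizationMonoid R] {f g : Polynomial R} (hf : Irreducible f) (hfg : ¬ f ∣ g) :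
    ∃ (a b : Polynomial R) (d : R), d ≠ 0 ∧ a * f + b * g = Polynomial.C d := by
  classical
  rcases Nat.eq_zero_or_pos f.natDegree with h0 | hpos
  · obtain ⟨r, hr⟩ := Polynomial.natDegree_eq_zero.1 h0
    refine ⟨1, 0, r, ?_, by simp [hr]⟩
    rintro rfl
    exact hf.ne_zero (by simp [← hr])
  let _ : StrongNormalizationMonoid R := UniqueFactorizationMonoid.strongNormalizationMonoid
  let _ : NormalizedGCDMonoid R := UniqueFactorizationMonoid.toNormalizedGCDMonoid R
  let K := FractionRing R
  have hp : f.IsPrimitive := hf.isPrimitive hpos.ne'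
  have hK : Irreducible (f.map (algebraMap R K)) :=
    (hp.irreducible_iff_irreducible_map_fraction_map).1 hf
  have hco : IsCoprime (f.map (algebraMap R K)) (g.map (algebraMap R K)) :=
    (hK.coprime_iff_not_dvd).2 fun h => hfg (hp.dvd_of_fraction_map_dvd_fraction_map h)
  obtain ⟨u, v, huv⟩ := hco
  obtain ⟨b, hb, hu⟩ := IsLocalization.integerNormalization_spec (nonZeroDivisors R) u
  obtain ⟨c, hc, hv⟩ := IsLocalization.integerNormalization_spec (nonZeroDivisors R) v
  refine ⟨Polynomial.C c * IsLocalization.integerNormalization (nonZeroDivisors R) u,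
    Polynomial.C b * IsLocalization.integerNormalization (nonZeroDivisors R) v, b * c,
    mul_ne_zero (nonZeroDivisors.ne_zero hb) (nonZeroDivisors.ne_zero hc), ?_⟩
  apply Polynomial.map_injective (algebraMap R K) (IsFractionRing.injective R K)
  simp only [Polynomial.map_add, Polynomial.map_mul, Polynomial.map_C, hu, hv, map_mul,
    Algebra.smul_def, Polynomial.algebraMap_apply]
  linear_combination (Polynomial.C (algebraMap R K b) * Polynomial.C (algebraMap R K c)) * huv

namespace MvPolynomial

/-- A combination of `f` and `g` in which the variable `X i` does not occur. -/
lemma exists_mul_add_mul_eq_of_irreducible {f g : MvPolynomial (Fin 3) ℂ} (hf : Irreducible f)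
    (hfg : ¬ f ∣ g) (i : Fin 3) : ∃ a b d : MvPolynomial (Fin 3) ℂ, d ≠ 0 ∧ a * f + b * g = d ∧
      ∀ v w : Fin 3 → ℂ, (∀ j ≠ i, v j = w j) → eval v d = eval w d := by
  -- move the variable `X i` to the front
  let e : MvPolynomial (Fin 3) ℂ ≃ₐ[ℂ] Polynomial (MvPolynomial (Fin 2) ℂ) :=
    (renameEquiv ℂ (Equiv.swap 0 i)).trans (finSuccEquiv ℂ 2)
  obtain ⟨a, b, d, hd, h⟩ := Polynomial.exists_mul_add_mul_eq_C_of_irreducible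
    (f := e f) (g := e g) ((MulEquiv.irreducible_iff e).2 hf) (fun h => hfg ((map_dvd_iff e).1 h))
  have hd' : e.symm (Polynomial.C d) = rename (Equiv.swap 0 i) (rename Fin.succ d) := by
    rw [AlgEquiv.symm_apply_eq]
    change _ = finSuccEquiv ℂ 2 (rename (Equiv.swap 0 i)
      (rename (Equiv.swap 0 i) (rename Fin.succ d)))
    rw [rename_rename (Equiv.swap 0 i) (Equiv.swap 0 i), ← Equiv.coe_trans, Equiv.swap_swap,
      Equiv.coe_refl, rename_id_apply]
    clear hd h
    induction d using MvPolynomial.induction_on with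
    | C r => simp [finSuccEquiv_apply]
    | add p q hp hq => simp [hp, hq]
    | mul_X p k hp => simp only [map_mul, hp, rename_X, finSuccEquiv_X_succ]
  refine ⟨e.symm a, e.symm b, e.symm (Polynomial.C d), ?_, ?_, ?_⟩
  · simpa using hd
  · rw [← h]; simp
  · intro v w hvw
    rw [hd', eval_rename, eval_rename, eval_rename, eval_rename]
    congr 2
    funext k
    apply hvw
    intro hk
    have := (Equiv.swap_apply_eq_iff).1 hk
    rw [Equiv.swap_apply_right] at this
    exact Fin.succ_ne_zero _ this

end MvPolynomial

namespace CP2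

open MvPolynomial

lemma mem_zeroSet_mk {f : MvPolynomial (Fin 3) ℂ} {n : ℕ} (hf : f.IsHomogeneous n) {v : Fin 3 → ℂ}
    (hv : v ≠ 0) : Projectivization.mk ℂ v hv ∈ zeroSet f ↔ eval v f = 0 := by
  obtain ⟨a, ha⟩ := Projectivization.exists_smul_eq_mk_rep ℂ v hv
  change eval (Projectivization.mk ℂ v hv).rep f = 0 ↔ _
  rw [← ha, Units.smul_def, hf.eval_smul]
  simp

/-- The zeros of an irreducible `f` and of a `g` that is not a multiple of `f` in a given affine
chart have finitely many values of each affine coordinate. -/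
lemma finite_ratio {f g : MvPolynomial (Fin 3) ℂ} {m n : ℕ} (hf : Irreducible f)
    (hfm : f.IsHomogeneous m) (hgn : g.IsHomogeneous n) (hfg : ¬ f ∣ g) (j k : Fin 3)
    (hjk : j ≠ k) :
    {x : ℂ | ∃ v : Fin 3 → ℂ, v k ≠ 0 ∧ eval v f = 0 ∧ eval v g = 0 ∧ x = v j / v k}.Finite := by
  obtain ⟨i, hall⟩ : ∃ i : Fin 3, ∀ l, l ≠ i → ¬ l = j → ¬ l = k → False := by
    revert j k; decide
  obtain ⟨a, b, d, hd, h, hdi⟩ := exists_mul_add_mul_eq_of_irreducible hf hfg i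
  obtain ⟨w, hw⟩ : ∃ w, eval w (d * X k) ≠ 0 := by
    by_contra! hcon
    exact mul_ne_zero hd (X_ne_zero k) (MvPolynomial.funext fun w => by simpa using hcon w)
  simp only [map_mul, eval_X, mul_ne_zero_iff] at hw
  let e : Polynomial ℂ := aeval (fun l => if l = j then Polynomial.C (w k) * Polynomial.X else
    if l = k then Polynomial.C (w k) else 0) d
  have he : ∀ x, e.eval x = eval (fun l => if l = j then w k * x else
      if l = k then w k else 0) d := by
    intro x
    change (Polynomial.evalRingHom x) (aeval _ d) = _
    rw [map_aeval]
    have h1 : (Polynomial.evalRingHom x).comp (algebraMap ℂ (Polynomial ℂ)) = RingHom.id ℂ := by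
      ext y; simp
    rw [h1]
    change eval _ d = _
    congr 2
    funext l
    split_ifs <;> simp
  have he0 : e ≠ 0 := by
    intro h0
    have h1 := he (w j / w k)
    rw [h0, Polynomial.eval_zero] at h1
    apply hw.1
    rw [h1]
    refine hdi _ _ fun l hl => ?_
    split_ifs with h2 h3
    · rw [h2, mul_div_cancel₀ _ hw.2]
    · rw [h3]
    · exact (hall l hl h2 h3).elim
  refine (e.roots.toFinset.finite_toSet).subset ?_
  rintro x ⟨v, hvk, hvf, hvg, rfl⟩
  simp only [Finset.mem_coe, Multiset.mem_toFinset, Polynomial.mem_roots he0, Polynomial.IsRoot]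
  have h2 : eval ((w k / v k) • v) d = 0 := by
    rw [← h, map_add, map_mul, map_mul, hfm.eval_smul, hgn.eval_smul, hvf, hvg]
    simp
  rw [he, ← h2]
  refine hdi _ _ fun l hl => ?_
  simp only [Pi.smul_apply, smul_eq_mul]
  split_ifs with h2 h3
  · rw [h2]; ring
  · rw [h3, div_mul_cancel₀ _ hvk]
  · exact (hall l hl h2 h3).elim

/-- Weak form of Bézout's theorem. -/
lemma finite_inter_zeroSet {f g : MvPolynomial (Fin 3) ℂ} {m n : ℕ} (hf : Irreducible f)
    (hfm : f.IsHomogeneous m) (hgn : g.IsHomogeneous n) (hfg : ¬ f ∣ g) :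
    (zeroSet f ∩ zeroSet g).Finite := by
  have h1 : ∀ k : Fin 3, (zeroSet f ∩ zeroSet g ∩ affineSet k).Finite := by
    intro k
    have hfin : (Set.univ.pi fun l : Fin 2 => {x : ℂ | ∃ v : Fin 3 → ℂ, v k ≠ 0 ∧ eval v f = 0 ∧
        eval v g = 0 ∧ x = v (k.succAbove l) / v k}).Finite :=
      Set.Finite.pi fun l => finite_ratio hf hfm hgn hfg _ _ (Fin.succAbove_ne k l)
    refine Set.Finite.of_finite_image (f := affineChart k) (hfin.subset ?_)
      ((affineChart k).injOn.mono inter_subset_right)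
    rintro _ ⟨p, ⟨⟨hpf, hpg⟩, hpk⟩, rfl⟩
    induction p using Projectivization.ind with
    | h v hv =>
      rw [mem_zeroSet_mk hfm] at hpf
      rw [mem_zeroSet_mk hgn] at hpg
      intro l _
      exact ⟨v, hpk, hpf, hpg, rfl⟩
  refine ((finite_univ (α := Fin 3)).biUnion fun k _ => h1 k).subset ?_
  intro p hp
  obtain ⟨k, hk⟩ := exists_mem_affineSet p
  exact mem_biUnion (mem_univ k) ⟨hp, hk⟩

lemma dvd_of_infinite {f g : MvPolynomial (Fin 3) ℂ} {m n : ℕ} (hf : Irreducible f)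
    (hfm : f.IsHomogeneous m) (hgn : g.IsHomogeneous n)
    (h : (zeroSet f ∩ zeroSet g).Infinite) : f ∣ g := by
  by_contra hfg
  exact h (finite_inter_zeroSet hf hfm hgn hfg)

end CP2

/-! ### Integrating factors from invariant polynomials -/

namespace MvPolynomial

open scoped Matrix

/-- The gradient, which stands for the one-form `df`. Wedge products of one-forms on `ℂ³` are
encoded by cross products. -/
noncomputable def grad (f : MvPolynomial (Fin 3) ℂ) : Fin 3 → MvPolynomial (Fin 3) ℂ :=
  fun i => pderiv i f

lemma grad_mul (f g : MvPolynomial (Fin 3) ℂ) : grad (f * g) = f • grad g + g • grad f := by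
  funext i
  simp only [grad, Derivation.leibniz, Pi.add_apply, Pi.smul_apply, smul_eq_mul]

/-- The curl, which stands for the exterior derivative of a one-form. -/
noncomputable def curl (A : Fin 3 → MvPolynomial (Fin 3) ℂ) : Fin 3 → MvPolynomial (Fin 3) ℂ :=
  ![pderiv 1 (A 2) - pderiv 2 (A 1), pderiv 2 (A 0) - pderiv 0 (A 2),
    pderiv 0 (A 1) - pderiv 1 (A 0)]

lemma curl_smul (h : MvPolynomial (Fin 3) ℂ) (A : Fin 3 → MvPolynomial (Fin 3) ℂ) :
    curl (h • A) = grad h ⨯₃ A + h • curl A := by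
  funext i
  fin_cases i <;> simp [curl, cross_apply, grad] <;> ring

lemma curl_add (A B : Fin 3 → MvPolynomial (Fin 3) ℂ) : curl (A + B) = curl A + curl B := by
  funext i
  fin_cases i <;> simp [curl] <;> ring

lemma curl_sum {ι : Type*} (s : Finset ι) (A : ι → Fin 3 → MvPolynomial (Fin 3) ℂ) :
    curl (∑ i ∈ s, A i) = ∑ i ∈ s, curl (A i) := by
  classical
  induction s using Finset.induction_on with
  | empty => funext i; fin_cases i <;> simp [curl]
  | insert a s ha ih => rw [Finset.sum_insert ha, Finset.sum_insert ha, curl_add, ih]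

lemma pderiv_pderiv_comm (i j : Fin 3) (f : MvPolynomial (Fin 3) ℂ) :
    pderiv i (pderiv j f) = pderiv j (pderiv i f) := by
  have h : ⁅(pderiv i : Derivation ℂ (MvPolynomial (Fin 3) ℂ) (MvPolynomial (Fin 3) ℂ)),
      (pderiv j : Derivation ℂ (MvPolynomial (Fin 3) ℂ) (MvPolynomial (Fin 3) ℂ))⁆ = 0 := by
    refine derivation_ext fun k => ?_
    simp only [Derivation.commutator_apply, pderiv_X, Derivation.coe_zero, Pi.zero_apply]
    rw [Pi.single_apply, Pi.single_apply]
    split_ifs <;> simp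
  have := congrArg (fun D : Derivation ℂ (MvPolynomial (Fin 3) ℂ) (MvPolynomial (Fin 3) ℂ) => D f) h
  simpa [Derivation.commutator_apply, sub_eq_zero] using this

lemma curl_grad (f : MvPolynomial (Fin 3) ℂ) : curl (grad f) = 0 := by
  funext i
  fin_cases i <;> simp [curl, grad, pderiv_pderiv_comm 1 2, pderiv_pderiv_comm 2 0,
    pderiv_pderiv_comm 0 1]

/-- Two forms annihilated by wedge product with a common nonzero form are parallel. -/
lemma cross_eq_zero_of_cross_eq_zero {R : Type*} [CommRing R] [IsDomain R] {A B C : Fin 3 → R}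
    (hA : A ≠ 0) (hB : A ⨯₃ B = 0) (hC : A ⨯₃ C = 0) : B ⨯₃ C = 0 := by
  obtain ⟨k, hk⟩ := Function.ne_iff.1 hA
  have b0 := congrFun hB 0; have b1 := congrFun hB 1; have b2 := congrFun hB 2
  have c0 := congrFun hC 0; have c1 := congrFun hC 1; have c2 := congrFun hC 2
  simp only [cross_apply, Matrix.cons_val, Pi.zero_apply] at b0 b1 b2 c0 c1 c2
  have key : ∀ i, A k * (B ⨯₃ C) i = 0 := by
    intro i
    fin_cases k <;> fin_cases i <;> simp only [cross_apply, Fin.mk_one, Fin.zero_eta,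
      Fin.reduceFinMk, Matrix.cons_val] <;> grind
  funext i
  exact (mul_eq_zero.1 (key i)).resolve_left hk

section Darboux

variable {ι : Type*} [Fintype ι] [DecidableEq ι] (f : ι → MvPolynomial (Fin 3) ℂ)

/-- The numerator of the closed logarithmic one-form `∑ i, a i • d(f i) / f i` over the common
denominator `∏ i, f i`. -/
noncomputable def logForm (a : ι → ℂ) : Fin 3 → MvPolynomial (Fin 3) ℂ :=
  ∑ i, (C (a i) : MvPolynomial (Fin 3) ℂ) • (∏ l ∈ Finset.univ.erase i, f l) • grad (f i)

lemma logForm_add_smul (r s : ℂ) (a b : ι → ℂ) :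
    logForm f (r • a + s • b) = (C r : MvPolynomial (Fin 3) ℂ) • logForm f a +
      (C s : MvPolynomial (Fin 3) ℂ) • logForm f b := by
  simp only [logForm, Finset.smul_sum, ← Finset.sum_add_distrib]
  refine Finset.sum_congr rfl fun i _ => ?_
  simp only [Pi.add_apply, Pi.smul_apply, smul_eq_mul, map_add, map_mul, add_smul, mul_smul]

/-- The logarithmic form, that is, the quotient of `logForm f a` by `∏ i, f i`, is closed. -/
lemma prod_smul_curl_logForm (a : ι → ℂ) :
    (∏ i, f i) • curl (logForm f a) = grad (∏ i, f i) ⨯₃ logForm f a := by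
  rw [logForm, curl_sum, Finset.smul_sum, map_sum]
  refine Finset.sum_congr rfl fun i _ => ?_
  have hF : ∏ i, f i = f i * ∏ l ∈ Finset.univ.erase i, f l :=
    (Finset.mul_prod_erase _ _ (Finset.mem_univ i)).symm
  set G := ∏ l ∈ Finset.univ.erase i, f l
  rw [hF, grad_mul, curl_smul, curl_smul, curl_grad]
  have : grad (C (a i)) = 0 := by funext i; simp [grad]
  rw [this]
  funext k
  fin_cases k <;> simp [cross_apply] <;> ring

lemma logForm_isHomogeneous {d : ι → ℕ} (hd : ∀ i, (f i).IsHomogeneous (d i)) (a : ι → ℂ)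
    (hpos : ∀ i, 0 < d i) (c : Fin 3) : (logForm f a c).IsHomogeneous (∑ i, d i - 1) := by
  rw [logForm, Finset.sum_apply]
  refine IsHomogeneous.sum _ _ _ fun i _ => ?_
  have h1 := (IsHomogeneous.prod (Finset.univ.erase i) f d fun l _ => hd l).mul
    ((hd i).pderiv (i := c))
  have h2 : ∑ i, d i - 1 = ∑ l ∈ Finset.univ.erase i, d l + (d i - 1) := by
    rw [← Finset.sum_erase_add _ _ (Finset.mem_univ i)]
    have := hpos i
    omega
  rw [h2]
  exact h1.C_mul (a i)

lemma irreducible_degree_pos {f : MvPolynomial (Fin 3) ℂ} {d : ℕ} (hf : Irreducible f)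
    (hd : f.IsHomogeneous d) : 0 < d := by
  rcases Nat.eq_zero_or_pos d with rfl | h
  · have h1 : f = C (coeff 0 f) :=
      totalDegree_eq_zero_iff_eq_C.1 (Nat.le_zero.1 hd.totalDegree_le)
    refine absurd ?_ hf.not_isUnit
    rw [h1]
    refine IsUnit.map C (isUnit_iff_ne_zero.2 fun h0 => hf.ne_zero ?_)
    rw [h1, h0, C_0]
  · exact h

/-- By Euler's identity an irreducible homogeneous polynomial does not divide all of its partial
derivatives. -/
lemma exists_not_dvd_pderiv {f : MvPolynomial (Fin 3) ℂ} {d : ℕ} (hf : Irreducible f)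
    (hd : f.IsHomogeneous d) : ∃ c, ¬ f ∣ pderiv c f := by
  by_contra! h
  have hpos := irreducible_degree_pos hf hd
  have h0 : ∀ c, pderiv c f = 0 := by
    intro c
    by_contra hne
    obtain ⟨q, hq⟩ := h c
    have h1 := (hd.pderiv (i := c)).totalDegree hne
    rw [hq, totalDegree_mul_of_isDomain hf.ne_zero (by rintro rfl; simp [hq] at hne),
      hd.totalDegree hf.ne_zero] at h1
    omega
  have h1 := hd.sum_X_mul_pderiv
  simp only [h0, mul_zero, Finset.sum_const_zero] at h1
  have h2 : (d : MvPolynomial (Fin 3) ℂ) * f = 0 := by simpa using h1.symm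
  rcases mul_eq_zero.1 h2 with h3 | h3
  · exact hpos.ne' (by exact_mod_cast h3)
  · exact hf.ne_zero h3

/-- The logarithmic forms of pairwise nonassociated irreducible polynomials are independent, by
their residues along the curves `f i = 0`. -/
lemma logForm_ne_zero {d : ι → ℕ} (hirr : ∀ i, Irreducible (f i))
    (hd : ∀ i, (f i).IsHomogeneous (d i)) (hna : Pairwise fun i j => ¬ Associated (f i) (f j))
    {a : ι → ℂ} (ha : a ≠ 0) : logForm f a ≠ 0 := by
  intro h0
  obtain ⟨i, hi⟩ := Function.ne_iff.1 ha
  obtain ⟨c, hc⟩ := exists_not_dvd_pderiv (hirr i) (hd i)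
  have h1 := congrFun h0 c
  rw [logForm, Finset.sum_apply, ← Finset.add_sum_erase _ _ (Finset.mem_univ i)] at h1
  have h2 : f i ∣ ∑ l ∈ Finset.univ.erase i,
      ((C (a l) : MvPolynomial (Fin 3) ℂ) • (∏ m ∈ Finset.univ.erase l, f m) • grad (f l)) c := by
    refine Finset.dvd_sum fun l hl => ?_
    refine Dvd.dvd.mul_left (Dvd.dvd.mul_right (Finset.dvd_prod_of_mem _ ?_) _) _
    simpa using (Finset.ne_of_mem_erase hl).symm
  have h3 : f i ∣ ((C (a i) : MvPolynomial (Fin 3) ℂ) •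
      (∏ m ∈ Finset.univ.erase i, f m) • grad (f i)) c := by
    rw [← dvd_add_left h2, h1]
    exact dvd_zero _
  have hp := (hirr i).prime
  rcases hp.dvd_or_dvd h3 with h4 | h4
  · exact hp.not_isUnit (isUnit_of_dvd_unit h4 (IsUnit.map C (isUnit_iff_ne_zero.2 hi)))
  rcases hp.dvd_or_dvd h4 with h5 | h5
  · obtain ⟨m, hm, h6⟩ := (hp.dvd_finsetProd_iff _).1 h5
    exact hna (Finset.ne_of_mem_erase hm).symm ((hirr i).associated_of_dvd (hirr m) h6)
  · exact hc h5

/-- Darboux's argument: two independent relations among the cofactors `θ i` of the invariant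
polynomials `f i` give two closed logarithmic forms proportional to `A`, and their quotient is a
rational first integral of `A`. -/
theorem exists_first_integral_of_relations {d : ι → ℕ} (hirr : ∀ i, Irreducible (f i))
    (hd : ∀ i, (f i).IsHomogeneous (d i)) (hna : Pairwise fun i j => ¬ Associated (f i) (f j))
    {A : Fin 3 → MvPolynomial (Fin 3) ℂ} (hA : A ≠ 0) {θ : ι → Fin 3 → MvPolynomial (Fin 3) ℂ}
    (hθ : ∀ i, A ⨯₃ grad (f i) = f i • θ i) {a b : ι → ℂ} (hab : LinearIndependent ℂ ![a, b])
    (ha : ∑ i, (C (a i) : MvPolynomial (Fin 3) ℂ) • θ i = 0)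
    (hb : ∑ i, (C (b i) : MvPolynomial (Fin 3) ℂ) • θ i = 0) :
    ∃ (n : ℕ) (P Q : MvPolynomial (Fin 3) ℂ), P.IsHomogeneous n ∧ Q.IsHomogeneous n ∧
      IsRelPrime P Q ∧ LinearIndependent ℂ ![P, Q] ∧
      A ⨯₃ (Q • grad P - P • grad Q) = 0 := by
  have hpar : ∀ a : ι → ℂ, ∑ i, (C (a i) : MvPolynomial (Fin 3) ℂ) • θ i = 0 →
      A ⨯₃ logForm f a = 0 := by
    intro a ha
    rw [logForm, map_sum]
    have : ∀ i ∈ Finset.univ, A ⨯₃ ((C (a i) : MvPolynomial (Fin 3) ℂ) •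
        (∏ l ∈ Finset.univ.erase i, f l) • grad (f i)) =
        (∏ i, f i) • ((C (a i) : MvPolynomial (Fin 3) ℂ) • θ i) := by
      intro i _
      rw [map_smul, map_smul, hθ, ← Finset.mul_prod_erase _ _ (Finset.mem_univ i)]
      simp only [smul_smul]
      congr 1
      ring
    rw [Finset.sum_congr rfl this, ← Finset.smul_sum, ha, smul_zero]
  have hF0 : ∏ i, f i ≠ 0 := Finset.prod_ne_zero_iff.2 fun i _ => (hirr i).ne_zero
  have hcomb : ∀ r s : ℂ, (C r : MvPolynomial (Fin 3) ℂ) • logForm f a +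
      (C s : MvPolynomial (Fin 3) ℂ) • logForm f b = 0 → r = 0 ∧ s = 0 := by
    intro r s h
    rw [← logForm_add_smul] at h
    by_contra hrs
    refine logForm_ne_zero f hirr hd hna ?_ h
    intro h0
    exact hrs (LinearIndependent.pair_iff.1 hab r s h0)
  have hηa : A ⨯₃ logForm f a = 0 := hpar a ha
  have hηb : A ⨯₃ logForm f b = 0 := hpar b hb
  have hηab := cross_eq_zero_of_cross_eq_zero hA hηa hηb
  have hca := prod_smul_curl_logForm f a
  have hcb := prod_smul_curl_logForm f b
  have hhom := logForm_isHomogeneous f hd (hpos := fun i => irreducible_degree_pos (hirr i) (hd i))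
  set F := ∏ i, f i
  set α := logForm f a
  set β := logForm f b
  have hβ0 : β ≠ 0 := fun h => one_ne_zero (hcomb 0 1 (by simp [h])).2
  have hα0 : α ≠ 0 := fun h => one_ne_zero (hcomb 1 0 (by simp [h])).1
  obtain ⟨c, hc⟩ := Function.ne_iff.1 hβ0
  have hprop : β c • α = α c • β := by
    have e0 := congrFun hηab 0; have e1 := congrFun hηab 1; have e2 := congrFun hηab 2
    simp only [cross_apply, Matrix.cons_val, Pi.zero_apply] at e0 e1 e2
    funext k
    fin_cases c <;> fin_cases k <;> simp only [Fin.mk_one, Fin.zero_eta, Fin.reduceFinMk,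
      Pi.smul_apply, smul_eq_mul] <;> grind
  have hcα : α c ≠ 0 := by
    intro h
    rw [h, zero_smul] at hprop
    exact hα0 ((smul_eq_zero.1 hprop).resolve_left hc)
  -- as `α / F` and `β / F` are closed and `α / β = α c / β c`, the differential of this quotient
  -- is parallel to `β`
  have hdiff : β c • grad (α c) ⨯₃ β - α c • grad (β c) ⨯₃ β = 0 := by
    have h1 : F • (β c • (grad (β c) ⨯₃ α - grad (α c) ⨯₃ β)) = 0 := by
      have h2 := congrArg curl hprop
      rw [curl_smul, curl_smul] at h2
      have h3 : F • (grad (β c) ⨯₃ α) + β c • (grad F ⨯₃ α) =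
          F • (grad (α c) ⨯₃ β) + α c • (grad F ⨯₃ β) := by
        have := congrArg (F • ·) h2
        simp only [smul_add] at this
        rw [smul_comm F (β c), smul_comm F (α c), hca, hcb] at this
        exact this
      have h4 : β c • (grad F ⨯₃ α) = α c • (grad F ⨯₃ β) := by
        rw [← map_smul, hprop, map_smul]
      rw [h4, add_left_inj] at h3
      rw [smul_comm, smul_sub, h3, sub_self, smul_zero]
    have h5 := (smul_eq_zero.1 ((smul_eq_zero.1 h1).resolve_left hF0)).resolve_left hc
    have h6 : grad (β c) ⨯₃ α = grad (α c) ⨯₃ β := sub_eq_zero.1 h5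
    rw [← h6, ← map_smul (crossProduct (grad (β c))) (α c) β, ← hprop, map_smul, sub_self]
  -- the first integral is the quotient `α c / β c` in lowest terms
  obtain ⟨P, Q, G, hrel, hGP, hGQ⟩ :=
    UniqueFactorizationMonoid.exists_reduced_factors (α c) hcα (β c)
  have hG : G ≠ 0 := by rintro rfl; simp at hGP; exact hcα hGP.symm
  have hP : P ≠ 0 := by rintro rfl; simp at hGP; exact hcα hGP.symm
  have hQ : Q ≠ 0 := by rintro rfl; simp at hGQ; exact hc hGQ.symm
  have hαh : (α c).IsHomogeneous _ := hhom a c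
  have hβh : (β c).IsHomogeneous _ := hhom b c
  obtain ⟨g, hg⟩ := hαh.exists_of_dvd hcα ⟨P, hGP.symm⟩
  obtain ⟨m, hm⟩ := hαh.exists_of_dvd hcα (Dvd.intro_left G hGP)
  obtain ⟨n, hn⟩ := hβh.exists_of_dvd hc (Dvd.intro_left G hGQ)
  have hmn : m = n := by
    have h1 := (hg.mul hm).inj_right (by rwa [hGP]) (by rwa [hGP])
    have h2 := (hg.mul hn).inj_right (by rwa [hGQ]) (by rwa [hGQ])
    omega
  subst hmn
  refine ⟨m, P, Q, hm, hn, hrel, ?_, ?_⟩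
  · rw [LinearIndependent.pair_iff]
    intro r s hrs
    refine hcomb r s ?_
    have h1 : C r * α c + C s * β c = 0 := by
      rw [← hGP, ← hGQ]
      rw [smul_eq_C_mul, smul_eq_C_mul] at hrs
      linear_combination G * hrs
    have h2 : β c • ((C r : MvPolynomial (Fin 3) ℂ) • α +
        (C s : MvPolynomial (Fin 3) ℂ) • β) = 0 := by
      rw [smul_add, smul_comm, hprop, smul_smul, smul_smul, ← add_smul, mul_comm (β c), h1,
        zero_smul]
    exact (smul_eq_zero.1 h2).resolve_left hc
  · have h1 : (Q • grad P - P • grad Q) ⨯₃ β = 0 := by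
      have h2 : (G * G) • ((Q • grad P - P • grad Q) ⨯₃ β) = 0 := by
        rw [← hdiff, ← hGP, ← hGQ, grad_mul, grad_mul]
        funext k
        fin_cases k <;> simp [cross_apply] <;> ring
      exact (smul_eq_zero.1 h2).resolve_left (mul_ne_zero hG hG)
    have h3 : β ⨯₃ (Q • grad P - P • grad Q) = 0 := by rw [← cross_anticomm, h1, neg_zero]
    have h4 : β ⨯₃ A = 0 := by rw [← cross_anticomm, hηb, neg_zero]
    exact cross_eq_zero_of_cross_eq_zero hβ0 h4 h3

end Darboux

end MvPolynomial

/-! ### Sections of the projection `ℂ³ ∖ {0} → CP2` -/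

namespace CP2

/-- The section of the projection over `{v_i ≠ 0}` with values in the plane `{v_i = 1}`. Outside of
this affine set its values are irrelevant. -/
noncomputable def sec (i : Fin 3) (p : CP2) : Fin 3 → ℂ := i.insertNth (1 : ℂ) (affineCoord i p)

lemma sec_self (i : Fin 3) (p : CP2) : sec i p i = 1 := by simp [sec]

lemma sec_ne_zero (i : Fin 3) (p : CP2) : sec i p ≠ 0 := insertNth_ne_zero i _

lemma proj_of_ne_zero {v : Fin 3 → ℂ} (hv : v ≠ 0) : proj v = Projectivization.mk ℂ v hv := by
  rw [proj, dif_pos hv]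

lemma ne_zero_of_apply_ne_zero {v : Fin 3 → ℂ} {i : Fin 3} (h : v i ≠ 0) : v ≠ 0 := by
  rintro rfl; exact h rfl

lemma proj_mem_affineSet {v : Fin 3 → ℂ} (hv : v ≠ 0) {i : Fin 3} :
    proj v ∈ affineSet i ↔ v i ≠ 0 := by
  rw [proj_of_ne_zero hv]; rfl

lemma exists_proj_eq (p : CP2) : ∃ v : Fin 3 → ℂ, v ≠ 0 ∧ proj v = p := by
  induction p using Projectivization.ind with
  | h v hv => exact ⟨v, hv, proj_of_ne_zero hv⟩

lemma proj_sec {i : Fin 3} {p : CP2} (hp : p ∈ affineSet i) : proj (sec i p) = p := by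
  rw [proj_of_ne_zero (sec_ne_zero i p)]
  exact (affineChart i).left_inv hp

lemma sec_proj {i : Fin 3} {v : Fin 3 → ℂ} (hv : v i ≠ 0) : sec i (proj v) = (v i)⁻¹ • v := by
  rw [proj_of_ne_zero (ne_zero_of_apply_ne_zero hv)]
  funext k
  refine Fin.succAboveCases i ?_ (fun k => ?_) k
  · simp [sec, hv]
  · simp [sec, affineCoord, div_eq_inv_mul]

lemma proj_smul {c : ℂ} (hc : c ≠ 0) {v : Fin 3 → ℂ} (hv : v ≠ 0) : proj (c • v) = proj v := by
  rw [proj_of_ne_zero hv, proj_of_ne_zero (smul_ne_zero hc hv)]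
  exact (Projectivization.mk_eq_mk_iff' ℂ _ _ _ _).2 ⟨c, rfl⟩

lemma exists_eq_smul_of_proj_eq {v w : Fin 3 → ℂ} (hv : v ≠ 0) (hw : w ≠ 0)
    (h : proj v = proj w) : ∃ c : ℂ, c ≠ 0 ∧ v = c • w := by
  rw [proj_of_ne_zero hv, proj_of_ne_zero hw, Projectivization.mk_eq_mk_iff'] at h
  obtain ⟨c, hc⟩ := h
  exact ⟨c, by rintro rfl; exact hv (by rw [← hc, zero_smul]), hc.symm⟩

lemma proj_mem_zeroSet {f : MvPolynomial (Fin 3) ℂ} {n : ℕ} (hf : f.IsHomogeneous n)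
    {v : Fin 3 → ℂ} (hv : v ≠ 0) : proj v ∈ zeroSet f ↔ MvPolynomial.eval v f = 0 := by
  rw [proj_of_ne_zero hv, mem_zeroSet_mk hf hv]

lemma affineChart_mem_maximalAtlas (i : Fin 3) :
    affineChart i ∈ IsManifold.maximalAtlas 𝓘(ℂ, Fin 2 → ℂ) ω CP2 :=
  IsManifold.subset_maximalAtlas (mem_range_self i)

lemma contDiff_insertNth (i : Fin 3) :
    ContDiff ℂ ω fun u : Fin 2 → ℂ => (i.insertNth (1 : ℂ) u : Fin 3 → ℂ) := by
  refine contDiff_pi.2 fun l => ?_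
  refine Fin.succAboveCases i ?_ (fun k => ?_) l
  · simpa using contDiff_const
  · simpa using contDiff_apply ℂ ℂ k

lemma contMDiffOn_sec (i : Fin 3) :
    ContMDiffOn 𝓘(ℂ, Fin 2 → ℂ) 𝓘(ℂ, Fin 3 → ℂ) ω (sec i) (affineSet i) :=
  (contDiff_insertNth i).contMDiff.comp_contMDiffOn
    (contMDiffOn_of_mem_maximalAtlas (affineChart_mem_maximalAtlas i))

lemma contMDiffAt_sec {i : Fin 3} {p : CP2} (hp : p ∈ affineSet i) :
    ContMDiffAt 𝓘(ℂ, Fin 2 → ℂ) 𝓘(ℂ, Fin 3 → ℂ) ω (sec i) p :=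
  (contMDiffOn_sec i).contMDiffAt ((isOpen_affineSet i).mem_nhds hp)

lemma contMDiffAt_proj {v : Fin 3 → ℂ} (hv : v ≠ 0) :
    ContMDiffAt 𝓘(ℂ, Fin 3 → ℂ) 𝓘(ℂ, Fin 2 → ℂ) ω proj v := by
  obtain ⟨i, hi⟩ := Function.ne_iff.1 hv
  have ho : IsOpen {v : Fin 3 → ℂ | v i ≠ 0} := isOpen_ne.preimage (continuous_apply i)
  have h1 : ContDiffOn ℂ ω (fun (v : Fin 3 → ℂ) (k : Fin 2) => v (i.succAbove k) / v i)
      {v | v i ≠ 0} :=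
    contDiffOn_pi.2 fun k => ((contDiff_apply ℂ ℂ _).contDiffOn).div
      ((contDiff_apply ℂ ℂ _).contDiffOn) fun v hv => hv
  have h2 : ContMDiffOn 𝓘(ℂ, Fin 3 → ℂ) 𝓘(ℂ, Fin 2 → ℂ) ω ((affineChart i).symm ∘
      fun (v : Fin 3 → ℂ) (k : Fin 2) => v (i.succAbove k) / v i) {v | v i ≠ 0} :=
    (contMDiffOn_symm_of_mem_maximalAtlas (affineChart_mem_maximalAtlas i)).comp
      h1.contMDiffOn fun v _ => mem_univ _
  refine (h2.contMDiffAt (ho.mem_nhds hi)).congr_of_eventuallyEq ?_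
  filter_upwards [ho.mem_nhds hi] with w hw
  rw [proj_of_ne_zero (ne_zero_of_apply_ne_zero hw)]
  exact ((affineChart i).left_inv (x := Projectivization.mk ℂ w (ne_zero_of_apply_ne_zero hw))
    hw).symm

lemma continuousAt_proj {v : Fin 3 → ℂ} (hv : v ≠ 0) : ContinuousAt proj v :=
  (contMDiffAt_proj hv).continuousAt

/-- The differential of `sec i ∘ proj`, that is, of `v ↦ v / v_i`. -/
lemma mfderiv_sec_mfderiv_proj {i : Fin 3} {v : Fin 3 → ℂ} (hv : v i ≠ 0) (w : Fin 3 → ℂ) :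
    (mfderiv 𝓘(ℂ, Fin 2 → ℂ) 𝓘(ℂ, Fin 3 → ℂ) (sec i) (proj v)
      (mfderiv 𝓘(ℂ, Fin 3 → ℂ) 𝓘(ℂ, Fin 2 → ℂ) proj v w) : Fin 3 → ℂ) =
      (v i)⁻¹ • w - (w i / v i ^ 2) • v := by
  have hv0 := ne_zero_of_apply_ne_zero hv
  have h1 : MDifferentiableAt 𝓘(ℂ, Fin 2 → ℂ) 𝓘(ℂ, Fin 3 → ℂ) (sec i) (proj v) :=
    (contMDiffAt_sec ((proj_mem_affineSet hv0).2 hv)).mdifferentiableAt (by simp)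
  have h2 : MDifferentiableAt 𝓘(ℂ, Fin 3 → ℂ) 𝓘(ℂ, Fin 2 → ℂ) proj v :=
    (contMDiffAt_proj hv0).mdifferentiableAt (by simp)
  have h3 := mfderiv_comp v h1 h2
  have h4 : HasFDerivAt (sec i ∘ proj) ((v i)⁻¹ • ContinuousLinearMap.id ℂ (Fin 3 → ℂ) +
      ((-(v i ^ 2)⁻¹ • (ContinuousLinearMap.proj i : (Fin 3 → ℂ) →L[ℂ] ℂ))).smulRight v) v := by
    have h5 : HasFDerivAt (fun v : Fin 3 → ℂ => (v i)⁻¹ • v) ((v i)⁻¹ • ContinuousLinearMap.id ℂ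
        (Fin 3 → ℂ) + ((-(v i ^ 2)⁻¹ • (ContinuousLinearMap.proj i :
          (Fin 3 → ℂ) →L[ℂ] ℂ))).smulRight v) v :=
      HasFDerivAt.fun_smul (((hasDerivAt_inv hv).comp_hasFDerivAt v (hasFDerivAt_apply i v)))
        (hasFDerivAt_id v)
    refine h5.congr_of_eventuallyEq ?_
    have ho : IsOpen {v : Fin 3 → ℂ | v i ≠ 0} := isOpen_ne.preimage (continuous_apply i)
    filter_upwards [ho.mem_nhds hv] with u hu
    exact sec_proj hu
  rw [mfderiv_eq_fderiv, h4.fderiv] at h3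
  have h6 := DFunLike.congr_fun h3 w
  refine h6.symm.trans ?_
  change (v i)⁻¹ • w + (-(v i ^ 2)⁻¹ * w i) • v = _
  rw [sub_eq_add_neg, ← neg_smul]
  congr 2
  ring

/-- `sec i` is an immersion with left inverse `proj`. -/
lemma mfderiv_proj_mfderiv_sec {i : Fin 3} {p : CP2} (hp : p ∈ affineSet i)
    (x : TangentSpace 𝓘(ℂ, Fin 2 → ℂ) p) :
    mfderiv 𝓘(ℂ, Fin 3 → ℂ) 𝓘(ℂ, Fin 2 → ℂ) proj (sec i p)
      (mfderiv 𝓘(ℂ, Fin 2 → ℂ) 𝓘(ℂ, Fin 3 → ℂ) (sec i) p x) = (x : Fin 2 → ℂ) := by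
  have h1 : MDifferentiableAt 𝓘(ℂ, Fin 2 → ℂ) 𝓘(ℂ, Fin 3 → ℂ) (sec i) p :=
    (contMDiffAt_sec hp).mdifferentiableAt (by simp)
  have h2 : MDifferentiableAt 𝓘(ℂ, Fin 3 → ℂ) 𝓘(ℂ, Fin 2 → ℂ) proj (sec i p) :=
    (contMDiffAt_proj (sec_ne_zero i p)).mdifferentiableAt (by simp)
  have h3 := mfderiv_comp p h2 h1
  have h4 : proj ∘ sec i =ᶠ[𝓝 p] id := by
    filter_upwards [(isOpen_affineSet i).mem_nhds hp] with q hq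
    exact proj_sec hq
  rw [h4.mfderiv_eq, mfderiv_id] at h3
  exact (DFunLike.congr_fun h3 x).symm

lemma mfderiv_sec_apply_self {i : Fin 3} {p : CP2} (hp : p ∈ affineSet i)
    (x : TangentSpace 𝓘(ℂ, Fin 2 → ℂ) p) :
    (mfderiv 𝓘(ℂ, Fin 2 → ℂ) 𝓘(ℂ, Fin 3 → ℂ) (sec i) p x : Fin 3 → ℂ) i = 0 := by
  have h1 : MDifferentiableAt 𝓘(ℂ, Fin 2 → ℂ) 𝓘(ℂ, Fin 3 → ℂ) (sec i) p :=
    (contMDiffAt_sec hp).mdifferentiableAt (by simp)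
  have h2 := ((hasFDerivAt_apply (𝕜 := ℂ) i (sec i p)).hasMFDerivAt).comp p h1.hasMFDerivAt
  have h3 : (fun v : Fin 3 → ℂ => v i) ∘ sec i = fun _ => 1 := funext fun q => sec_self i q
  rw [h3] at h2
  exact DFunLike.congr_fun (hasMFDerivAt_unique h2 (hasMFDerivAt_const (1 : ℂ) p)) x

end CP2

namespace HolomorphicFoliation

open CP2

variable (F : HolomorphicFoliation)

/-- The local vector field `X j` in the homogeneous coordinates `sec i`, as a function on `ℂ³` that
is constant on the lines through the origin. It is meaningful only on `dom i j`. -/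
noncomputable def field (i : Fin 3) (j : F.ι) (v : Fin 3 → ℂ) : Fin 3 → ℂ :=
  mfderiv 𝓘(ℂ, Fin 2 → ℂ) 𝓘(ℂ, Fin 3 → ℂ) (sec i) (proj v) (F.X j (proj v))

/-- The set of the vectors over `U j` whose `i`-th coordinate does not vanish. -/
def dom (i : Fin 3) (j : F.ι) : Set (Fin 3 → ℂ) := {v | v i ≠ 0 ∧ proj v ∈ F.U j}

lemma isOpen_dom (i : Fin 3) (j : F.ι) : IsOpen (F.dom i j) := by
  rw [isOpen_iff_mem_nhds]
  rintro v ⟨hv, hj⟩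
  have ho : IsOpen {v : Fin 3 → ℂ | v i ≠ 0} := isOpen_ne.preimage (continuous_apply i)
  filter_upwards [ho.mem_nhds hv, (continuousAt_proj (ne_zero_of_apply_ne_zero hv)).eventually_mem
    ((F.isOpen_U j).mem_nhds hj)] with w h1 h2
  exact ⟨h1, h2⟩

lemma contDiffAt_field {i : Fin 3} {j : F.ι} {v : Fin 3 → ℂ} (hv : v ∈ F.dom i j) :
    ContDiffAt ℂ ω (F.field i j) v := by
  have hv0 := ne_zero_of_apply_ne_zero hv.1
  have hp : proj v ∈ affineSet i := (proj_mem_affineSet hv0).2 hv.1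
  have h1 := (contMDiffOn_sec i).contMDiffOn_tangentMapWithin (m := ω) (by simp)
    (isOpen_affineSet i).uniqueMDiffOn
  have h2 : ContMDiffAt 𝓘(ℂ, Fin 2 → ℂ) (𝓘(ℂ, Fin 2 → ℂ).tangent) ω
      (fun p => (⟨p, F.X j p⟩ : TangentBundle 𝓘(ℂ, Fin 2 → ℂ) CP2)) (proj v) :=
    (F.holomorphic_X j).contMDiffAt ((F.isOpen_U j).mem_nhds hv.2)
  have h3 := h2.comp v (contMDiffAt_proj hv0)
  have h4 := (h1.contMDiffAt (x := (⟨proj v, F.X j (proj v)⟩ :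
    TangentBundle 𝓘(ℂ, Fin 2 → ℂ) CP2)) (((isOpen_affineSet i).preimage
      (FiberBundle.continuous_proj _ _)).mem_nhds hp)).comp v h3
  have h5 := ((contMDiff_snd_tangentBundle_modelSpace (Fin 3 → ℂ)
    𝓘(ℂ, Fin 3 → ℂ)).contMDiffAt.comp v h4).contDiffAt
  refine h5.congr_of_eventuallyEq ?_
  filter_upwards [(F.isOpen_dom i j).mem_nhds hv] with w hw
  have hw0 := ne_zero_of_apply_ne_zero hw.1
  simp only [Function.comp, tangentMapWithin, field]
  rw [mfderivWithin_of_isOpen (isOpen_affineSet i) ((proj_mem_affineSet hw0).2 hw.1)]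

end HolomorphicFoliation

namespace HolomorphicFoliation

open CP2
open scoped Matrix

variable (F : HolomorphicFoliation)

lemma exists_mem_dom {v : Fin 3 → ℂ} (hv : v ≠ 0) : ∃ i j, v ∈ F.dom i j := by
  obtain ⟨i, hi⟩ := Function.ne_iff.1 hv
  obtain ⟨j, hj⟩ := mem_iUnion.1 (F.iUnion_U ▸ mem_univ (proj v) : proj v ∈ ⋃ j, F.U j)
  exact ⟨i, j, hi, hj⟩

variable {F}

lemma smul_mem_dom {i : Fin 3} {j : F.ι} {v : Fin 3 → ℂ} {c : ℂ} (hc : c ≠ 0)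
    (hv : v ∈ F.dom i j) : c • v ∈ F.dom i j :=
  ⟨mul_ne_zero hc hv.1, by rw [proj_smul hc (ne_zero_of_apply_ne_zero hv.1)]; exact hv.2⟩

lemma field_congr {i : Fin 3} {j : F.ι} {v w : Fin 3 → ℂ} (h : proj v = proj w) :
    F.field i j v = F.field i j w := by
  unfold field
  rw [h]

lemma field_eq {i : Fin 3} {j : F.ι} {v : Fin 3 → ℂ} {p : CP2} (h : proj v = p) :
    F.field i j v = mfderiv 𝓘(ℂ, Fin 2 → ℂ) 𝓘(ℂ, Fin 3 → ℂ) (sec i) p (F.X j p) := by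
  subst h
  rfl

lemma field_apply_self {i : Fin 3} {j : F.ι} {v : Fin 3 → ℂ} (hv : v ∈ F.dom i j) :
    F.field i j v i = 0 :=
  mfderiv_sec_apply_self ((proj_mem_affineSet (ne_zero_of_apply_ne_zero hv.1)).2 hv.1) _

lemma mfderiv_proj_eq_smul_iff {i : Fin 3} {j : F.ι} {v : Fin 3 → ℂ} (hv : v ∈ F.dom i j)
    (w : Fin 3 → ℂ) (c : ℂ) :
    mfderiv 𝓘(ℂ, Fin 3 → ℂ) 𝓘(ℂ, Fin 2 → ℂ) proj v w = c • F.X j (proj v) ↔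
      (v i)⁻¹ • w - (w i / v i ^ 2) • v = c • F.field i j v := by
  have hp := (proj_mem_affineSet (ne_zero_of_apply_ne_zero hv.1)).2 hv.1
  rw [← mfderiv_sec_mfderiv_proj hv.1 w]
  constructor
  · intro h
    rw [h]
    exact map_smul _ _ _
  · intro h
    have h1 : mfderiv 𝓘(ℂ, Fin 2 → ℂ) 𝓘(ℂ, Fin 3 → ℂ) (sec i) (proj v)
        (mfderiv 𝓘(ℂ, Fin 3 → ℂ) 𝓘(ℂ, Fin 2 → ℂ) proj v w) =
        mfderiv 𝓘(ℂ, Fin 2 → ℂ) 𝓘(ℂ, Fin 3 → ℂ) (sec i) (proj v) (c • F.X j (proj v)) :=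
      h.trans (map_smul _ _ _).symm
    have h2 := congrArg (mfderiv 𝓘(ℂ, Fin 3 → ℂ) 𝓘(ℂ, Fin 2 → ℂ) proj (sec i (proj v))) h1
    exact (mfderiv_proj_mfderiv_sec hp _).symm.trans (h2.trans (mfderiv_proj_mfderiv_sec hp _))

lemma mfderiv_proj_field {i : Fin 3} {j : F.ι} {v : Fin 3 → ℂ} (hv : v ∈ F.dom i j) :
    mfderiv 𝓘(ℂ, Fin 3 → ℂ) 𝓘(ℂ, Fin 2 → ℂ) proj v (v i • F.field i j v) =
      F.X j (proj v) := by
  have h := (mfderiv_proj_eq_smul_iff hv (v i • F.field i j v) 1).2 (by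
    rw [smul_smul, inv_mul_cancel₀ hv.1]
    simp [field_apply_self hv])
  rwa [one_smul] at h

lemma field_eq_zero_iff {i : Fin 3} {j : F.ι} {v : Fin 3 → ℂ} (hv : v ∈ F.dom i j) :
    F.field i j v = 0 ↔ F.X j (proj v) = 0 := by
  constructor
  · intro h
    rw [← mfderiv_proj_field hv, h, smul_zero]
    exact map_zero _
  · intro h
    unfold field
    rw [h]
    exact map_zero _

lemma X_eq_zero_iff {p : CP2} {j : F.ι} (hp : p ∈ F.U j) : F.X j p = 0 ↔ p ∈ F.sing := by
  refine ⟨fun h => ⟨j, hp, h⟩, ?_⟩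
  rintro ⟨k, hk, h⟩
  obtain ⟨g, -, hg⟩ := F.compatible j k
  rw [(hg p ⟨hp, hk⟩).2, h, smul_zero]

lemma field_ne_zero_iff {i : Fin 3} {j : F.ι} {v : Fin 3 → ℂ} (hv : v ∈ F.dom i j) :
    F.field i j v ≠ 0 ↔ proj v ∉ F.sing := by
  rw [Ne, field_eq_zero_iff hv, X_eq_zero_iff hv.2]

variable (F) in
/-- The contraction of the volume form of `ℂ³` with the radial field and a lift of the local vector
field. This local one-form on `ℂ³` defines the foliation; up to a factor it does not depend on
the choices of the coordinates `i` and of the local vector field. -/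
noncomputable def form (i : Fin 3) (j : F.ι) (v : Fin 3 → ℂ) : Fin 3 → ℂ := v ⨯₃ F.field i j v

/-- A vector with vanishing `i`-th coordinate that is parallel to `v` vanishes. -/
lemma eq_zero_of_cross_eq_zero {v w : Fin 3 → ℂ} {i : Fin 3} (hv : v i ≠ 0) (hw : w i = 0)
    (h : v ⨯₃ w = 0) : w = 0 := by
  have e0 := congrFun h 0; have e1 := congrFun h 1; have e2 := congrFun h 2
  simp only [cross_apply, Matrix.cons_val, Pi.zero_apply] at e0 e1 e2
  funext k
  fin_cases i <;> fin_cases k <;> simp at hv hw ⊢ <;> grind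

lemma form_ne_zero_iff {i : Fin 3} {j : F.ι} {v : Fin 3 → ℂ} (hv : v ∈ F.dom i j) :
    F.form i j v ≠ 0 ↔ proj v ∉ F.sing := by
  rw [← field_ne_zero_iff hv, not_iff_not]
  refine ⟨fun h => eq_zero_of_cross_eq_zero hv.1 (field_apply_self hv) h, fun h => ?_⟩
  rw [form, h, map_zero]

lemma exists_form_eq_smul {i i' : Fin 3} {j j' : F.ι} {v : Fin 3 → ℂ} (hv : v ∈ F.dom i j)
    (hv' : v ∈ F.dom i' j') : ∃ c : ℂ, c ≠ 0 ∧ F.form i j v = c • F.form i' j' v := by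
  obtain ⟨g, -, hg⟩ := F.compatible j j'
  obtain ⟨hg0, hX⟩ := hg (proj v) ⟨hv.2, hv'.2⟩
  have h := (mfderiv_proj_eq_smul_iff hv' (v i • F.field i j v) (g (proj v))).1
    ((mfderiv_proj_field hv).trans hX)
  refine ⟨g (proj v) * v i' / v i, div_ne_zero (mul_ne_zero hg0 hv'.1) hv.1, ?_⟩
  have h2 := congrArg (fun w => v ⨯₃ w) h
  simp only [map_sub, map_smul, cross_self, smul_zero, sub_zero] at h2
  have h3 : F.form i j v = (v i' / v i) • ((v i')⁻¹ • v i • F.form i j v) := by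
    rw [smul_smul, smul_smul]
    have := hv.1
    have := hv'.1
    rw [show v i' / v i * (v i')⁻¹ * v i = 1 by field_simp, one_smul]
  rw [h3]
  simp only [form]
  rw [h2, smul_smul]
  congr 1
  ring

lemma contDiffAt_form {i : Fin 3} {j : F.ι} {v : Fin 3 → ℂ} (hv : v ∈ F.dom i j) :
    ContDiffAt ℂ ω (F.form i j) v := by
  have h1 := contDiffAt_pi.1 (F.contDiffAt_field hv)
  have h2 : ∀ k : Fin 3, ContDiffAt ℂ ω (fun v : Fin 3 → ℂ => v k) v := fun k =>
    (contDiff_apply ℂ ℂ k).contDiffAt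
  refine contDiffAt_pi.2 fun k => ?_
  unfold form
  fin_cases k
  · simpa [cross_apply] using ((h2 1).mul (h1 2)).sub ((h2 2).mul (h1 1))
  · simpa [cross_apply] using ((h2 2).mul (h1 0)).sub ((h2 0).mul (h1 2))
  · simpa [cross_apply] using ((h2 0).mul (h1 1)).sub ((h2 1).mul (h1 0))

lemma hasDerivAt_sec_comp {i : Fin 3} {j : F.ι} {γ : ℂ → CP2} {w : ℂ}
    (h : HasMFDerivAt 𝓘(ℂ, ℂ) 𝓘(ℂ, Fin 2 → ℂ) γ w
        ((1 : ℂ →L[ℂ] ℂ).smulRight (F.X j (γ w)))) (hw : γ w ∈ affineSet i) :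
    HasDerivAt (fun z => sec i (γ z)) (F.field i j (sec i (γ w))) w := by
  have h1 : MDifferentiableAt 𝓘(ℂ, Fin 2 → ℂ) 𝓘(ℂ, Fin 3 → ℂ) (sec i) (γ w) :=
    (contMDiffAt_sec hw).mdifferentiableAt (by simp)
  have h2 : HasFDerivAt (sec i ∘ γ) ((mfderiv 𝓘(ℂ, Fin 2 → ℂ) 𝓘(ℂ, Fin 3 → ℂ) (sec i) (γ w)).comp
      ((1 : ℂ →L[ℂ] ℂ).smulRight (F.X j (γ w))) : ℂ →L[ℂ] (Fin 3 → ℂ)) w :=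
    (h1.hasMFDerivAt.comp w h).hasFDerivAt
  rw [hasDerivAt_iff_hasFDerivAt, field_eq (proj_sec hw)]
  refine h2.congr_fderiv (ContinuousLinearMap.ext_ring ?_)
  change mfderiv 𝓘(ℂ, Fin 2 → ℂ) 𝓘(ℂ, Fin 3 → ℂ) (sec i) (γ w) ((1 : ℂ) • F.X j (γ w)) =
    (1 : ℂ) • (mfderiv 𝓘(ℂ, Fin 2 → ℂ) 𝓘(ℂ, Fin 3 → ℂ) (sec i) (γ w) (F.X j (γ w)) : Fin 3 → ℂ)
  rw [one_smul, one_smul]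

lemma hasMFDerivAt_proj_comp {i : Fin 3} {j : F.ι} {σ : ℂ → Fin 3 → ℂ} {w : ℂ}
    (h : HasDerivAt σ (F.field i j (σ w)) w) (hw : σ w ∈ F.dom i j) (hi : σ w i = 1) :
    HasMFDerivAt 𝓘(ℂ, ℂ) 𝓘(ℂ, Fin 2 → ℂ) (fun z => proj (σ z)) w
        ((1 : ℂ →L[ℂ] ℂ).smulRight (F.X j (proj (σ w)))) := by
  have h1 : MDifferentiableAt 𝓘(ℂ, Fin 3 → ℂ) 𝓘(ℂ, Fin 2 → ℂ) proj (σ w) :=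
    (contMDiffAt_proj (ne_zero_of_apply_ne_zero hw.1)).mdifferentiableAt (by simp)
  have h2 := h1.hasMFDerivAt.comp w h.hasFDerivAt.hasMFDerivAt
  refine h2.congr_mfderiv ?_
  ext
  have h3 := mfderiv_proj_field hw
  rw [hi, one_smul] at h3
  change mfderiv 𝓘(ℂ, Fin 3 → ℂ) 𝓘(ℂ, Fin 2 → ℂ) proj (σ w)
    ((1 : ℂ) • F.field i j (σ w)) = (1 : ℂ) • F.X j (proj (σ w))
  rw [one_smul, one_smul, h3]

/-- Local integral curves in homogeneous coordinates. -/
lemma exists_integralCurve {i : Fin 3} {j : F.ι} {v : Fin 3 → ℂ} (hv : v ∈ F.dom i j)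
    (hi : v i = 1) : ∃ (r : ℝ) (σ : ℂ → Fin 3 → ℂ), 0 < r ∧ σ 0 = v ∧
      ∀ z ∈ Metric.ball (0 : ℂ) r, σ z ∈ F.dom i j ∧ σ z i = 1 ∧
        HasDerivAt σ (F.field i j (σ z)) z ∧ F.FlowStep (proj v) (proj (σ z)) := by
  obtain ⟨r, σ, hr, h0, hσ⟩ := exists_hasDerivAt_of_contDiffAt
    ((F.contDiffAt_field hv).of_le (m := 1) (by simp))
  have h1 : ∀ᶠ z in 𝓝 (0 : ℂ), σ z ∈ F.dom i j :=
    (hσ 0 (Metric.mem_ball_self hr)).continuousAt.eventually_mem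
      ((F.isOpen_dom i j).mem_nhds (h0 ▸ hv))
  obtain ⟨s, hs, hball⟩ := Metric.eventually_nhds_iff_ball.1
    (h1.and (Metric.ball_mem_nhds (0 : ℂ) hr))
  have h2 : ∀ z ∈ Metric.ball (0 : ℂ) s, σ z i = 1 := by
    intro z hz
    have h3 : ∀ z ∈ Metric.ball (0 : ℂ) s, HasDerivAt (fun z => σ z i) 0 z := by
      intro z hz
      have := hasDerivAt_pi.1 (hσ z (hball z hz).2) i
      rwa [field_apply_self (hball z hz).1] at this
    have h4 := (convex_ball (0 : ℂ) s).norm_image_sub_le_of_norm_hasDerivWithin_le (C := 0)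
      (fun w hw => (h3 w hw).hasDerivWithinAt) (by simp) (Metric.mem_ball_self hs) hz
    rw [zero_mul, norm_le_zero_iff, sub_eq_zero, h0, hi] at h4
    exact h4
  refine ⟨s, σ, hs, h0, fun z hz => ⟨(hball z hz).1, h2 z hz, hσ z (hball z hz).2, ?_⟩⟩
  exact ⟨j, fun z => proj (σ z), s, z, hz, congrArg proj h0, rfl, fun w hw =>
    ⟨(hball w hw).1.2, hasMFDerivAt_proj_comp (hσ w (hball w hw).2) (hball w hw).1 (h2 w hw)⟩⟩

end HolomorphicFoliation

/-! ### Topology of the projective plane and of its algebraic curves -/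

namespace MvPolynomial

lemma hasDerivAt_eval {σ : ℂ → Fin 3 → ℂ} {σ' : Fin 3 → ℂ} {z : ℂ} (h : HasDerivAt σ σ' z)
    (f : MvPolynomial (Fin 3) ℂ) :
    HasDerivAt (fun w => eval (σ w) f) ((fun c => eval (σ z) (pderiv c f)) ⬝ᵥ σ') z := by
  induction f using MvPolynomial.induction_on with
  | C a => simpa [dotProduct] using hasDerivAt_const z a
  | add p q hp hq =>
    simpa [dotProduct, add_mul, Finset.sum_add_distrib] using hp.fun_add hq
  | mul_X p k hp =>
    have h1 := hp.mul (hasDerivAt_pi.1 h k)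
    simp only [map_mul, eval_X]
    refine h1.congr_deriv ?_
    simp only [dotProduct, Derivation.leibniz, pderiv_X, smul_eq_mul, map_add, map_mul, eval_X,
      add_mul, Finset.sum_add_distrib, Finset.sum_mul]
    rw [add_comm]
    congr 1
    · rw [Finset.sum_eq_single k]
      · simp
      · intro b _ hb
        simp [hb.symm]
      · simp
    · exact Finset.sum_congr rfl fun i _ => by ring

lemma contDiff_eval {n : WithTop ℕ∞} (f : MvPolynomial (Fin 3) ℂ) :
    ContDiff ℂ n fun v : Fin 3 → ℂ => eval v f := by
  have h : AnalyticOnNhd ℂ (fun v : Fin 3 → ℂ => aeval v f) univ :=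
    AnalyticOnNhd.aeval_mvPolynomial (fun i => (ContinuousLinearMap.proj
      (R := ℂ) (φ := fun _ : Fin 3 => ℂ) i).analyticOnNhd univ) f
  exact h.contDiff

lemma continuous_eval' (f : MvPolynomial (Fin 3) ℂ) :
    Continuous fun v : Fin 3 → ℂ => eval v f := (contDiff_eval (n := 0) f).continuous

end MvPolynomial

namespace CP2

open MvPolynomial

lemma isClosed_zeroSet {f : MvPolynomial (Fin 3) ℂ} {n : ℕ} (hf : f.IsHomogeneous n) :
    IsClosed (zeroSet f) := by
  rw [← isOpen_compl_iff]
  change IsOpen ((Quotient.mk (projectivizationSetoid ℂ (Fin 3 → ℂ))) ⁻¹' (zeroSet f)ᶜ)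
  have h : (Quotient.mk (projectivizationSetoid ℂ (Fin 3 → ℂ))) ⁻¹' (zeroSet f)ᶜ =
      {v | eval v.1 f ≠ 0} := by
    ext v
    exact not_congr (mem_zeroSet_mk hf v.2)
  rw [h]
  exact isOpen_ne_fun ((continuous_eval' f).comp continuous_subtype_val) continuous_const

instance : T1Space CP2 := by
  refine ⟨fun p => ?_⟩
  obtain ⟨v, hv, rfl⟩ := exists_proj_eq p
  -- the point is cut out by the linear forms that vanish on `v`
  have h : {proj v} = ⋂ (i : Fin 3) (j : Fin 3), zeroSet (C (v i) * X j - C (v j) * X i) := by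
    ext q
    obtain ⟨w, hw, rfl⟩ := exists_proj_eq q
    have hh : ∀ i j, (C (v i) * X j - C (v j) * X i : MvPolynomial (Fin 3) ℂ).IsHomogeneous 1 :=
      fun i j => ((isHomogeneous_X ℂ j).C_mul _).sub ((isHomogeneous_X ℂ i).C_mul _)
    simp only [mem_singleton_iff, mem_iInter, proj_mem_zeroSet (hh _ _) hw, map_sub, map_mul,
      eval_C, eval_X]
    constructor
    · intro he i j
      obtain ⟨c, -, rfl⟩ := exists_eq_smul_of_proj_eq hw hv he
      simp; ring
    · intro he
      obtain ⟨i, hi⟩ := Function.ne_iff.1 hv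
      have hwv : w = (w i / v i) • v := by
        funext j
        have := he i j
        simp only [Pi.smul_apply, smul_eq_mul]
        rw [div_mul_eq_mul_div, eq_div_iff hi]
        linear_combination this
      rw [hwv, proj_smul _ hv]
      intro h0
      rw [h0, zero_smul] at hwv
      exact hw hwv
  rw [h]
  exact isClosed_iInter fun i => isClosed_iInter fun j => isClosed_zeroSet
    (((isHomogeneous_X ℂ j).C_mul _).sub ((isHomogeneous_X ℂ i).C_mul _))

instance : CompactSpace CP2 := by
  refine ⟨?_⟩
  have h : proj '' Metric.sphere (0 : Fin 3 → ℂ) 1 = univ := by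
    refine eq_univ_of_forall fun p => ?_
    obtain ⟨v, hv, rfl⟩ := exists_proj_eq p
    have hn : ‖v‖ ≠ 0 := norm_ne_zero_iff.2 hv
    refine ⟨((‖v‖ : ℂ)⁻¹) • v, ?_, proj_smul (by simpa using hv) hv⟩
    rw [mem_sphere_zero_iff_norm, norm_smul, norm_inv, Complex.norm_real, norm_norm,
      inv_mul_cancel₀ hn]
  rw [← h]
  refine (isCompact_sphere _ _).image_of_continuousOn fun v hv => ?_
  refine (continuousAt_proj ?_).continuousWithinAt
  rintro rfl
  simp at hv

/-- Holomorphic functions on an affine chart have no isolated zeros. -/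
lemma infinite_zeros {i : Fin 3} {h : (Fin 3 → ℂ) → ℂ} {v : Fin 3 → ℂ} (hi : v i = 1)
    (hd : ∀ᶠ w in 𝓝 v, DifferentiableAt ℂ h w) (h0 : h v = 0) {N : Set CP2}
    (hN : N ∈ 𝓝 (proj v)) : {p | p ∈ N ∧ p ∈ affineSet i ∧ h (sec i p) = 0}.Infinite := by
  intro hfin
  have hv0 : v ≠ 0 := ne_zero_of_apply_ne_zero (i := i) (by simp [hi])
  have hp : proj v ∈ affineSet i := (proj_mem_affineSet hv0).2 (by simp [hi])
  let ψ : ℂ × ℂ → (Fin 3 → ℂ) := fun u => i.insertNth (1 : ℂ) (![u.1, u.2] : Fin 2 → ℂ)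
  have hψd : Differentiable ℂ ψ := by
    have h1 : Differentiable ℂ fun u : ℂ × ℂ => (![u.1, u.2] : Fin 2 → ℂ) := by
      refine differentiable_pi.2 fun k => ?_
      fin_cases k
      · exact differentiable_fst
      · exact differentiable_snd
    exact ((contDiff_insertNth i).differentiable (by simp)).comp h1
  have hψi : ∀ u, ψ u i = 1 := fun u => by simp [ψ]
  have hψ0 : ∀ u, ψ u ≠ 0 := fun u => insertNth_ne_zero i _
  have hψs : ∀ u, proj (ψ u) ∈ affineSet i := fun u =>
    (proj_mem_affineSet (hψ0 u)).2 (by simp [hψi])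
  have hsec : ∀ u, sec i (proj (ψ u)) = ψ u := fun u => by
    rw [sec_proj (by simp [hψi]), hψi, inv_one, one_smul]
  set u₀ : ℂ × ℂ := (v (i.succAbove 0), v (i.succAbove 1)) with hu₀
  have hψu₀ : ψ u₀ = v := by
    funext k
    refine Fin.succAboveCases i ?_ (fun k => ?_) k
    · rw [hψi, hi]
    · fin_cases k <;> simp [ψ, hu₀]
  have hinj : Function.Injective ψ := by
    intro u u' huu
    have h1 := congrFun huu (i.succAbove 0)
    have h2 := congrFun huu (i.succAbove 1)
    simp only [ψ, Fin.insertNth_apply_succAbove] at h1 h2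
    exact Prod.ext h1 h2
  have hcont : ContinuousAt (fun u => proj (ψ u)) u₀ :=
    ContinuousAt.comp (g := proj) (continuousAt_proj (hψ0 u₀)) hψd.continuous.continuousAt
  have hfreq := frequently_eq_zero_of_two_variables (h := fun u => h (ψ u)) (u := u₀) (by
    have : ∀ᶠ u in 𝓝 u₀, DifferentiableAt ℂ h (ψ u) :=
      hψd.continuous.continuousAt.eventually (hψu₀ ▸ hd)
    exact this.mono fun u hu => hu.comp u (hψd u)) (by simp only [hψu₀, h0])
  set S := {p | p ∈ N ∧ p ∈ affineSet i ∧ h (sec i p) = 0}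
  have hS : (S \ {proj v})ᶜ ∈ 𝓝 (proj (ψ u₀)) := by
    rw [hψu₀]
    exact (hfin.subset sdiff_subset).isClosed.isOpen_compl.mem_nhds (by simp)
  have hev : ∀ᶠ u in 𝓝[≠] u₀, proj (ψ u) ∈ N ∧ proj (ψ u) ∈ (S \ {proj v})ᶜ ∧ u ≠ u₀ := by
    filter_upwards [nhdsWithin_le_nhds (hcont.eventually_mem (by rw [hψu₀]; exact hN)),
      nhdsWithin_le_nhds (hcont.eventually_mem hS), self_mem_nhdsWithin] with u h1 h2 h3
    exact ⟨h1, h2, h3⟩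
  obtain ⟨u, hu0, h1, h2, h3⟩ := (hfreq.and_eventually hev).exists
  refine h2 ⟨⟨h1, hψs u, by rw [hsec]; exact hu0⟩, ?_⟩
  intro h4
  apply h3
  apply hinj
  rw [hψu₀, ← hsec, h4, sec_proj (by simp [hi]), hi, inv_one, one_smul]

lemma infinite_zeroSet_inter {f : MvPolynomial (Fin 3) ℂ} {n : ℕ} (hf : f.IsHomogeneous n) {p : CP2}
    (hp : p ∈ zeroSet f) {N : Set CP2} (hN : N ∈ 𝓝 p) : (zeroSet f ∩ N).Infinite := by
  obtain ⟨i, hi⟩ := exists_mem_affineSet p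
  have hmem : ∀ q ∈ affineSet i, (q ∈ zeroSet f ↔ eval (sec i q) f = 0) := fun q hq => by
    rw [← proj_mem_zeroSet hf (sec_ne_zero i q), proj_sec hq]
  refine (infinite_zeros (sec_self i p) (h := fun v => eval v f)
    (Eventually.of_forall fun w => (contDiff_eval (n := 1) f).differentiable (by simp) w)
    ((hmem p hi).1 hp) (N := N) (by rwa [proj_sec hi])).mono ?_
  rintro q ⟨h1, h2, h3⟩
  exact ⟨(hmem q h2).2 h3, h1⟩

end CP2

namespace HolomorphicFoliation

open CP2

variable (F : HolomorphicFoliation)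

lemma isOpen_compl_sing : IsOpen F.singᶜ := by
  rw [isOpen_iff_mem_nhds]
  intro p hp
  obtain ⟨v, hv, rfl⟩ := exists_proj_eq p
  obtain ⟨i, j, hij⟩ := F.exists_mem_dom hv
  have hs : proj v ∈ affineSet i := (proj_mem_affineSet hv).2 hij.1
  have hsec : sec i (proj v) ∈ F.dom i j := by
    rw [sec_proj hij.1]; exact smul_mem_dom (inv_ne_zero hij.1) hij
  have h1 : ∀ᶠ w in 𝓝 (sec i (proj v)), F.form i j w ≠ 0 ∧ w ∈ F.dom i j := by
    refine ((contDiffAt_form hsec).continuousAt.eventually_ne ?_).and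
      ((F.isOpen_dom i j).mem_nhds hsec)
    rw [form_ne_zero_iff hsec, proj_sec hs]
    exact hp
  have h2 : ContinuousAt (sec i) (proj v) := (contMDiffAt_sec hs).continuousAt
  filter_upwards [h2.eventually h1, (isOpen_affineSet i).mem_nhds hs] with q hq hqs
  rw [form_ne_zero_iff hq.2, proj_sec hqs] at hq
  exact hq.1

lemma finite_sing : F.sing.Finite := by
  have h : ∀ p : CP2, ∃ N ∈ 𝓝 p, (F.sing ∩ N).Finite := by
    intro p
    by_cases hp : p ∈ F.sing
    · obtain ⟨j, hj, h0⟩ := hp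
      refine ⟨_, inter_mem ((F.isOpen_U j).mem_nhds hj)
        (eventually_nhdsWithin_iff.1 (F.isolated_zeros j p hj h0)),
        (finite_singleton p).subset ?_⟩
      rintro q ⟨hq, hqj, hq0⟩
      by_contra hne
      exact hq0 hne ((X_eq_zero_iff hqj).2 hq)
    · exact ⟨F.singᶜ, F.isOpen_compl_sing.mem_nhds hp, by simp⟩
  have := (isCompact_univ (X := CP2)).induction_on (p := fun s => (F.sing ∩ s).Finite)
    (by simp) (fun s t hst ht => ht.subset (inter_subset_inter_right _ hst))
    (fun s t hs ht => by rw [inter_union_distrib_left]; exact hs.union ht)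
    (fun p _ => by
      obtain ⟨N, hN, hf⟩ := h p
      exact ⟨N, nhdsWithin_le_nhds hN, hf⟩)
  simpa using this

end HolomorphicFoliation

/-! ### Polynomial forms defining a foliation -/

namespace MvPolynomial

open scoped Matrix

/-- The value at a point of `ℂ³` of a one-form with polynomial coefficients. -/
noncomputable def evalVec (A : Fin 3 → MvPolynomial (Fin 3) ℂ) (v : Fin 3 → ℂ) : Fin 3 → ℂ :=
  fun c => eval v (A c)

lemma evalVec_cross (A B : Fin 3 → MvPolynomial (Fin 3) ℂ) (v : Fin 3 → ℂ) :
    evalVec (A ⨯₃ B) v = evalVec A v ⨯₃ evalVec B v := by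
  funext c
  fin_cases c <;> simp [evalVec, cross_apply]

lemma evalVec_smul (f : MvPolynomial (Fin 3) ℂ) (A : Fin 3 → MvPolynomial (Fin 3) ℂ)
    (v : Fin 3 → ℂ) : evalVec (f • A) v = eval v f • evalVec A v := by
  funext c; simp [evalVec]

lemma continuous_evalVec (A : Fin 3 → MvPolynomial (Fin 3) ℂ) : Continuous (evalVec A) :=
  continuous_pi fun c => continuous_eval' (A c)

/-- Euler's identity for the values of the gradient. -/
lemma evalVec_grad_dotProduct_self {f : MvPolynomial (Fin 3) ℂ} {n : ℕ} (hf : f.IsHomogeneous n)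
    (v : Fin 3 → ℂ) : evalVec (grad f) v ⬝ᵥ v = n * eval v f := by
  have h := congrArg (eval v) hf.sum_X_mul_pderiv
  simp only [map_sum, map_mul, eval_X, nsmul_eq_mul, map_natCast] at h
  rw [← h, dotProduct]
  exact Finset.sum_congr rfl fun i _ => mul_comm _ _

end MvPolynomial

open scoped Matrix in
lemma exists_eq_smul_of_cross_eq_zero {a b : Fin 3 → ℂ} (hb : b ≠ 0) (h : a ⨯₃ b = 0) :
    ∃ m : ℂ, a = m • b := by
  have h1 : b ⨯₃ a = 0 := by rw [← cross_anticomm, h, neg_zero]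
  by_contra! hcon
  exact (crossProduct_ne_zero_iff_linearIndependent.2
    ((LinearIndependent.pair_iff' hb).2 fun m hm => hcon m hm.symm)) h1

namespace HolomorphicFoliation

open CP2 MvPolynomial
open scoped Matrix

variable {F : HolomorphicFoliation}

variable (F) in
/-- The polynomial one-form `A` defines the foliation off its singular set: there it is a nonzero
multiple of the local forms. -/
def IsDefinedBy (A : Fin 3 → MvPolynomial (Fin 3) ℂ) : Prop :=
  ∀ i j v, v ∈ F.dom i j → proj v ∉ F.sing → ∃ m : ℂ, m ≠ 0 ∧ evalVec A v = m • F.form i j v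

lemma form_dotProduct_self (i : Fin 3) (j : F.ι) (v : Fin 3 → ℂ) : F.form i j v ⬝ᵥ v = 0 := by
  rw [dotProduct_comm]; exact dot_self_cross _ _

lemma form_dotProduct_field (i : Fin 3) (j : F.ι) (v : Fin 3 → ℂ) :
    F.form i j v ⬝ᵥ F.field i j v = 0 := by
  rw [dotProduct_comm]; exact dot_cross_self _ _

/-- A form of degree `k` defines the foliation if and only if it is a nonzero multiple of the local
forms at the nonsingular points: both have the same kernel, spanned by the radial vector and a lift
of the local vector field. -/
lemma hasDegree_iff {k : ℕ} : F.HasDegree k ↔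
    ∃ A : Fin 3 → MvPolynomial (Fin 3) ℂ, (∀ i, (A i).IsHomogeneous k) ∧ F.IsDefinedBy A := by
  refine exists_congr fun A => and_congr_right fun _ => ⟨fun h i j v hv hs => ?_, ?_⟩
  · have hv0 := ne_zero_of_apply_ne_zero hv.1
    have key : ∀ w : Fin 3 → ℂ, evalVec A v ⬝ᵥ w = 0 ↔ ∃ c : ℂ,
        (v i)⁻¹ • w - (w i / v i ^ 2) • v = c • F.field i j v := fun w =>
      (h v hv0 hs j hv.2 w).trans (exists_congr fun c => mfderiv_proj_eq_smul_iff hv w c)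
    have hv1 := hv.1
    have h1 : evalVec A v ⬝ᵥ v = 0 := (key v).2 ⟨0, by
      rw [zero_smul, ← sub_smul]
      have : (v i)⁻¹ - v i / v i ^ 2 = 0 := by field_simp; simp
      rw [this, zero_smul]⟩
    have h2 : evalVec A v ⬝ᵥ F.field i j v = 0 := (key _).2 ⟨(v i)⁻¹, by
      rw [field_apply_self hv, zero_div, zero_smul, sub_zero]⟩
    have hform : F.form i j v ≠ 0 := (form_ne_zero_iff hv).2 hs
    obtain ⟨m, hm⟩ := exists_eq_smul_of_cross_eq_zero hform (a := evalVec A v) (by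
      rw [form, cross_cross_eq_smul_sub_smul', h2, dotProduct_comm v, h1]
      simp)
    refine ⟨m, ?_, hm⟩
    rintro rfl
    rw [zero_smul] at hm
    -- if `A` vanished at `v`, all tangent vectors would be tangent to the foliation
    apply hform
    have h3 : ∀ w : Fin 3 → ℂ, w ⬝ᵥ F.form i j v = 0 := by
      intro w
      obtain ⟨c, hc⟩ := (key w).1 (by rw [hm, zero_dotProduct])
      have h4 := congrArg (fun u => F.form i j v ⬝ᵥ u) hc
      simp only [dotProduct_sub, dotProduct_smul, form_dotProduct_self, form_dotProduct_field,
        smul_zero, sub_zero] at h4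
      rw [dotProduct_comm]
      exact (smul_eq_zero.1 h4).resolve_left (inv_ne_zero hv1)
    funext c
    simpa using h3 (Pi.single c 1)
  · intro h v hv0 hs j hj w
    obtain ⟨i, hi⟩ := Function.ne_iff.1 hv0
    have hv : v ∈ F.dom i j := ⟨hi, hj⟩
    have hi' : v i ≠ 0 := hi
    obtain ⟨m, hm0, hm⟩ := h i j v hv hs
    have hY : F.field i j v ≠ 0 := (field_ne_zero_iff hv).2 hs
    refine Iff.trans ?_ (exists_congr fun c => (mfderiv_proj_eq_smul_iff hv w c).symm)
    change evalVec A v ⬝ᵥ w = 0 ↔ _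
    set u := (v i)⁻¹ • w - (w i / v i ^ 2) • v with hu
    have hu1 : evalVec A v ⬝ᵥ w = 0 ↔ F.form i j v ⬝ᵥ u = 0 := by
      rw [hm, hu, dotProduct_sub, dotProduct_smul, dotProduct_smul, form_dotProduct_self,
        smul_dotProduct, smul_zero, sub_zero, smul_eq_zero, smul_eq_zero]
      simp [hm0, hi']
    rw [hu1]
    constructor
    · intro h1
      have hui : u i = 0 := by
        simp only [hu, Pi.sub_apply, Pi.smul_apply, smul_eq_mul]
        field_simp
        ring
      have hYi := field_apply_self hv
      have h2 : v ⬝ᵥ (F.field i j v ⨯₃ u) = 0 := by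
        rw [dotProduct_comm, form, triple_product_permutation] at h1
        exact h1
      have h3 : F.field i j v ⨯₃ u = 0 := by
        simp only [cross_apply] at h2 ⊢
        funext c
        fin_cases i <;> fin_cases c <;>
          simp [dotProduct, Fin.sum_univ_three] at hui hYi h2 hi' ⊢ <;> grind
      refine exists_eq_smul_of_cross_eq_zero hY ?_
      rw [← cross_anticomm, h3, neg_zero]
    · rintro ⟨c, hc⟩
      rw [hc, dotProduct_smul, form_dotProduct_field, smul_zero]

lemma IsDefinedBy.ne_zero {A : Fin 3 → MvPolynomial (Fin 3) ℂ} (hA : F.IsDefinedBy A)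
    {i : Fin 3} {j : F.ι} {v : Fin 3 → ℂ} (hv : v ∈ F.dom i j) (hs : proj v ∉ F.sing) :
    evalVec A v ≠ 0 := by
  obtain ⟨m, hm, h⟩ := hA i j v hv hs
  rw [h]
  exact smul_ne_zero hm ((form_ne_zero_iff hv).2 hs)

lemma IsDefinedBy.dotProduct_field {A : Fin 3 → MvPolynomial (Fin 3) ℂ} (hA : F.IsDefinedBy A)
    {i : Fin 3} {j : F.ι} {v : Fin 3 → ℂ} (hv : v ∈ F.dom i j) (hs : proj v ∉ F.sing) :
    evalVec A v ⬝ᵥ F.field i j v = 0 := by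
  obtain ⟨m, hm, h⟩ := hA i j v hv hs
  rw [h, smul_dotProduct, form_dotProduct_field, smul_zero]

/-! ### Leaves and invariant curves -/

/-- A property that is locally constant along integral curves is constant along flow steps. -/
lemma FlowStep.iff_of_locally {P : CP2 → Prop}
    (h : ∀ (j : F.ι) (γ : ℂ → CP2) (w₀ : ℂ), (∀ᶠ w in 𝓝 w₀, γ w ∈ F.U j ∧
      HasMFDerivAt 𝓘(ℂ, ℂ) 𝓘(ℂ, Fin 2 → ℂ) γ w ((1 : ℂ →L[ℂ] ℂ).smulRight (F.X j (γ w)))) →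
      ∀ᶠ w in 𝓝 w₀, (P (γ w₀) ↔ P (γ w))) {p q : CP2} (hpq : F.FlowStep p q) : P p ↔ P q := by
  obtain ⟨j, γ, r, z, hz, rfl, rfl, hγ⟩ := hpq
  refine (convex_ball (0 : ℂ) r).isPreconnected.induction₂ (fun x y => P (γ x) ↔ P (γ y)) ?_
    (fun x y z _ _ _ h1 h2 => h1.trans h2) (fun x y _ _ h1 => h1.symm)
    (Metric.mem_ball_self ((norm_nonneg z).trans_lt (by simpa using hz))) hz
  intro w hw
  refine nhdsWithin_le_nhds (h j γ w ?_)
  filter_upwards [Metric.isOpen_ball.mem_nhds hw] with w' hw'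
  exact hγ w' hw'

/-- In homogeneous coordinates an integral curve of `X j` is an integral curve of `field i j`. -/
lemma eventually_hasDerivAt_sec {j : F.ι} {γ : ℂ → CP2} {w₀ : ℂ} {i : Fin 3}
    (hγ : ∀ᶠ w in 𝓝 w₀, γ w ∈ F.U j ∧
      HasMFDerivAt 𝓘(ℂ, ℂ) 𝓘(ℂ, Fin 2 → ℂ) γ w ((1 : ℂ →L[ℂ] ℂ).smulRight (F.X j (γ w))))
    (hi : γ w₀ ∈ affineSet i) :
    ∀ᶠ w in 𝓝 w₀, proj (sec i (γ w)) = γ w ∧ sec i (γ w) ∈ F.dom i j ∧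
      HasDerivAt (fun z => sec i (γ z)) (F.field i j (sec i (γ w))) w := by
  filter_upwards [hγ, hγ.self_of_nhds.2.continuousAt.eventually_mem
    ((isOpen_affineSet i).mem_nhds hi)] with w hw hwi
  exact ⟨proj_sec hwi, ⟨by simp [sec_self], by rw [proj_sec hwi]; exact hw.1⟩,
    hasDerivAt_sec_comp hw.2 hwi⟩

/-- Integral curves do not reach the singular set. -/
lemma FlowStep.mem_sing_iff {p q : CP2} (hpq : F.FlowStep p q) : p ∈ F.sing ↔ q ∈ F.sing := by
  refine hpq.iff_of_locally (P := (· ∈ F.sing)) fun j γ w₀ hγ => ?_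
  have hc : ContinuousAt γ w₀ := hγ.self_of_nhds.2.continuousAt
  by_cases hs : γ w₀ ∈ F.sing
  · obtain ⟨i, hi⟩ := exists_mem_affineSet (γ w₀)
    have h1 := eventually_hasDerivAt_sec hγ hi
    obtain ⟨h2, h3, h4⟩ := h1.self_of_nhds
    have h0 : F.field i j (sec i (γ w₀)) = 0 := by
      by_contra h
      rw [← Ne, field_ne_zero_iff h3, h2] at h
      exact h hs
    obtain ⟨L, s, hsn, hL⟩ := ((F.contDiffAt_field h3).of_le (m := 1)
      (by simp)).exists_lipschitzOnWith
    have h5 := eventually_eq_zero_of_norm_deriv_le (w₀ := w₀) (C := L)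
      (φ := fun w => sec i (γ w) - sec i (γ w₀)) (φ' := fun w => F.field i j (sec i (γ w))) (by
        filter_upwards [h1, h4.continuousAt.eventually_mem hsn] with w hw hws
        refine ⟨hw.2.2.sub_const _, ?_⟩
        have := hL.dist_le_mul _ hws _ (mem_of_mem_nhds hsn)
        rwa [h0, dist_zero_right, dist_eq_norm] at this) (by simp)
    filter_upwards [h1, h5] with w hw hw0
    have : γ w = γ w₀ := by rw [← hw.1, ← h2, sub_eq_zero.1 hw0]
    rw [this]
  · filter_upwards [hc.eventually_mem (F.isOpen_compl_sing.mem_nhds hs)] with w hw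
    exact iff_of_false hs hw

/-- If `f` divides `A ∧ df` for a form `A` that defines the foliation, then the curve `f = 0` is
invariant: along an integral curve `f` solves a linear differential equation. -/
lemma FlowStep.mem_zeroSet_iff {A θ : Fin 3 → MvPolynomial (Fin 3) ℂ} (hA : F.IsDefinedBy A)
    {f : MvPolynomial (Fin 3) ℂ} {n : ℕ} (hf : f.IsHomogeneous n) (hθ : A ⨯₃ grad f = f • θ)
    {p q : CP2} (hpq : F.FlowStep p q) :
    (p ∉ F.sing ∧ p ∈ zeroSet f) ↔ (q ∉ F.sing ∧ q ∈ zeroSet f) := by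
  refine hpq.iff_of_locally (P := fun p => p ∉ F.sing ∧ p ∈ zeroSet f) fun j γ w₀ hγ => ?_
  have hc : ContinuousAt γ w₀ := hγ.self_of_nhds.2.continuousAt
  by_cases hf0 : γ w₀ ∈ zeroSet f
  swap
  · filter_upwards [hc.eventually_mem ((isClosed_zeroSet hf).isOpen_compl.mem_nhds hf0)] with w hw
    exact iff_of_false (fun h => hf0 h.2) fun h => hw h.2
  by_cases hs : γ w₀ ∈ F.sing
  · have h1 : ∀ᶠ w in 𝓝 w₀, γ w ∈ F.sing := by
      obtain ⟨r, hr, hball⟩ := Metric.eventually_nhds_iff_ball.1 hγ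
      filter_upwards [Metric.ball_mem_nhds w₀ hr] with w hw
      refine (FlowStep.mem_sing_iff (p := γ w₀) ⟨j, fun z => γ (w₀ + z), r, w - w₀, ?_, by simp,
        by simp, fun z hz => ?_⟩).1 hs
      · simpa [dist_eq_norm] using hw
      · obtain ⟨h1, h2⟩ := hball (w₀ + z) (by simpa [dist_eq_norm] using hz)
        refine ⟨h1, ?_⟩
        have h3 : HasMFDerivAt 𝓘(ℂ, ℂ) 𝓘(ℂ, ℂ) (fun z : ℂ => w₀ + z) z
            (ContinuousLinearMap.id ℂ ℂ) :=
          ((hasFDerivAt_id z).const_add w₀).hasMFDerivAt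
        exact h2.comp z h3
    filter_upwards [h1] with w hw
    exact iff_of_false (fun h => h.1 hs) fun h => h.1 hw
  obtain ⟨i, hi⟩ := exists_mem_affineSet (γ w₀)
  have h1 := eventually_hasDerivAt_sec hγ hi
  have hns : ∀ᶠ w in 𝓝 w₀, γ w ∉ F.sing :=
    hc.eventually_mem (F.isOpen_compl_sing.mem_nhds hs)
  obtain ⟨h2, h3, h4⟩ := h1.self_of_nhds
  obtain ⟨c, hcA⟩ := Function.ne_iff.1 (hA.ne_zero h3 (by rwa [h2]))
  set σ : ℂ → Fin 3 → ℂ := fun w => sec i (γ w) with hσ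
  have hcontA : ContinuousAt (fun w => evalVec A (σ w) c) w₀ :=
    (continuous_eval' (A c)).continuousAt.comp h4.continuousAt
  -- `φ' = k φ` for the following continuous function `k`
  set k : ℂ → ℂ := fun w => -(evalVec θ (σ w) ⨯₃ F.field i j (σ w)) c / evalVec A (σ w) c with hk
  have hkc : ContinuousAt k w₀ := by
    have h5 : ContinuousAt (fun w => F.field i j (σ w)) w₀ :=
      ContinuousAt.comp (g := F.field i j) (F.contDiffAt_field h3).continuousAt h4.continuousAt
    have h6 : ContinuousAt (fun w => evalVec θ (σ w)) w₀ :=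
      (continuous_evalVec θ).continuousAt.comp h4.continuousAt
    refine ContinuousAt.div (ContinuousAt.neg ?_) hcontA hcA
    have h5' := fun k => (continuousAt_pi.1 h5) k
    have h6' := fun k => (continuousAt_pi.1 h6) k
    fin_cases c <;> simp only [cross_apply]
    · exact ((h6' 1).mul (h5' 2)).sub ((h6' 2).mul (h5' 1))
    · exact ((h6' 2).mul (h5' 0)).sub ((h6' 0).mul (h5' 2))
    · exact ((h6' 0).mul (h5' 1)).sub ((h6' 1).mul (h5' 0))
  have h7 := eventually_eq_zero_of_norm_deriv_le (w₀ := w₀) (C := ‖k w₀‖ + 1)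
    (φ := fun w => eval (σ w) f) (φ' := fun w => k w * eval (σ w) f) (by
      filter_upwards [h1, hns, hcontA.eventually_ne hcA,
        hkc.norm.eventually_lt_const (lt_add_one _)] with w hw hwns hwA hwk
      refine ⟨(hasDerivAt_eval hw.2.2 f).congr_deriv ?_, ?_⟩
      · have h8 := hA.dotProduct_field hw.2.1 (by rwa [hw.1])
        have h9 : evalVec A (σ w) ⨯₃ evalVec (grad f) (σ w) = eval (σ w) f • evalVec θ (σ w) := by
          rw [← evalVec_cross, hθ, evalVec_smul]
        have h10 := cross_cross_eq_smul_sub_smul (evalVec A (σ w)) (evalVec (grad f) (σ w))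
          (F.field i j (σ w))
        rw [h9, h8, zero_smul, zero_sub] at h10
        have h11 := congrFun h10 c
        simp only [map_smul, LinearMap.smul_apply, Pi.smul_apply, Pi.neg_apply, smul_eq_mul] at h11
        rw [hk]
        simp only
        rw [div_mul_eq_mul_div, eq_div_iff hwA]
        change (evalVec (grad f) (σ w) ⬝ᵥ F.field i j (σ w)) * _ = _
        linear_combination h11
      · rw [norm_mul]
        exact mul_le_mul_of_nonneg_right hwk.le (norm_nonneg _)) (by
      rw [← proj_mem_zeroSet hf (sec_ne_zero i _), h2]
      exact hf0)
  filter_upwards [h1, h7, hns] with w hw hw0 hwns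
  refine iff_of_true ⟨hs, hf0⟩ ⟨hwns, ?_⟩
  rw [← hw.1, proj_mem_zeroSet hf (sec_ne_zero i _)]
  exact hw0

lemma iff_of_mem_leafThrough {P : CP2 → Prop} (h : ∀ p q, F.FlowStep p q → (P p ↔ P q)) {p q : CP2}
    (hq : q ∈ F.leafThrough p) : P p ↔ P q := by
  induction hq with
  | rel x y hxy => exact h x y hxy
  | refl x => exact Iff.rfl
  | symm x y _ ih => exact ih.symm
  | trans x y z _ _ ih1 ih2 => exact ih1.trans ih2

lemma not_mem_sing_of_mem_leafThrough {p q : CP2} (hq : q ∈ F.leafThrough p) (hp : p ∉ F.sing) :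
    q ∉ F.sing :=
  (not_congr (iff_of_mem_leafThrough (fun _ _ h => h.mem_sing_iff) hq)).1 hp

lemma leafThrough_subset_zeroSet {A θ : Fin 3 → MvPolynomial (Fin 3) ℂ} (hA : F.IsDefinedBy A)
    {f : MvPolynomial (Fin 3) ℂ} {n : ℕ} (hf : f.IsHomogeneous n) (hθ : A ⨯₃ grad f = f • θ)
    {p : CP2} (hp : p ∉ F.sing) (hpf : p ∈ zeroSet f) : F.leafThrough p ⊆ zeroSet f := fun _ hq =>
  ((iff_of_mem_leafThrough (fun _ _ h => h.mem_zeroSet_iff hA hf hθ) hq).1 ⟨hp, hpf⟩).2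

end HolomorphicFoliation

/-! ### Linear coordinates, homogenization and projection from a point -/

namespace MvPolynomial

/-- Every nonzero vector is part of a basis of `ℂ³`; the dual basis is given by linear forms. -/
lemma exists_linear_coordinates {e : Fin 3 → ℂ} (he : e ≠ 0) :
    ∃ (b : Fin 3 → Fin 3 → ℂ) (ℓ : Fin 3 → MvPolynomial (Fin 3) ℂ), b 2 = e ∧
      (∀ k, (ℓ k).IsHomogeneous 1) ∧
      (∀ v, eval v (ℓ 0) • b 0 + eval v (ℓ 1) • b 1 + eval v (ℓ 2) • b 2 = v) ∧
      ∀ x y z : ℂ, eval (x • b 0 + y • b 1 + z • b 2) (ℓ 0) = x ∧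
        eval (x • b 0 + y • b 1 + z • b 2) (ℓ 1) = y ∧
        eval (x • b 0 + y • b 1 + z • b 2) (ℓ 2) = z := by
  obtain ⟨i, hi⟩ := Function.ne_iff.1 he
  simp only [Pi.zero_apply] at hi
  refine ⟨![Pi.single (i.succAbove 0) 1, Pi.single (i.succAbove 1) 1, e],
    ![X (i.succAbove 0) - C (e (i.succAbove 0) / e i) * X i,
      X (i.succAbove 1) - C (e (i.succAbove 1) / e i) * X i, C (1 / e i) * X i], rfl, ?_, ?_, ?_⟩
  · intro k
    fin_cases k
    · exact (isHomogeneous_X ℂ _).sub ((isHomogeneous_X ℂ _).C_mul _)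
    · exact (isHomogeneous_X ℂ _).sub ((isHomogeneous_X ℂ _).C_mul _)
    · exact (isHomogeneous_X ℂ _).C_mul _
  · intro v
    funext k
    fin_cases i <;> fin_cases k <;> simp [Fin.succAbove] at hi ⊢ <;> field_simp <;> ring
  · intro x y z
    fin_cases i <;> simp [Fin.succAbove] at hi ⊢ <;> field_simp <;> simp

/-- A polynomial in quotients `N κ / M` of homogeneous polynomials of the same degree becomes
homogeneous after multiplication with a sufficiently high power of `M`. -/
lemma exists_homogenization {κ : Type*} {M : MvPolynomial (Fin 3) ℂ}
    {N : κ → MvPolynomial (Fin 3) ℂ} {a : ℕ} (hM : M.IsHomogeneous a)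
    (hN : ∀ k, (N k).IsHomogeneous a) (H : MvPolynomial κ ℂ) :
    ∃ d₀, ∀ d ≥ d₀, ∃ G : MvPolynomial (Fin 3) ℂ, G.IsHomogeneous (a * d) ∧
      ∀ v, eval v M ≠ 0 → eval v G = eval v M ^ d * eval (fun k => eval v (N k) / eval v M) H := by
  induction H using MvPolynomial.induction_on with
  | C c =>
    refine ⟨0, fun d _ => ⟨C c * M ^ d, (hM.pow d).C_mul c, fun v _ => ?_⟩⟩
    simp [mul_comm]
  | add p q hp hq =>
    obtain ⟨d₁, h1⟩ := hp
    obtain ⟨d₂, h2⟩ := hq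
    refine ⟨max d₁ d₂, fun d hd => ?_⟩
    obtain ⟨G₁, hG₁, he₁⟩ := h1 d (le_trans (le_max_left _ _) hd)
    obtain ⟨G₂, hG₂, he₂⟩ := h2 d (le_trans (le_max_right _ _) hd)
    refine ⟨G₁ + G₂, hG₁.add hG₂, fun v hv => ?_⟩
    rw [map_add, map_add, he₁ v hv, he₂ v hv, mul_add]
  | mul_X p k hp =>
    obtain ⟨d₁, h1⟩ := hp
    refine ⟨d₁ + 1, fun d hd => ?_⟩
    obtain ⟨d, rfl⟩ : ∃ d', d = d' + 1 := ⟨d - 1, by omega⟩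
    obtain ⟨G, hG, he⟩ := h1 d (by omega)
    refine ⟨G * N k, by rw [mul_add, mul_one]; exact hG.mul (hN k), fun v hv => ?_⟩
    rw [map_mul, map_mul, he v hv, eval_X, pow_succ]
    field_simp

/-- On the lines through `[e]`, which are parametrized by `z` and depend on `x`, a homogeneous
polynomial of degree `n` is a polynomial in `z` of degree at most `n`, whose coefficients are
polynomials in `x`. The coefficient of `z ^ n` is the value at `e`. -/
lemma exists_coeff_polynomial {f : MvPolynomial (Fin 3) ℂ} {n : ℕ}
    (hf : f.IsHomogeneous n) (u v e : Fin 3 → ℂ) :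
    ∃ c : ℕ → Polynomial ℂ, c n = Polynomial.C (eval e f) ∧ ∀ x z : ℂ,
      eval (u + x • v + z • e) f = ∑ m ∈ Finset.range (n + 1), (c m).eval x * z ^ m := by
  set g : Fin 3 → Polynomial (Polynomial ℂ) := fun k => Polynomial.C (Polynomial.C (u k) +
    Polynomial.C (v k) * Polynomial.X) * Polynomial.X + Polynomial.C (Polynomial.C (e k)) with hg
  set q : Polynomial (Polynomial ℂ) := aeval (R := Polynomial ℂ) (S₁ := Polynomial (Polynomial ℂ)) g
    (MvPolynomial.map Polynomial.C f) with hq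
  have hdeg : q.natDegree ≤ n := by
    have := MvPolynomial.aeval_natDegree_le (m := n) (n := 1) (MvPolynomial.map Polynomial.C f)
      ((hf.map _).totalDegree_le) g (fun i => Polynomial.natDegree_linear_le)
    simpa using this
  have hev : ∀ (ψ : Polynomial (Polynomial ℂ) →+* ℂ),
      (∀ a, ψ (Polynomial.C (Polynomial.C a)) = a) → ψ q = eval (fun k => ψ (g k)) f := by
    intro ψ hψ
    rw [hq]
    clear hq hdeg hf
    induction f using MvPolynomial.induction_on with
    | C a => simp [hψ]
    | add p q hp hq => simp [hp, hq]
    | mul_X p k hp => simp [hp]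
  refine ⟨fun m => q.coeff (n - m), ?_, ?_⟩
  · simp only [Nat.sub_self, Polynomial.coeff_zero_eq_eval_zero]
    refine Polynomial.funext fun x => ?_
    have := hev ((Polynomial.evalRingHom x).comp (Polynomial.evalRingHom 0)) (by simp)
    simpa [hg] using this
  · intro x z
    set p₁ : Polynomial ℂ := ∑ m ∈ Finset.range (n + 1),
      Polynomial.C ((q.coeff (n - m)).eval x) * Polynomial.X ^ m with hp₁
    obtain ⟨p₂, hp₂⟩ : ∃ p₂ : Polynomial ℂ, ∀ z, p₂.eval z = eval (u + x • v + z • e) f := by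
      refine ⟨aeval (fun k => Polynomial.C (u k + x * v k) + Polynomial.X * Polynomial.C (e k)) f,
        fun z => ?_⟩
      clear hev hq hdeg hf
      induction f using MvPolynomial.induction_on with
      | C a => simp
      | add p q hp hq => simp_all
      | mul_X p k hp =>
        simp_all [mul_comm (e k) z]
    have h : p₁ = p₂ := by
      refine Polynomial.eq_of_infinite_eval_eq _ _
        ((Set.finite_singleton (0 : ℂ)).infinite_compl.mono ?_)
      intro w hw
      replace hw : w ≠ 0 := hw
      have h1 := hev ((Polynomial.evalRingHom w⁻¹).comp
        (Polynomial.mapRingHom (Polynomial.evalRingHom x))) (by simp)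
      have h2 : u + x • v + w • e = w • fun k => (u k + v k * x) * w⁻¹ + e k := by
        funext k
        simp only [Pi.add_apply, Pi.smul_apply, smul_eq_mul]
        field_simp
      have h3 : eval (u + x • v + w • e) f =
          w ^ n * ((q.map (Polynomial.evalRingHom x)).eval w⁻¹) := by
        rw [h2, hf.eval_smul]
        congr 1
        simpa [hg] using h1.symm
      change p₁.eval w = p₂.eval w
      rw [hp₂, h3, Polynomial.eval_eq_sum_range' (n := n + 1)
        ((Polynomial.natDegree_map_le).trans_lt (Nat.lt_succ_of_le hdeg)), hp₁,
        ← Finset.sum_range_reflect, Polynomial.eval_finsetSum, Finset.mul_sum]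
      refine Finset.sum_congr rfl fun m hm => ?_
      have hm' : m ≤ n := by simpa [Nat.lt_succ_iff] using hm
      have h4 : n + 1 - 1 - m = n - m := by omega
      obtain ⟨l, rfl⟩ : ∃ l, n = m + l := ⟨n - m, by omega⟩
      have h6 : m + l - l = m := by omega
      simp only [h4, h6, Polynomial.eval_mul, Polynomial.eval_C, Polynomial.eval_pow,
        Polynomial.eval_X, Polynomial.coeff_map, Polynomial.coe_evalRingHom,
        Nat.add_sub_cancel_left, pow_add, inv_pow]
      field_simp
    rw [← hp₂, ← h, hp₁, Polynomial.eval_finsetSum]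
    simp

end MvPolynomial

/-! ### Connectedness of irreducible curves -/

/-- A simple root of a holomorphic equation depends holomorphically on the parameter. -/
lemma exists_root_section {Ψ : ℂ × ℂ → ℂ} {x₀ z₀ D : ℂ} (h : ContDiffAt ℂ 1 Ψ (x₀, z₀))
    (h0 : Ψ (x₀, z₀) = 0) (hD : HasDerivAt (fun z => Ψ (x₀, z)) D z₀) (hD0 : D ≠ 0) :
    ∃ ζ : ℂ → ℂ, ζ x₀ = z₀ ∧ DifferentiableAt ℂ ζ x₀ ∧ ∀ᶠ x in 𝓝 x₀, Ψ (x, ζ x) = 0 := by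
  have hinv : (fderiv ℂ Ψ (x₀, z₀) ∘L .inr ℂ ℂ ℂ).IsInvertible := by
    refine ⟨ContinuousLinearEquiv.unitsEquivAut ℂ (Units.mk0 D hD0), ?_⟩
    have h1 : HasFDerivAt (fun z : ℂ => Ψ (x₀, z)) (fderiv ℂ Ψ (x₀, z₀) ∘L .inr ℂ ℂ ℂ) z₀ :=
      HasFDerivAt.comp z₀ (f := fun z : ℂ => (x₀, z)) (g := Ψ)
        (h.differentiableAt (by simp)).hasFDerivAt (hasFDerivAt_prodMk_right x₀ z₀)
    rw [hD.hasFDerivAt.unique h1 |>.symm]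
    ext
    simp
  refine ⟨h.implicitFunction one_ne_zero hinv, h.implicitFunction_apply_self one_ne_zero hinv,
    (h.contDiffAt_implicitFunction one_ne_zero hinv).differentiableAt one_ne_zero, ?_⟩
  simpa [h0] using h.eventually_apply_implicitFunction one_ne_zero hinv

/-- Sums over the roots of a family of polynomials that satisfy a locally constant condition
are holomorphic where all roots are simple. -/
lemma differentiableAt_sum_roots {g : ℂ → Polynomial ℂ} {n : ℕ} {x₀ : ℂ} (hg : ∀ x, g x ≠ 0)
    (hdeg : ∀ x, (g x).natDegree ≤ n) (hcard : n ≤ (g x₀).roots.toFinset.card)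
    {P : ℂ → ℂ → Prop} [∀ x, DecidablePred (P x)]
    (hsec : ∀ z, (g x₀).eval z = 0 → ∃ ζ : ℂ → ℂ, ζ x₀ = z ∧ DifferentiableAt ℂ ζ x₀ ∧
      ∀ᶠ x in 𝓝 x₀, (g x).eval (ζ x) = 0 ∧ (P x (ζ x) ↔ P x₀ z)) (b : ℕ) :
    DifferentiableAt ℂ (fun x => ∑ z ∈ (g x).roots.toFinset with P x z, z ^ b) x₀ := by
  choose! ζ h1 h2 h3 using hsec
  have hmem : ∀ x z, z ∈ (g x).roots.toFinset ↔ (g x).eval z = 0 := fun x z => by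
    rw [Multiset.mem_toFinset, Polynomial.mem_roots (hg x), Polynomial.IsRoot]
  have hne : ∀ z ∈ (g x₀).roots.toFinset, ∀ z' ∈ (g x₀).roots.toFinset, z ≠ z' →
      ∀ᶠ x in 𝓝 x₀, ζ z x ≠ ζ z' x := by
    intro z hz z' hz' hzz
    rw [hmem] at hz hz'
    refine (h2 z hz).continuousAt.ne_iff_eventually_ne (h2 z' hz').continuousAt |>.1 ?_
    rwa [h1 z hz, h1 z' hz']
  have hev : ∀ᶠ x in 𝓝 x₀, (∀ z ∈ (g x₀).roots.toFinset, ∀ z' ∈ (g x₀).roots.toFinset, z ≠ z' →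
      ζ z x ≠ ζ z' x) ∧ ∀ z ∈ (g x₀).roots.toFinset, (g x).eval (ζ z x) = 0 ∧
        (P x (ζ z x) ↔ P x₀ z) := by
    refine Eventually.and ?_ ?_
    · refine (Filter.eventually_all_finset _).2 fun z hz => (Filter.eventually_all_finset _).2
        fun z' hz' => ?_
      by_cases hzz : z = z'
      · simp [hzz]
      · simpa [hzz] using hne z hz z' hz' hzz
    · exact (Filter.eventually_all_finset _).2 fun z hz => h3 z ((hmem _ _).1 hz)
  have hd : DifferentiableAt ℂ (fun x => ∑ z ∈ (g x₀).roots.toFinset with P x₀ z, ζ z x ^ b) x₀ :=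
    DifferentiableAt.fun_sum fun z hz => (h2 z ((hmem _ _).1 (Finset.mem_filter.1 hz).1)).pow b
  refine hd.congr_of_eventuallyEq ?_
  filter_upwards [hev] with x hx
  have hinj : Set.InjOn (fun z => ζ z x) ((g x₀).roots.toFinset : Set ℂ) := by
    intro z hz z' hz' he
    by_contra hzz
    exact hx.1 z hz z' hz' hzz he
  have hR : (g x).roots.toFinset = (g x₀).roots.toFinset.image (fun z => ζ z x) := by
    symm
    refine Finset.eq_of_subset_of_card_le (fun w hw => ?_) ?_
    · obtain ⟨z, hz, rfl⟩ := Finset.mem_image.1 hw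
      exact (hmem _ _).2 (hx.2 z hz).1
    · rw [Finset.card_image_of_injOn hinj]
      exact (Multiset.toFinset_card_le _).trans (((g x).card_roots').trans ((hdeg x).trans hcard))
  rw [hR, Finset.filter_image,
    Finset.sum_image (hinj.mono (Finset.coe_subset.2 (Finset.filter_subset _ _)))]
  refine Finset.sum_congr (Finset.filter_congr fun z hz => (hx.2 z hz).2) fun _ _ => rfl

namespace MvPolynomial

/-- If `f` does not vanish at `e`, the zeros of `f` on the lines through `[e]` in the affine
plane grow at most linearly. -/
lemma exists_root_bound {f : MvPolynomial (Fin 3) ℂ} {n : ℕ} (hf : f.IsHomogeneous n)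
    (u v : Fin 3 → ℂ) {e : Fin 3 → ℂ} (he : eval e f ≠ 0) :
    ∃ C : ℝ, 0 ≤ C ∧ ∀ x z : ℂ, eval (u + x • v + z • e) f = 0 → ‖z‖ ≤ C * (1 + ‖x‖) := by
  obtain ⟨ε, hε, hball⟩ := Metric.eventually_nhds_iff_ball.1
    ((continuous_eval' f).continuousAt.eventually_ne he)
  refine ⟨(‖u‖ + ‖v‖) / ε, by positivity, fun x z hz => ?_⟩
  rcases eq_or_ne z 0 with rfl | hz0
  · simp only [norm_zero]; positivity
  have h1 : u + x • v + z • e = z • (e + z⁻¹ • (u + x • v)) := by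
    rw [smul_add, smul_smul, mul_inv_cancel₀ hz0, one_smul, add_comm]
  rw [h1, hf.eval_smul] at hz
  have h2 := (mul_eq_zero.1 hz).resolve_left (pow_ne_zero _ hz0)
  have h3 : ε ≤ ‖z⁻¹ • (u + x • v)‖ := by
    by_contra! hlt
    exact hball _ (by simpa [dist_eq_norm] using hlt) h2
  have h4 : ‖u + x • v‖ ≤ (‖u‖ + ‖v‖) * (1 + ‖x‖) := by
    refine (norm_add_le _ _).trans ?_
    rw [norm_smul]
    nlinarith [norm_nonneg u, norm_nonneg v, norm_nonneg x,
      mul_nonneg (norm_nonneg u) (norm_nonneg x)]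
  rw [norm_smul, norm_inv, inv_mul_eq_div, le_div_iff₀ (norm_pos_iff.2 hz0)] at h3
  rw [div_mul_eq_mul_div, le_div_iff₀ hε]
  linarith

lemma IsHomogeneous.not_dvd_of_lt {f g : MvPolynomial (Fin 3) ℂ} {m n : ℕ} (hf : f.IsHomogeneous m)
    (hg : g.IsHomogeneous n) (h0 : g ≠ 0) (h : n < m) : ¬ f ∣ g := by
  rintro ⟨q, rfl⟩
  have h1 := hg.totalDegree h0
  rw [totalDegree_mul_of_isDomain (left_ne_zero_of_mul h0) (right_ne_zero_of_mul h0),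
    hf.totalDegree (left_ne_zero_of_mul h0)] at h1
  omega

/-- A linear form that vanishes at a point off the curve `f = 0` is not a multiple of `f`. -/
lemma not_dvd_of_eval_eq_zero {f g : MvPolynomial (Fin 3) ℂ} {n : ℕ} (hf : f.IsHomogeneous n)
    (hn : 0 < n) (hg : g.IsHomogeneous 1) (h0 : g ≠ 0) {e : Fin 3 → ℂ} (hfe : eval e f ≠ 0)
    (hge : eval e g = 0) : ¬ f ∣ g := by
  rintro ⟨q, rfl⟩
  have h1 := hg.totalDegree h0
  rw [totalDegree_mul_of_isDomain (left_ne_zero_of_mul h0) (right_ne_zero_of_mul h0),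
    hf.totalDegree (left_ne_zero_of_mul h0)] at h1
  have h2 : q.totalDegree = 0 := by omega
  rw [totalDegree_eq_zero_iff_eq_C] at h2
  rw [map_mul] at hge
  have h3 := (mul_eq_zero.1 hge).resolve_left hfe
  rw [h2, eval_C] at h3
  exact right_ne_zero_of_mul h0 (by rw [h2, h3, map_zero])

end MvPolynomial

/-- For a set `V` of roots of `g = ∑ m, c m * z ^ m`, the polynomial `∑ ζ ∈ V, (g z - g ζ) / (z - ζ)`
vanishes at the other roots, and takes the value `g' z` at the roots in `V`. -/
lemma sum_divided_difference {n : ℕ} {c : ℕ → ℂ} {V : Finset ℂ}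
    (hV : ∀ ζ ∈ V, ∑ m ∈ Finset.range (n + 1), c m * ζ ^ m = 0) {z : ℂ}
    (hz : ∑ m ∈ Finset.range (n + 1), c m * z ^ m = 0) :
    ∑ ζ ∈ V, ∑ m ∈ Finset.range (n + 1), c m * ∑ a ∈ Finset.range m, z ^ a * ζ ^ (m - 1 - a) =
      if z ∈ V then ∑ m ∈ Finset.range (n + 1), c m * (m * z ^ (m - 1)) else 0 := by
  have h1 : ∀ ζ ∈ V, ζ ≠ z → ∑ m ∈ Finset.range (n + 1),
      c m * ∑ a ∈ Finset.range m, z ^ a * ζ ^ (m - 1 - a) = 0 := by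
    intro ζ hζ hne
    refine (mul_eq_zero.1 (?_ : _ * (z - ζ) = 0)).resolve_right (sub_ne_zero.2 hne.symm)
    rw [Finset.sum_mul, ← sub_self (0 : ℂ)]
    nth_rewrite 1 [← hz]
    rw [← hV ζ hζ, ← Finset.sum_sub_distrib]
    refine Finset.sum_congr rfl fun m _ => ?_
    rw [mul_assoc, (Commute.all z ζ).geom_sum₂_mul, mul_sub]
  split_ifs with h
  · rw [Finset.sum_eq_single z (fun ζ hζ hne => h1 ζ hζ hne) (fun h' => (h' h).elim)]
    simp only [geom_sum₂_self]
  · exact Finset.sum_eq_zero fun ζ hζ => h1 ζ hζ (by rintro rfl; exact h hζ)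

namespace CP2

open MvPolynomial
open scoped Matrix

set_option maxHeartbeats 1000000 in
/-- The core of the connectedness of irreducible curves: a locally constant property of the points
of an irreducible curve cannot both hold and fail at infinitely many points. Project the
curve from a point outside to a line. The power sums of the roots with the property are polynomials,
and so there is a polynomial that vanishes exactly at the points without the property, up to
finitely many exceptions. -/
lemma finite_of_infinite_not {f : MvPolynomial (Fin 3) ℂ} {n : ℕ} (hf : Irreducible f)
    (hfn : f.IsHomogeneous n) {B : Set CP2} (hB : B.Finite) {P : CP2 → Prop}
    (hloc : ∀ p ∈ zeroSet f \ B, ∀ᶠ q in 𝓝 p, q ∈ zeroSet f \ B → (P q ↔ P p))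
    (hinf : (zeroSet f ∩ {q | ¬ P q}).Infinite) : (zeroSet f ∩ {q | P q}).Finite := by
  classical
  have hn : 0 < n := irreducible_degree_pos hf hfn
  obtain ⟨e, he⟩ : ∃ e, eval e f ≠ 0 := by
    by_contra! hcon
    exact hf.ne_zero (MvPolynomial.funext fun v => by simpa using hcon v)
  have he0 : e ≠ 0 := by
    rintro rfl
    have := hfn.eval_smul 0 0
    rw [smul_zero, zero_pow hn.ne', zero_mul] at this
    exact he this
  obtain ⟨b, ℓ, hb2, hℓ, hbℓ, hℓb⟩ := exists_linear_coordinates he0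
  subst hb2
  obtain ⟨c, hcn, hc⟩ := exists_coeff_polynomial hfn (b 0) (b 1) (b 2)
  set π : ℂ → ℂ → Fin 3 → ℂ := fun x z => b 0 + x • b 1 + z • b 2 with hπ
  have hℓπ : ∀ x z, eval (π x z) (ℓ 0) = 1 ∧ eval (π x z) (ℓ 1) = x ∧ eval (π x z) (ℓ 2) = z :=
    fun x z => by simpa [hπ] using hℓb 1 x z
  have hℓe : eval (b 2) (ℓ 0) = 0 ∧ eval (b 2) (ℓ 1) = 0 := by
    have := hℓb 0 0 1
    simp only [zero_smul, zero_add, one_smul] at this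
    exact ⟨this.1, this.2.1⟩
  have hπ0 : ∀ x z, π x z ≠ 0 := by
    intro x z h0
    have h1 := (hℓπ x z).1
    have h2 := (hℓ 0).eval_smul 0 (π x z)
    rw [zero_smul, pow_one, zero_mul, ← h0] at h2
    rw [h2] at h1
    exact zero_ne_one h1
  obtain ⟨K, hK0, hK⟩ := exists_root_bound hfn (b 0) (b 1) he
  replace hK : ∀ x z, eval (π x z) f = 0 → ‖z‖ ≤ K * (1 + ‖x‖) := hK
  replace hc : ∀ x z, eval (π x z) f = ∑ m ∈ Finset.range (n + 1), (c m).eval x * z ^ m := hc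
  clear_value π
  -- the derivative of `f` in the direction of the centre of the projection
  set D : MvPolynomial (Fin 3) ℂ := ∑ k, C (b 2 k) * pderiv k f with hD
  have hDn : D.IsHomogeneous (n - 1) :=
    IsHomogeneous.sum _ _ _ fun k _ => (hfn.pderiv).C_mul _
  have hDeval : ∀ v, eval v D = evalVec (grad f) v ⬝ᵥ b 2 := fun v => by
    simp only [hD, map_sum, map_mul, eval_C, dotProduct]
    exact Finset.sum_congr rfl fun k _ => mul_comm _ _
  have hD0 : D ≠ 0 := by
    intro h0
    have h1 := hDeval (b 2)
    rw [evalVec_grad_dotProduct_self hfn, h0, map_zero] at h1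
    exact mul_ne_zero (Nat.cast_ne_zero.2 hn.ne') he h1.symm
  have hfD : ¬ f ∣ D := hfn.not_dvd_of_lt hDn hD0 (by omega)
  have hlin : ∀ x : ℂ, (ℓ 1 - C x * ℓ 0).IsHomogeneous 1 ∧ ¬ f ∣ ℓ 1 - C x * ℓ 0 := by
    intro x
    have h1 : (ℓ 1 - C x * ℓ 0).IsHomogeneous 1 := (hℓ 1).sub ((hℓ 0).C_mul x)
    refine ⟨h1, not_dvd_of_eval_eq_zero hfn hn h1 ?_ he (by simp [hℓe])⟩
    intro h0
    have := congrArg (eval (π (x + 1) 0)) h0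
    simp [hℓπ] at this
  have hℓ0 : ¬ f ∣ ℓ 0 := by
    refine not_dvd_of_eval_eq_zero hfn hn (hℓ 0) ?_ he hℓe.1
    intro h0
    have := congrArg (eval (π 0 0)) h0
    simp [hℓπ] at this
  -- the fibres with multiple roots or exceptional points
  set E : Set CP2 := zeroSet f ∩ (B ∪ zeroSet D) with hE
  have hEfin : E.Finite := by
    rw [hE, inter_union_distrib_left]
    exact (hB.subset inter_subset_right).union (finite_inter_zeroSet hf hfn hDn hfD)
  set S : Set ℂ := (fun p : CP2 => eval p.rep (ℓ 1) / eval p.rep (ℓ 0)) '' E with hS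
  have hSfin : S.Finite := hEfin.image _
  have hfib : ∀ x ∉ S, ∀ z, eval (π x z) f = 0 →
      proj (π x z) ∈ zeroSet f \ B ∧ eval (π x z) D ≠ 0 := by
    intro x hx z hz
    have h1 : proj (π x z) ∈ zeroSet f := (proj_mem_zeroSet hfn (hπ0 x z)).2 hz
    have h2 : proj (π x z) ∉ E := by
      intro hmem
      apply hx
      refine ⟨_, hmem, ?_⟩
      obtain ⟨a, ha⟩ := Projectivization.exists_smul_eq_mk_rep ℂ (π x z) (hπ0 x z)
      rw [proj_of_ne_zero (hπ0 x z)]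
      dsimp only
      rw [← ha, Units.smul_def]
      simp only [(hℓ _).eval_smul, hℓπ]
      simp
    refine ⟨⟨h1, fun hb => h2 ⟨h1, Or.inl hb⟩⟩, fun h0 => h2 ⟨h1, Or.inr ?_⟩⟩
    exact (proj_mem_zeroSet hDn (hπ0 x z)).2 h0
  -- the equation of the curve in the fibre over `x`
  set g : ℂ → Polynomial ℂ := fun x => ∑ m ∈ Finset.range (n + 1),
    Polynomial.C ((c m).eval x) * Polynomial.X ^ m with hg
  have hgeval : ∀ x z, (g x).eval z = eval (π x z) f := fun x z => by
    rw [hc, hg]; simp [Polynomial.eval_finsetSum]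
  have hgdeg : ∀ x, (g x).natDegree ≤ n := fun x =>
    Polynomial.natDegree_sum_le_of_forall_le _ _ fun m hm =>
      (Polynomial.natDegree_C_mul_X_pow_le _ _).trans (Nat.lt_succ_iff.1 (Finset.mem_range.1 hm))
  have hgcoeff : ∀ x, (g x).coeff n ≠ 0 := fun x => by
    rw [hg]
    simp only [Polynomial.finsetSum_coeff, Polynomial.coeff_C_mul_X_pow]
    rw [Finset.sum_ite_eq, if_pos (by simp), hcn]
    simpa using he
  have hg0 : ∀ x, g x ≠ 0 := fun x h0 => hgcoeff x (by rw [h0, Polynomial.coeff_zero])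
  clear_value g
  have hgderiv : ∀ x z, (g x).derivative.eval z = eval (π x z) D := by
    intro x z
    have h1 : HasDerivAt (fun z => π x z) (b 2) z := by
      rw [hπ]
      simpa using ((hasDerivAt_id z).smul_const (b 2)).const_add (b 0 + x • b 1)
    have h2 := hasDerivAt_eval h1 f
    rw [hDeval]
    refine HasDerivAt.unique ((g x).hasDerivAt z) (HasDerivAt.congr_of_eventuallyEq h2 ?_)
    exact Eventually.of_forall fun w => hgeval x w
  have hcard : ∀ x ∉ S, n ≤ (g x).roots.toFinset.card := by
    intro x hx
    rw [Multiset.toFinset_card_of_nodup, ← (IsAlgClosed.splits (g x)).natDegree_eq_card_roots]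
    · exact Polynomial.le_natDegree_of_ne_zero (hgcoeff x)
    · refine Multiset.nodup_iff_count_le_one.2 fun z => ?_
      rw [Polynomial.count_roots]
      by_contra! hlt
      rw [Polynomial.one_lt_rootMultiplicity_iff_isRoot (hg0 x)] at hlt
      have h1 := hlt.1
      have h2 := hlt.2
      rw [Polynomial.IsRoot, hgeval] at h1
      rw [Polynomial.IsRoot, hgderiv] at h2
      exact (hfib x hx z h1).2 h2
  -- the power sums of the roots that have the property
  set s : ℕ → ℂ → ℂ := fun m x =>
    ∑ z ∈ (g x).roots.toFinset with P (proj (π x z)), z ^ m with hs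
  have hsdiff : ∀ m, DifferentiableOn ℂ (s m) Sᶜ := by
    intro m x₀ hx₀
    refine (differentiableAt_sum_roots hg0 hgdeg (hcard x₀ hx₀)
      (P := fun x z => P (proj (π x z))) (fun z hz => ?_) m).differentiableWithinAt
    have hz' := hz
    rw [hgeval] at hz'
    have hΨ : ContDiff ℂ 1 fun p : ℂ × ℂ => eval (π p.1 p.2) f := by
      rw [hπ]
      refine (contDiff_eval f).comp ?_
      exact (contDiff_const.add (contDiff_fst.smul contDiff_const)).add
        (contDiff_snd.smul contDiff_const)
    obtain ⟨ζ, h1, h2, h3⟩ := exists_root_section (z₀ := z) (x₀ := x₀) hΨ.contDiffAt hz'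
      (D := eval (π x₀ z) D) (by
        have := (g x₀).hasDerivAt z
        rw [hgderiv] at this
        exact this.congr_of_eventuallyEq (Eventually.of_forall fun w => (hgeval x₀ w).symm))
      (hfib x₀ hx₀ z hz').2
    refine ⟨ζ, h1, h2, ?_⟩
    have h4 : ContinuousAt (fun x => proj (π x (ζ x))) x₀ := by
      refine ContinuousAt.comp (g := proj) (continuousAt_proj (hπ0 _ _)) ?_
      rw [hπ]
      exact (continuousAt_const.add (continuousAt_id.smul continuousAt_const)).add
        (h2.continuousAt.smul continuousAt_const)
    have h5 := hloc _ (hfib x₀ hx₀ z hz').1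
    rw [← h1] at h5
    filter_upwards [h3, h4.eventually h5, hSfin.isClosed.isOpen_compl.mem_nhds hx₀] with x h6 h7 h8
    rw [hgeval, ← h1]
    exact ⟨h6, h7 (hfib x h8 _ h6).1⟩
  have hroot : ∀ x z, z ∈ (g x).roots.toFinset ↔ eval (π x z) f = 0 := fun x z => by
    rw [Multiset.mem_toFinset, Polynomial.mem_roots (hg0 x), Polynomial.IsRoot, hgeval]
  have hspoly : ∀ m, ∃ p : Polynomial ℂ, ∀ x ∉ S, s m x = p.eval x := by
    intro m
    refine exists_polynomial_of_differentiableOn_compl hSfin (C := n * K ^ m) (m := m) (hsdiff m)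
      fun x _ => ?_
    have h1 : ∀ z ∈ (g x).roots.toFinset.filter (fun z => P (proj (π x z))),
        ‖z ^ m‖ ≤ (K * (1 + ‖x‖)) ^ m := by
      intro z hz
      rw [norm_pow]
      exact pow_le_pow_left₀ (norm_nonneg _) (hK x z ((hroot x z).1 (Finset.mem_filter.1 hz).1)) _
    refine (norm_sum_le_of_le _ h1).trans ?_
    rw [Finset.sum_const, nsmul_eq_mul, mul_pow, mul_assoc]
    refine mul_le_mul_of_nonneg_right ?_ (by positivity)
    exact_mod_cast (Finset.card_filter_le _ _).trans ((Multiset.toFinset_card_le _).trans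
      (((g x).card_roots').trans (hgdeg x)))
  choose σ hσ using hspoly
  -- the polynomial that singles out the roots with the property
  set H : MvPolynomial (Fin 2) ℂ := ∑ m ∈ Finset.range (n + 1), Polynomial.aeval (X 0) (c m) *
    ∑ a ∈ Finset.range m, X 1 ^ a * Polynomial.aeval (X 0) (σ (m - 1 - a)) with hH
  have haeval : ∀ (w : Fin 2 → ℂ) (p : Polynomial ℂ),
      eval w (Polynomial.aeval (X 0 : MvPolynomial (Fin 2) ℂ) p) = p.eval (w 0) := by
    intro w p
    induction p using Polynomial.induction_on' with
    | add p q hp hq => simp [hp, hq]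
    | monomial k a => simp [Polynomial.aeval_monomial]
  have hHeval : ∀ x ∉ S, ∀ z, eval (π x z) f = 0 →
      eval ![x, z] H = if P (proj (π x z)) then eval (π x z) D else 0 := by
    intro x hx z hz
    have hrt : ∀ ζ, eval (π x ζ) f = 0 →
        ∑ m ∈ Finset.range (n + 1), (c m).eval x * ζ ^ m = 0 := fun ζ h => by rw [← hc]; exact h
    have h1 := sum_divided_difference (n := n) (c := fun m => (c m).eval x)
      (V := (g x).roots.toFinset.filter (fun z => P (proj (π x z))))
      (fun ζ hζ => hrt ζ ((hroot x ζ).1 (Finset.mem_filter.1 hζ).1)) (hrt z hz)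
    have h2 : eval ![x, z] H = ∑ ζ ∈ (g x).roots.toFinset with P (proj (π x ζ)),
        ∑ m ∈ Finset.range (n + 1), (c m).eval x *
          ∑ a ∈ Finset.range m, z ^ a * ζ ^ (m - 1 - a) := by
      rw [Finset.sum_comm, hH, map_sum]
      refine Finset.sum_congr rfl fun m _ => ?_
      rw [← Finset.mul_sum, Finset.sum_comm, map_mul, haeval, map_sum]
      congr 1
      refine Finset.sum_congr rfl fun a _ => ?_
      rw [← Finset.mul_sum, map_mul, haeval, map_pow, eval_X]
      congr 1
      exact (hσ _ x hx).symm
    rw [h2, h1]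
    have h3 : z ∈ (g x).roots.toFinset.filter (fun z => P (proj (π x z))) ↔ P (proj (π x z)) := by
      rw [Finset.mem_filter, hroot]
      exact and_iff_right hz
    simp only [h3]
    rw [← hgderiv, hg]
    simp only [Polynomial.derivative_sum, Polynomial.derivative_C_mul_X_pow,
      Polynomial.eval_finsetSum]
    congr 1
    refine Finset.sum_congr rfl fun m _ => ?_
    simp
    ring
  obtain ⟨d, hd⟩ := exists_homogenization (hℓ 0) (N := ![ℓ 1, ℓ 2]) (fun k => by
    fin_cases k
    · exact hℓ 1
    · exact hℓ 2) H
  obtain ⟨G, hGhom, hG⟩ := hd d le_rfl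
  -- apart from finitely many points, `G` vanishes where the property fails
  set E' : Set CP2 := zeroSet f ∩ (zeroSet (ℓ 0) ∪ ⋃ x ∈ S, zeroSet (ℓ 1 - C x * ℓ 0)) with hE'
  have hE'fin : E'.Finite := by
    rw [hE', inter_union_distrib_left, inter_iUnion₂]
    exact (finite_inter_zeroSet hf hfn (hℓ 0) hℓ0).union (hSfin.biUnion fun x _ =>
      finite_inter_zeroSet hf hfn (hlin x).1 (hlin x).2)
  have hGP : ∀ q ∈ zeroSet f, q ∉ E' → (q ∈ zeroSet G ↔ ¬ P q) := by
    intro q hq hqE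
    obtain ⟨w, hw, rfl⟩ := exists_proj_eq q
    have hw0 : eval w (ℓ 0) ≠ 0 := fun h0 =>
      hqE ⟨hq, Or.inl ((proj_mem_zeroSet (hℓ 0) hw).2 h0)⟩
    set x := eval w (ℓ 1) / eval w (ℓ 0) with hx
    set z := eval w (ℓ 2) / eval w (ℓ 0) with hz
    have hwπ : w = eval w (ℓ 0) • π x z := by
      conv_lhs => rw [← hbℓ w]
      simp only [hπ, smul_add, smul_smul, hx, hz, mul_div_cancel₀ _ hw0]
    have hpw : proj w = proj (π x z) := by
      conv_lhs => rw [hwπ]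
      exact proj_smul hw0 (hπ0 x z)
    have hxS : x ∉ S := by
      intro hxS
      refine hqE ⟨hq, Or.inr (mem_biUnion hxS ((proj_mem_zeroSet (hlin x).1 hw).2 ?_))⟩
      simp [hx, div_mul_cancel₀ _ hw0]
    rw [hpw] at hq ⊢
    rw [proj_mem_zeroSet hfn (hπ0 x z)] at hq
    rw [proj_mem_zeroSet hGhom (hπ0 x z), hG _ (by rw [(hℓπ x z).1]; exact one_ne_zero)]
    have h1 : (fun k => eval (π x z) ((![ℓ 1, ℓ 2] : Fin 2 → _) k) / eval (π x z) (ℓ 0)) =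
        ![x, z] := by
      funext k
      fin_cases k <;> simp [hℓπ]
    rw [h1, (hℓπ x z).1, one_pow, one_mul, hHeval x hxS z hq]
    have h2 := (hfib x hxS z hq).2
    split_ifs with h3 <;> simp [h2, h3]
  have hfG : f ∣ G := by
    refine dvd_of_infinite hf hfn hGhom ((hinf.sdiff hE'fin).mono ?_)
    rintro q ⟨⟨h1, h2⟩, h3⟩
    exact ⟨h1, (hGP q h1 h3).2 h2⟩
  refine hE'fin.subset ?_
  rintro q ⟨h1, h2⟩
  by_contra h3
  refine (hGP q h1 h3).1 ?_ h2
  obtain ⟨u, rfl⟩ := hfG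
  change eval q.rep (f * u) = 0
  have h4 : eval q.rep f = 0 := h1
  rw [map_mul, h4, zero_mul]

/-- Irreducible curves minus finitely many points are connected. -/
theorem of_locally_constant {f : MvPolynomial (Fin 3) ℂ} {n : ℕ} (hf : Irreducible f)
    (hfn : f.IsHomogeneous n) {B : Set CP2} (hB : B.Finite) {P : CP2 → Prop}
    (hloc : ∀ p ∈ zeroSet f \ B, ∀ᶠ q in 𝓝 p, q ∈ zeroSet f \ B → (P q ↔ P p)) {p q : CP2}
    (hp : p ∈ zeroSet f \ B) (hPp : P p) (hq : q ∈ zeroSet f \ B) : P q := by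
  have key : ∀ p ∈ zeroSet f \ B, (zeroSet f ∩ {q | P q ↔ P p}).Infinite := by
    intro p hp
    refine (infinite_zeroSet_inter hfn hp.1 (inter_mem (hloc p hp)
      (hB.isClosed.isOpen_compl.mem_nhds hp.2))).mono ?_
    rintro q ⟨h1, h2, h3⟩
    exact ⟨h1, h2 ⟨h1, h3⟩⟩
  by_contra hPq
  refine (key p hp) ((finite_of_infinite_not hf hfn hB hloc ?_).subset ?_)
  · simpa [hPq] using key q hq
  · simp [hPp]

end CP2

/-! ### Leaves inside invariant curves -/

namespace HolomorphicFoliation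

open CP2 MvPolynomial
open scoped Matrix

variable {F : HolomorphicFoliation}

lemma mem_leafThrough_self (p : CP2) : p ∈ F.leafThrough p := Relation.EqvGen.refl p

lemma leafThrough_eq_of_mem {p q : CP2} (h : q ∈ F.leafThrough p) :
    F.leafThrough q = F.leafThrough p :=
  Set.ext fun _ => ⟨fun h' => h.trans _ _ _ h', fun h' => (h.symm _ _).trans _ _ _ h'⟩

/-- Near a nonsingular point the leaf contains an integral curve along which one of the
affine coordinates is a local homeomorphism. -/
lemma exists_integralCurve_coordinate {i : Fin 3} {j : F.ι} {v : Fin 3 → ℂ} (hv : v ∈ F.dom i j)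
    (hi : v i = 1) (hs : proj v ∉ F.sing) : ∃ (k : Fin 3) (σ : ℂ → Fin 3 → ℂ), k ≠ i ∧
      F.field i j v k ≠ 0 ∧ σ 0 = v ∧ HasDerivAt σ (F.field i j v) 0 ∧
      (∀ᶠ z in 𝓝 (0 : ℂ), σ z i = 1 ∧ proj (σ z) ∈ F.leafThrough (proj v)) ∧
      Filter.map (fun z => σ z k) (𝓝 0) = 𝓝 (v k) := by
  obtain ⟨k, hk⟩ := Function.ne_iff.1 ((field_ne_zero_iff hv).2 hs)
  obtain ⟨r, σ, hr, h0, hσ⟩ := exists_integralCurve hv hi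
  have hd := (hσ 0 (Metric.mem_ball_self hr)).2.2.1
  rw [h0] at hd
  refine ⟨k, σ, ?_, hk, h0, hd, ?_, ?_⟩
  · rintro rfl
    exact hk (field_apply_self hv)
  · filter_upwards [Metric.ball_mem_nhds (0 : ℂ) hr] with z hz
    exact ⟨(hσ z hz).2.1, Relation.EqvGen.rel _ _ (hσ z hz).2.2.2⟩
  · have h1 : DifferentiableOn ℂ (fun z => σ z k) (Metric.ball 0 r) := fun z hz =>
      (hasDerivAt_pi.1 (hσ z hz).2.2.1 k).differentiableAt.differentiableWithinAt
    have h2 := (h1.analyticAt (Metric.ball_mem_nhds (0 : ℂ) hr)).hasStrictDerivAt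
    rw [(hasDerivAt_pi.1 hd k).deriv] at h2
    have h3 := h2.map_nhds_eq hk
    rwa [h0] at h3

lemma exists_dom_of_point (p : CP2) : ∃ i j, p ∈ affineSet i ∧ sec i p ∈ F.dom i j := by
  obtain ⟨v, hv, rfl⟩ := exists_proj_eq p
  obtain ⟨i, j, hij⟩ := F.exists_mem_dom hv
  refine ⟨i, j, (proj_mem_affineSet hv).2 hij.1, ?_⟩
  rw [sec_proj hij.1]
  exact smul_mem_dom (inv_ne_zero hij.1) hij

lemma infinite_leafThrough {p : CP2} (hp : p ∉ F.sing) : (F.leafThrough p).Infinite := by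
  obtain ⟨i, j, hi, hd⟩ := exists_dom_of_point (F := F) p
  obtain ⟨k, σ, -, -, h0, -, h1, h2⟩ := exists_integralCurve_coordinate hd (sec_self i p)
    (by rwa [proj_sec hi])
  intro hfin
  have h3 : (fun z => σ z k) '' {z | σ z i = 1 ∧ proj (σ z) ∈ F.leafThrough (proj (sec i p))} ∈
      𝓝 (sec i p k) := by
    rw [← h2]
    exact image_mem_map h1
  rw [proj_sec hi] at h3
  refine infinite_of_mem_nhds _ h3 ((hfin.image fun q => sec i q k).subset ?_)
  rintro _ ⟨z, ⟨hz1, hz2⟩, rfl⟩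
  exact ⟨_, hz2, by simp only; rw [sec_proj (by simp [hz1]), hz1, inv_one, one_smul]⟩

/-- Where an integral curve stays inside the curve `f = 0`, the differential of `f` is proportional
to the form that defines the foliation. -/
lemma IsDefinedBy.cross_grad_eq_zero {A : Fin 3 → MvPolynomial (Fin 3) ℂ} (hA : F.IsDefinedBy A)
    {f : MvPolynomial (Fin 3) ℂ} {n : ℕ} (hf : f.IsHomogeneous n) {i : Fin 3} {j : F.ι}
    {v : Fin 3 → ℂ} (hv : v ∈ F.dom i j) (hs : proj v ∉ F.sing) {σ : ℂ → Fin 3 → ℂ}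
    (h0 : σ 0 = v) (hσ : HasDerivAt σ (F.field i j v) 0) (hfσ : ∀ᶠ z in 𝓝 0, eval (σ z) f = 0) :
    evalVec (A ⨯₃ grad f) v = 0 := by
  have h1 : evalVec (grad f) v ⬝ᵥ F.field i j v = 0 := by
    have h2 := hasDerivAt_eval hσ f
    rw [h0] at h2
    exact h2.unique ((hasDerivAt_const (0 : ℂ) (0 : ℂ)).congr_of_eventuallyEq hfσ)
  have h2 : evalVec (grad f) v ⬝ᵥ v = 0 := by
    rw [evalVec_grad_dotProduct_self hf, ← h0, hfσ.self_of_nhds, mul_zero]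
  obtain ⟨m, -, hm⟩ := hA i j v hv hs
  rw [evalVec_cross, hm, form, ← cross_anticomm, map_smul, cross_cross_eq_smul_sub_smul', h1,
    dotProduct_comm, h2]
  simp

/-- An invariant curve lies locally in a single leaf near its smooth points. -/
lemma IsDefinedBy.eventually_mem_leafThrough {A θ : Fin 3 → MvPolynomial (Fin 3) ℂ}
    (hA : F.IsDefinedBy A) {f : MvPolynomial (Fin 3) ℂ} {n : ℕ} (hf : f.IsHomogeneous n)
    (hθ : A ⨯₃ grad f = f • θ) {p : CP2} (hp : p ∉ F.sing) (hpf : p ∈ zeroSet f)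
    (hgrad : ∃ c, p ∉ zeroSet (pderiv c f)) : ∀ᶠ q in 𝓝 p, q ∈ zeroSet f → q ∈ F.leafThrough p := by
  obtain ⟨i, j, hi, hd⟩ := exists_dom_of_point (F := F) p
  set v := sec i p with hv
  have hvp : proj v = p := proj_sec hi
  have hvi : v i = 1 := sec_self i p
  have hs : proj v ∉ F.sing := by rwa [hvp]
  obtain ⟨k, σ, hki, hk, h0, hσ, h1, h2⟩ := exists_integralCurve_coordinate hd hvi hs
  have hσf : ∀ᶠ z in 𝓝 0, eval (σ z) f = 0 := by
    filter_upwards [h1] with z hz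
    rw [← proj_mem_zeroSet hf (ne_zero_of_apply_ne_zero (i := i) (by simp [hz.1]))]
    exact leafThrough_subset_zeroSet hA hf hθ hp hpf (hvp ▸ hz.2)
  -- the gradient of `f` is a nonzero multiple of the local form
  have hg1 : evalVec (grad f) v ⬝ᵥ F.field i j v = 0 := by
    have h2 := hasDerivAt_eval hσ f
    rw [h0] at h2
    exact h2.unique ((hasDerivAt_const (0 : ℂ) (0 : ℂ)).congr_of_eventuallyEq hσf)
  have hg2 : evalVec (grad f) v ⬝ᵥ v = 0 := by
    rw [evalVec_grad_dotProduct_self hf, ← h0, hσf.self_of_nhds, mul_zero]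
  obtain ⟨m, hm⟩ := exists_eq_smul_of_cross_eq_zero ((form_ne_zero_iff hd).2 hs)
    (a := evalVec (grad f) v) (by
      rw [form, cross_cross_eq_smul_sub_smul', hg1, dotProduct_comm v, hg2]; simp)
  have hm0 : m ≠ 0 := by
    rintro rfl
    obtain ⟨c, hc⟩ := hgrad
    rw [← hvp, proj_mem_zeroSet hf.pderiv (sec_ne_zero i p)] at hc
    apply hc
    have := congrFun hm c
    simpa [evalVec, grad] using this
  -- the remaining index
  obtain ⟨l, hli, hlk, hall⟩ : ∃ l : Fin 3, l ≠ i ∧ l ≠ k ∧ ∀ c, c = i ∨ c = k ∨ c = l := by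
    have : ∀ i k : Fin 3, k ≠ i → ∃ l : Fin 3, l ≠ i ∧ l ≠ k ∧ ∀ c, c = i ∨ c = k ∨ c = l := by
      decide
    exact this i k hki
  have hl : eval v (pderiv l f) ≠ 0 := by
    have h3 := congrFun hm l
    have h4 : F.form i j v l ≠ 0 := by
      have h5 := field_apply_self hd
      simp only [form, cross_apply]
      fin_cases i <;> fin_cases k <;> fin_cases l <;> simp at hki hli hlk hvi h5 hk ⊢ <;>
        simp [hvi, h5, hk]
    have h5 : eval v (pderiv l f) = m * F.form i j v l := h3
    rw [h5]
    exact mul_ne_zero hm0 h4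
  -- two zeros of `f` near `v` with the same coordinates `i` and `k` coincide
  have hstrict := ((contDiff_eval (n := 1) f).contDiffAt (x := v)).hasStrictFDerivAt one_ne_zero
  have hfd : fderiv ℂ (fun v : Fin 3 → ℂ => eval v f) v (Pi.single l 1) = eval v (pderiv l f) := by
    have h3 : HasDerivAt (fun t : ℂ => v + t • (Pi.single l 1 : Fin 3 → ℂ)) (Pi.single l 1) 0 := by
      simpa using ((hasDerivAt_id (0 : ℂ)).smul_const (Pi.single l 1 : Fin 3 → ℂ)).const_add v
    have h4 := hasDerivAt_eval h3 f
    have h5 := HasFDerivAt.comp_hasDerivAt (f := fun t : ℂ => v + t • (Pi.single l 1 : Fin 3 → ℂ))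
      (0 : ℂ) (l := fun v : Fin 3 → ℂ => eval v f) (by
        simp only [zero_smul, add_zero]
        exact hstrict.hasFDerivAt) h3
    have h6 := h5.unique h4
    simpa using h6
  have huniq : ∀ᶠ u in 𝓝 (v, v), eval u.1 f = 0 → eval u.2 f = 0 → u.1 i = u.2 i → u.1 k = u.2 k →
      u.1 = u.2 := by
    have hε : 0 < ‖eval v (pderiv l f)‖ / 2 := by positivity
    filter_upwards [hstrict.isLittleO.def hε] with u hu e1 e2 e3 e4
    have h3 : u.1 - u.2 = (u.1 l - u.2 l) • (Pi.single l 1 : Fin 3 → ℂ) := by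
      funext c
      rcases hall c with rfl | rfl | rfl
      · simp [e3, hli.symm]
      · simp [e4, hlk.symm]
      · simp
    rw [e1, e2, h3, map_smul, hfd, sub_zero, zero_sub, norm_neg, norm_smul, norm_smul,
      Pi.norm_single, norm_one, mul_one] at hu
    have h4 : ‖u.1 l - u.2 l‖ = 0 := by
      nlinarith [norm_nonneg (u.1 l - u.2 l), norm_pos_iff.2 hl]
    rw [norm_eq_zero.1 h4, zero_smul] at h3
    exact sub_eq_zero.1 h3
  rw [nhds_prod_eq] at huniq
  obtain ⟨N₁, hN₁, N₂, hN₂, hN⟩ := Filter.mem_prod_iff.1 huniq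
  have h3 : ∀ᶠ z in 𝓝 (0 : ℂ), σ z ∈ N₂ := hσ.continuousAt.eventually_mem (by rwa [h0])
  have h4 : (fun z => σ z k) '' {z | (σ z i = 1 ∧ proj (σ z) ∈ F.leafThrough (proj v)) ∧
      eval (σ z) f = 0 ∧ σ z ∈ N₂} ∈ 𝓝 (v k) := by
    rw [← h2]
    exact image_mem_map (h1.and (hσf.and h3))
  have h5 : ContinuousAt (sec i) p := (contMDiffAt_sec hi).continuousAt
  filter_upwards [(isOpen_affineSet i).mem_nhds hi, h5.eventually_mem hN₁,
    ((continuous_apply k).continuousAt.comp h5).eventually_mem h4] with q hq1 hq2 hq3 hqf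
  obtain ⟨z, ⟨⟨hz1, hz2⟩, hz3, hz4⟩, hz⟩ := hq3
  have h6 : sec i q = σ z := by
    refine hN (mk_mem_prod hq2 hz4) ?_ hz3 ?_ hz.symm
    · rwa [← proj_mem_zeroSet hf (sec_ne_zero i q), proj_sec hq1]
    · exact (sec_self i q).trans hz1.symm
  rw [← h6, proj_sec hq1, hvp] at hz2
  exact hz2

/-- Up to finitely many points, an irreducible invariant curve is a single leaf. -/
lemma IsDefinedBy.exists_finite_diff_subset {A θ : Fin 3 → MvPolynomial (Fin 3) ℂ}
    (hA : F.IsDefinedBy A) {f : MvPolynomial (Fin 3) ℂ} {n : ℕ} (hf : Irreducible f)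
    (hfn : f.IsHomogeneous n) (hθ : A ⨯₃ grad f = f • θ) :
    ∃ B : Set CP2, B.Finite ∧ ∀ p ∈ zeroSet f, p ∉ F.sing → zeroSet f \ B ⊆ F.leafThrough p := by
  obtain ⟨c, hc⟩ := exists_not_dvd_pderiv hf hfn
  have hB : (F.sing ∪ zeroSet f ∩ zeroSet (pderiv c f)).Finite :=
    F.finite_sing.union (finite_inter_zeroSet hf hfn hfn.pderiv hc)
  refine ⟨_, hB, fun p hp hps q hq => ?_⟩
  have hL := leafThrough_subset_zeroSet hA hfn hθ hps hp
  obtain ⟨p', hp', hpB⟩ := ((infinite_leafThrough hps).sdiff hB).nonempty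
  refine of_locally_constant (P := (· ∈ F.leafThrough p)) hf hfn hB (fun x hx => ?_)
    ⟨hL hp', hpB⟩ hp' hq
  have hxs : x ∉ F.sing := fun h => hx.2 (Or.inl h)
  have hxc : x ∉ zeroSet (pderiv c f) := fun h => hx.2 (Or.inr ⟨hx.1, h⟩)
  filter_upwards [hA.eventually_mem_leafThrough hfn hθ hxs hx.1 ⟨c, hxc⟩] with y hy hyB
  have h1 := hy hyB.1
  exact ⟨fun h => h.trans _ _ _ (h1.symm _ _), fun h => h.trans _ _ _ h1⟩

lemma _root_.CP2.zeroSet_subset_closure {f : MvPolynomial (Fin 3) ℂ} {n : ℕ}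
    (hfn : f.IsHomogeneous n) {B : Set CP2} (hB : B.Finite) :
    zeroSet f ⊆ closure (zeroSet f \ B) := by
  intro p hp
  rw [mem_closure_iff_nhds]
  intro N hN
  obtain ⟨q, hq, hqB⟩ := ((infinite_zeroSet_inter hfn hp hN).sdiff hB).nonempty
  exact ⟨q, hq.2, hq.1, hqB⟩

end HolomorphicFoliation

/-! ### Algebraic leaves and invariant curves are invariant in the algebraic sense -/

namespace MvPolynomial

open scoped Matrix

/-- The curve `f = 0` is invariant for the one-form `A`: the polynomial `f` divides `A ∧ df`. -/
def IsInvariantFor (A : Fin 3 → MvPolynomial (Fin 3) ℂ) (f : MvPolynomial (Fin 3) ℂ) : Prop :=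
  ∃ θ : Fin 3 → MvPolynomial (Fin 3) ℂ, A ⨯₃ grad f = f • θ

lemma isInvariantFor_iff {A : Fin 3 → MvPolynomial (Fin 3) ℂ} {f : MvPolynomial (Fin 3) ℂ} :
    IsInvariantFor A f ↔ ∀ c, f ∣ (A ⨯₃ grad f) c := by
  constructor
  · rintro ⟨θ, hθ⟩ c
    exact ⟨θ c, congrFun hθ c⟩
  · intro h
    choose θ hθ using h
    exact ⟨θ, _root_.funext hθ⟩

lemma isHomogeneous_cross_grad {A : Fin 3 → MvPolynomial (Fin 3) ℂ} {k : ℕ}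
    (hA : ∀ i, (A i).IsHomogeneous k) {f : MvPolynomial (Fin 3) ℂ} {n : ℕ}
    (hf : f.IsHomogeneous n) (c : Fin 3) : ((A ⨯₃ grad f) c).IsHomogeneous (k + (n - 1)) := by
  have h : ∀ i j, (A i * grad f j).IsHomogeneous (k + (n - 1)) := fun i j => (hA i).mul hf.pderiv
  fin_cases c <;> simp only [cross_apply] <;> exact (h _ _).sub (h _ _)

/-- An irreducible curve at infinitely many points of which `A` and `df` are proportional is
invariant. -/
lemma isInvariantFor_of_infinite {A : Fin 3 → MvPolynomial (Fin 3) ℂ} {k : ℕ}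
    (hA : ∀ i, (A i).IsHomogeneous k) {f : MvPolynomial (Fin 3) ℂ} {n : ℕ} (hf : Irreducible f)
    (hfn : f.IsHomogeneous n)
    (h : {p | p ∈ CP2.zeroSet f ∧ ∀ c, p ∈ CP2.zeroSet ((A ⨯₃ grad f) c)}.Infinite) :
    IsInvariantFor A f :=
  isInvariantFor_iff.2 fun c => CP2.dvd_of_infinite hf hfn (isHomogeneous_cross_grad hA hfn c)
    (h.mono fun _ hp => ⟨hp.1, hp.2 c⟩)

end MvPolynomial

namespace HolomorphicFoliation

open CP2 MvPolynomial
open scoped Matrix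

variable {F : HolomorphicFoliation}

/-- If near `p` the leaf through `p` is contained in the curve `f = 0`, then `A` and `df` are
proportional at `p`. -/
lemma IsDefinedBy.mem_zeroSet_cross_grad {A : Fin 3 → MvPolynomial (Fin 3) ℂ} {d : ℕ}
    (hA : F.IsDefinedBy A) (hAd : ∀ i, (A i).IsHomogeneous d) {f : MvPolynomial (Fin 3) ℂ} {n : ℕ}
    (hf : f.IsHomogeneous n) {p : CP2} (hp : p ∉ F.sing)
    (hloc : ∀ᶠ q in 𝓝 p, q ∈ F.leafThrough p → q ∈ zeroSet f) (c : Fin 3) :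
    p ∈ zeroSet ((A ⨯₃ grad f) c) := by
  obtain ⟨i, j, hi, hd⟩ := exists_dom_of_point (F := F) p
  have hs : proj (sec i p) ∉ F.sing := by rwa [proj_sec hi]
  obtain ⟨k, σ, -, -, h0, hσ, h1, -⟩ := exists_integralCurve_coordinate hd (sec_self i p) hs
  have h2 : ContinuousAt (fun z => proj (σ z)) 0 :=
    ContinuousAt.comp (g := proj) (continuousAt_proj (h0 ▸ sec_ne_zero i p)) hσ.continuousAt
  have h3 : proj (σ 0) = p := by rw [h0, proj_sec hi]
  have h4 := hA.cross_grad_eq_zero hf hd hs h0 hσ (by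
    rw [← h3] at hloc
    filter_upwards [h1, h2.eventually hloc] with z hz hz'
    rw [← proj_mem_zeroSet hf (ne_zero_of_apply_ne_zero (i := i) (by simp [hz.1]))]
    exact hz' (by rw [h0]; exact hz.2))
  rw [← proj_sec hi, proj_mem_zeroSet (isHomogeneous_cross_grad hAd hf c) (sec_ne_zero i p)]
  exact congrFun h4 c

lemma _root_.CP2.infinite_zeroSet {f : MvPolynomial (Fin 3) ℂ} {n : ℕ} (hfn : f.IsHomogeneous n)
    (h : (zeroSet f).Nonempty) : (zeroSet f).Infinite := by
  obtain ⟨p, hp⟩ := h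
  simpa using infinite_zeroSet_inter hfn hp univ_mem

lemma _root_.CP2.zeroSet_subset_of_dvd {f g : MvPolynomial (Fin 3) ℂ} (h : f ∣ g) :
    zeroSet f ⊆ zeroSet g := by
  obtain ⟨u, rfl⟩ := h
  intro p hp
  change eval p.rep (f * u) = 0
  rw [map_mul, show eval p.rep f = 0 from hp, zero_mul]

lemma _root_.CP2.zeroSet_eq_of_associated {f g : MvPolynomial (Fin 3) ℂ} (h : Associated f g) :
    zeroSet f = zeroSet g :=
  (zeroSet_subset_of_dvd h.dvd).antisymm (zeroSet_subset_of_dvd h.symm.dvd)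

/-- Every curve has a point. -/
lemma _root_.CP2.zeroSet_nonempty {f : MvPolynomial (Fin 3) ℂ} {n : ℕ} (hfn : f.IsHomogeneous n)
    (hn : 0 < n) : (zeroSet f).Nonempty := by
  by_cases h1 : eval (Pi.single 2 1) f = 0
  · have h0 : (Pi.single 2 1 : Fin 3 → ℂ) ≠ 0 := by simp
    exact ⟨proj _, (proj_mem_zeroSet hfn h0).2 h1⟩
  · obtain ⟨c, hcn, hc⟩ := exists_coeff_polynomial hfn (Pi.single 0 1) 0 (Pi.single 2 1)
    set g : Polynomial ℂ := ∑ m ∈ Finset.range (n + 1),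
      Polynomial.C ((c m).eval 0) * Polynomial.X ^ m with hg
    have hgn : g.coeff n ≠ 0 := by
      rw [hg]
      simp only [Polynomial.finsetSum_coeff, Polynomial.coeff_C_mul_X_pow]
      rw [Finset.sum_ite_eq, if_pos (by simp), hcn]
      simpa using h1
    have hdeg : 0 < g.natDegree := hn.trans_le (Polynomial.le_natDegree_of_ne_zero hgn)
    obtain ⟨z, hz⟩ := IsAlgClosed.exists_root g (Polynomial.natDegree_pos_iff_degree_pos.1 hdeg).ne'
    have h2 := hc 0 z
    rw [show ∑ m ∈ Finset.range (n + 1), (c m).eval 0 * z ^ m = g.eval z by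
      simp [hg, Polynomial.eval_finsetSum], hz.eq_zero] at h2
    refine ⟨proj _, (proj_mem_zeroSet hfn ?_).2 h2⟩
    intro h3
    simpa using congrFun h3 0

/-- An irreducible component of the closure of an algebraic leaf is invariant and contains
nonsingular points of the leaf: off the other components the leaf lies in this component and
accumulates at each of its points. -/
lemma IsDefinedBy.exists_of_mem_algebraicLeaves {A : Fin 3 → MvPolynomial (Fin 3) ℂ} {d : ℕ}
    (hA : F.IsDefinedBy A) (hAd : ∀ i, (A i).IsHomogeneous d) {L : Set CP2}
    (hL : L ∈ F.algebraicLeaves) : ∃ (f : MvPolynomial (Fin 3) ℂ) (n : ℕ), Irreducible f ∧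
      f.IsHomogeneous n ∧ IsInvariantFor A f ∧ ∃ p, p ∉ F.sing ∧ p ∈ zeroSet f ∧
        L = F.leafThrough p := by
  obtain ⟨⟨p₀, hp₀, rfl⟩, m, g, hm, hg0, hgm, hclos⟩ := hL
  have hgu : ¬ IsUnit g := by
    intro hu
    obtain ⟨p, hp⟩ := zeroSet_nonempty hgm hm
    exact (hu.map (eval p.rep)).ne_zero hp
  obtain ⟨f, hf, hfg⟩ := WfDvdMonoid.exists_irreducible_factor hgu hg0
  obtain ⟨a, h, hfh, hgfh⟩ := WfDvdMonoid.max_power_factor hg0 hf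
  obtain ⟨n, hfn⟩ := hgm.exists_of_dvd hg0 hfg
  obtain ⟨l, hhl⟩ := hgm.exists_of_dvd hg0 (f := h) ⟨f ^ a, by rw [hgfh, mul_comm]⟩
  have hn := irreducible_degree_pos hf hfn
  have hfinf := infinite_zeroSet hfn (zeroSet_nonempty hfn hn)
  have hfin := finite_inter_zeroSet hf hfn hhl hfh
  have hsub : zeroSet f ⊆ zeroSet g := zeroSet_subset_of_dvd hfg
  have hgf : ∀ q ∈ zeroSet g, q ∉ zeroSet h → q ∈ zeroSet f := by
    intro q hq hqh
    have h1 : eval q.rep (f ^ a * h) = 0 := by rw [← hgfh]; exact hq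
    rw [map_mul, map_pow] at h1
    exact eq_zero_of_pow_eq_zero ((mul_eq_zero.1 h1).resolve_right hqh)
  have hleaf : F.leafThrough p₀ ⊆ zeroSet g := hclos ▸ subset_closure
  have hop : IsOpen (zeroSet h)ᶜ := (isClosed_zeroSet hhl).isOpen_compl
  have hpt : ∀ q ∈ F.leafThrough p₀, q ∉ zeroSet h → ∀ c, q ∈ zeroSet ((A ⨯₃ grad f) c) := by
    intro q hq hqh
    refine hA.mem_zeroSet_cross_grad hAd hfn (not_mem_sing_of_mem_leafThrough hq hp₀) ?_
    filter_upwards [hop.mem_nhds hqh] with q' hq' hq'L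
    exact hgf _ (hleaf (leafThrough_eq_of_mem hq ▸ hq'L)) hq'
  have hdense : ∀ q ∈ zeroSet f, q ∉ zeroSet h → ∀ N ∈ 𝓝 q, ∃ q' ∈ N, q' ∈ F.leafThrough p₀ ∧
      q' ∉ zeroSet h := by
    intro q hq hqh N hN
    have h1 : q ∈ closure (F.leafThrough p₀) := hclos ▸ hsub hq
    obtain ⟨q', hq', hq'L⟩ := mem_closure_iff_nhds.1 h1 _ (inter_mem hN (hop.mem_nhds hqh))
    exact ⟨q', hq'.1, hq'L, hq'.2⟩
  refine ⟨f, n, hf, hfn, isInvariantFor_of_infinite hAd hf hfn ((hfinf.sdiff hfin).mono ?_), ?_⟩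
  · rintro q ⟨hq, hqh⟩
    refine ⟨hq, fun c => ?_⟩
    rw [← (isClosed_zeroSet (isHomogeneous_cross_grad hAd hfn c)).closure_eq,
      mem_closure_iff_nhds]
    intro N hN
    obtain ⟨q', h1, h2, h3⟩ := hdense q hq (fun hh => hqh ⟨hq, hh⟩) N hN
    exact ⟨q', h1, hpt q' h2 h3 c⟩
  · obtain ⟨q, hq, hqh⟩ := (hfinf.sdiff hfin).nonempty
    obtain ⟨q', -, h2, h3⟩ := hdense q hq (fun hh => hqh ⟨hq, hh⟩) univ univ_mem
    exact ⟨q', not_mem_sing_of_mem_leafThrough h2 hp₀, hgf _ (hleaf h2) h3,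
      (leafThrough_eq_of_mem h2).symm⟩

/-- A curve that contains all leaves that it meets is invariant for the form `A`. -/
lemma IsDefinedBy.exists_of_mem_invariantCurves {A : Fin 3 → MvPolynomial (Fin 3) ℂ} {d : ℕ}
    (hA : F.IsDefinedBy A) (hAd : ∀ i, (A i).IsHomogeneous d) {C : Set CP2}
    (hC : C ∈ F.invariantCurves) : ∃ (f : MvPolynomial (Fin 3) ℂ) (n : ℕ), Irreducible f ∧
      f.IsHomogeneous n ∧ IsInvariantFor A f ∧ C = zeroSet f := by
  obtain ⟨⟨n, f, hf, hfn, rfl⟩, hC⟩ := hC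
  have hn := irreducible_degree_pos hf hfn
  have hfinf := infinite_zeroSet hfn (zeroSet_nonempty hfn hn)
  refine ⟨f, n, hf, hfn, isInvariantFor_of_infinite hAd hf hfn
    ((hfinf.sdiff F.finite_sing).mono ?_), rfl⟩
  rintro q ⟨hq, hqs⟩
  refine ⟨hq, hA.mem_zeroSet_cross_grad hAd hfn hqs (Eventually.of_forall ?_)⟩
  exact hC _ (mem_image_of_mem _ hqs) ⟨q, mem_leafThrough_self q, hq⟩

/-- The nonsingular points of an irreducible invariant curve belong to a single leaf. -/
lemma IsDefinedBy.leafThrough_eq {A : Fin 3 → MvPolynomial (Fin 3) ℂ} (hA : F.IsDefinedBy A)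
    {f : MvPolynomial (Fin 3) ℂ} {n : ℕ} (hf : Irreducible f) (hfn : f.IsHomogeneous n)
    (hinv : IsInvariantFor A f) {p q : CP2} (hp : p ∈ zeroSet f) (hps : p ∉ F.sing)
    (hq : q ∈ zeroSet f) (hqs : q ∉ F.sing) : F.leafThrough p = F.leafThrough q := by
  obtain ⟨θ, hθ⟩ := hinv
  obtain ⟨B, hB, h⟩ := hA.exists_finite_diff_subset hf hfn hθ
  obtain ⟨x, hx⟩ := ((infinite_zeroSet hfn ⟨p, hp⟩).sdiff hB).nonempty
  rw [← leafThrough_eq_of_mem (h p hp hps hx), ← leafThrough_eq_of_mem (h q hq hqs hx)]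

/-- On an invariant irreducible curve every leaf is algebraic. -/
lemma IsDefinedBy.closure_leafThrough {A : Fin 3 → MvPolynomial (Fin 3) ℂ} (hA : F.IsDefinedBy A)
    {f : MvPolynomial (Fin 3) ℂ} {n : ℕ} (hf : Irreducible f) (hfn : f.IsHomogeneous n)
    (hinv : IsInvariantFor A f) {p : CP2} (hp : p ∈ zeroSet f) (hps : p ∉ F.sing) :
    closure (F.leafThrough p) = zeroSet f := by
  obtain ⟨θ, hθ⟩ := hinv
  obtain ⟨B, hB, h⟩ := hA.exists_finite_diff_subset hf hfn hθ
  refine ((isClosed_zeroSet hfn).closure_subset_iff.2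
    (leafThrough_subset_zeroSet hA hfn hθ hps hp)).antisymm ?_
  exact (zeroSet_subset_closure hfn hB).trans (closure_mono (h p hp hps))

end HolomorphicFoliation

/-! ### Rational first integrals from invariant curves -/

namespace MvPolynomial

open scoped Matrix

lemma IsInvariantFor.totalDegree_le {A : Fin 3 → MvPolynomial (Fin 3) ℂ} {k : ℕ}
    (hA : ∀ i, (A i).IsHomogeneous k) {f : MvPolynomial (Fin 3) ℂ} {n : ℕ} (hf : f ≠ 0)
    (hfn : f.IsHomogeneous n) {θ : Fin 3 → MvPolynomial (Fin 3) ℂ} (hθ : A ⨯₃ grad f = f • θ)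
    (c : Fin 3) : (θ c).totalDegree ≤ k := by
  by_cases h0 : θ c = 0
  · simp [h0]
  have h1 : (A ⨯₃ grad f) c = f * θ c := congrFun hθ c
  have h2 := (isHomogeneous_cross_grad hA hfn c).totalDegree_le
  rw [h1, totalDegree_mul_of_isDomain hf h0, hfn.totalDegree hf] at h2
  omega

/-- A linear map from a space of dimension `m + 2` to a space of dimension at most `m` has
two linearly independent elements in its kernel. -/
lemma _root_.LinearMap.exists_linearIndependent_pair_mem_ker {V W : Type*} [AddCommGroup V]
    [Module ℂ V] [AddCommGroup W] [Module ℂ W] [FiniteDimensional ℂ V] [FiniteDimensional ℂ W]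
    (T : V →ₗ[ℂ] W) (h : Module.finrank ℂ W + 2 ≤ Module.finrank ℂ V) :
    ∃ a b : V, LinearIndependent ℂ ![a, b] ∧ T a = 0 ∧ T b = 0 := by
  have h1 := T.finrank_range_add_finrank_ker
  have h2 := (LinearMap.range T).finrank_le
  have h3 : 1 < Module.finrank ℂ (LinearMap.ker T) := by omega
  have : Nontrivial (LinearMap.ker T) := Module.nontrivial_of_finrank_pos (R := ℂ) (by omega)
  obtain ⟨x, hx⟩ := exists_ne (0 : LinearMap.ker T)
  obtain ⟨y, hy⟩ := exists_linearIndependent_pair_of_one_lt_finrank h3 hx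
  refine ⟨x, y, ?_, x.2, y.2⟩
  have h4 := hy.map' (LinearMap.ker T).subtype (Submodule.ker_subtype _)
  have h5 : (LinearMap.ker T).subtype ∘ ![x, y] = ![(x : V), (y : V)] := by
    funext i
    fin_cases i <;> rfl
  rwa [h5] at h4

/-- Darboux's theorem: with enough invariant irreducible curves, of number bounded in terms
of the degree, there is a rational first integral. -/
theorem exists_first_integral {A : Fin 3 → MvPolynomial (Fin 3) ℂ} {k : ℕ} (hA0 : A ≠ 0)
    (hA : ∀ i, (A i).IsHomogeneous k) {m : ℕ}
    (hm : 3 * Module.finrank ℂ (restrictTotalDegree (Fin 3) ℂ k) + 2 ≤ m)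
    {f : Fin m → MvPolynomial (Fin 3) ℂ} {d : Fin m → ℕ} (hirr : ∀ i, Irreducible (f i))
    (hd : ∀ i, (f i).IsHomogeneous (d i)) (hna : Pairwise fun i j => ¬ Associated (f i) (f j))
    (hinv : ∀ i, IsInvariantFor A (f i)) :
    ∃ (n : ℕ) (P Q : MvPolynomial (Fin 3) ℂ), P.IsHomogeneous n ∧ Q.IsHomogeneous n ∧
      IsRelPrime P Q ∧ LinearIndependent ℂ ![P, Q] ∧ A ⨯₃ (Q • grad P - P • grad Q) = 0 := by
  choose θ hθ using hinv
  have hmem : ∀ i c, θ i c ∈ restrictTotalDegree (Fin 3) ℂ k := fun i c =>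
    (mem_restrictTotalDegree _ _ _).2
      (IsInvariantFor.totalDegree_le hA (hirr i).ne_zero (hd i) (hθ i) c)
  let T : (Fin m → ℂ) →ₗ[ℂ] (Fin 3 → restrictTotalDegree (Fin 3) ℂ k) :=
    Fintype.linearCombination ℂ fun i c => ⟨θ i c, hmem i c⟩
  obtain ⟨a, b, hab, ha, hb⟩ := T.exists_linearIndependent_pair_mem_ker (by
    rw [Module.finrank_pi_fintype]; simpa using hm)
  have hT : ∀ a, T a = 0 → ∑ i, (C (a i) : MvPolynomial (Fin 3) ℂ) • θ i = 0 := by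
    intro a ha
    funext c
    have h1 := congrArg Subtype.val (congrFun ha c)
    simp only [T, Fintype.linearCombination_apply, Finset.sum_apply, Pi.smul_apply,
      Submodule.coe_sum, Submodule.coe_smul, Pi.zero_apply, Submodule.coe_zero] at h1
    simpa [Finset.sum_apply, smul_eq_C_mul] using h1
  exact exists_first_integral_of_relations f hirr hd hna hA0 hθ hab (hT a ha) (hT b hb)

/-- The members of the pencil of a first integral are invariant. -/
lemma isInvariantFor_pencil {A : Fin 3 → MvPolynomial (Fin 3) ℂ} {P Q : MvPolynomial (Fin 3) ℂ}
    (hrel : IsRelPrime P Q) (h : A ⨯₃ (Q • grad P - P • grad Q) = 0) {a b : ℂ}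
    (hab : a ≠ 0 ∨ b ≠ 0) : IsInvariantFor A (C a * P + C b * Q) := by
  set R := C a * P + C b * Q with hR
  have hgR : grad R = (C a : MvPolynomial (Fin 3) ℂ) • grad P +
      (C b : MvPolynomial (Fin 3) ℂ) • grad Q := by
    funext c
    simp [hR, grad, Derivation.leibniz]
  have hcu : ∀ x : ℂ, x ≠ 0 → IsUnit (C x : MvPolynomial (Fin 3) ℂ) := fun x hx =>
    (IsUnit.mk0 x hx).map C
  -- a second member of the pencil, without common factors with the first
  have key : ∀ S : MvPolynomial (Fin 3) ℂ, IsRelPrime R S → A ⨯₃ (S • grad R - R • grad S) = 0 →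
      IsInvariantFor A R := by
    intro S hS h0
    refine isInvariantFor_iff.2 fun c => hS.dvd_of_dvd_mul_left (y := S) ⟨(A ⨯₃ grad S) c, ?_⟩
    rw [map_sub, map_smul, map_smul] at h0
    have := congrFun h0 c
    simp only [Pi.sub_apply, Pi.smul_apply, smul_eq_mul, Pi.zero_apply] at this
    exact sub_eq_zero.1 this
  rcases hab with ha | hb
  · refine key Q (fun d hdR hdQ => hrel ?_ hdQ) ?_
    · have h1 : d ∣ C a * P := by
        have := dvd_sub hdR (hdQ.mul_left (C b))
        rwa [hR, add_sub_cancel_right] at this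
      exact ((hcu a ha).dvd_mul_left).1 h1
    · have : Q • grad R - R • grad Q =
          (C a : MvPolynomial (Fin 3) ℂ) • (Q • grad P - P • grad Q) := by
        rw [hgR, hR]
        funext c
        simp
        ring
      rw [this, map_smul, h, smul_zero]
  · refine key P (fun d hdR hdP => hrel hdP ?_) ?_
    · have h1 : d ∣ C b * Q := by
        have := dvd_sub hdR (hdP.mul_left (C a))
        rwa [hR, add_sub_cancel_left] at this
      exact ((hcu b hb).dvd_mul_left).1 h1
    · have : P • grad R - R • grad P =
          (-C b : MvPolynomial (Fin 3) ℂ) • (Q • grad P - P • grad Q) := by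
        rw [hgR, hR]
        funext c
        simp
        ring
      rw [this, map_smul, h, smul_zero]

/-- An irreducible factor of an invariant polynomial is invariant. -/
lemma IsInvariantFor.of_dvd {A : Fin 3 → MvPolynomial (Fin 3) ℂ} {f g : MvPolynomial (Fin 3) ℂ}
    (hg : IsInvariantFor A g) (hg0 : g ≠ 0) (hf : Irreducible f) (hfg : f ∣ g) :
    IsInvariantFor A f := by
  obtain ⟨m, h, hfh, rfl⟩ := WfDvdMonoid.max_power_factor hg0 hf
  have hm : m ≠ 0 := by
    rintro rfl
    rw [pow_zero, one_mul] at hfg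
    exact hfh hfg
  obtain ⟨l, rfl⟩ := Nat.exists_eq_succ_of_ne_zero hm
  obtain ⟨θ, hθ⟩ := hg
  refine isInvariantFor_iff.2 fun c => ?_
  have hgr : grad (f ^ (l + 1) * h) =
      f ^ (l + 1) • grad h + ((l + 1 : ℕ) * f ^ l * h) • grad f := by
    funext c
    simp [grad, Derivation.leibniz, Derivation.leibniz_pow]
    ring
  have h1 := congrFun hθ c
  rw [hgr, map_add, map_smul, map_smul] at h1
  simp only [Pi.add_apply, Pi.smul_apply, smul_eq_mul] at h1
  have h2 : f ^ l * (f * ((A ⨯₃ grad h) c) + (l + 1 : ℕ) * h * (A ⨯₃ grad f) c) =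
      f ^ l * (f * (h * θ c)) := by
    rw [pow_succ] at h1
    linear_combination h1
  have h3 := mul_left_cancel₀ (pow_ne_zero _ hf.ne_zero) h2
  have h4 : f ∣ ((l + 1 : ℕ) : MvPolynomial (Fin 3) ℂ) * h * (A ⨯₃ grad f) c :=
    ⟨h * θ c - (A ⨯₃ grad h) c, by linear_combination h3⟩
  have hp := hf.prime
  refine (hp.dvd_or_dvd h4).resolve_left fun h5 => ?_
  refine (hp.dvd_or_dvd h5).elim (fun h6 => hf.not_isUnit ?_) hfh
  refine isUnit_of_dvd_unit h6 ?_
  have : ((l + 1 : ℕ) : MvPolynomial (Fin 3) ℂ) = C ((l + 1 : ℕ) : ℂ) := by simp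
  rw [this]
  exact (IsUnit.mk0 _ (Nat.cast_ne_zero.2 l.succ_ne_zero)).map C

end MvPolynomial

namespace HolomorphicFoliation

open CP2 MvPolynomial
open scoped Matrix

variable {F : HolomorphicFoliation}

instance _root_.CP2.instInfinite : Infinite CP2 := by
  have h := infinite_zeros (i := 0) (h := fun _ => 0) (v := Pi.single 0 1) (by simp)
    (Eventually.of_forall fun w => differentiableAt_const _) rfl (N := univ) univ_mem
  exact infinite_univ_iff.1 (h.mono (subset_univ _))

lemma IsDefinedBy.form_ne_zero {A : Fin 3 → MvPolynomial (Fin 3) ℂ} (hA : F.IsDefinedBy A) :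
    A ≠ 0 := by
  rintro rfl
  obtain ⟨p, hp⟩ := F.finite_sing.infinite_compl.nonempty
  obtain ⟨i, j, hi, hd⟩ := exists_dom_of_point (F := F) p
  refine hA.ne_zero hd (by rwa [proj_sec hi]) ?_
  funext c
  simp [evalVec]

/-- A point lies on an irreducible component of a curve. -/
lemma _root_.CP2.exists_irreducible_dvd {R : MvPolynomial (Fin 3) ℂ} (hR : R ≠ 0) {p : CP2}
    (hp : p ∈ zeroSet R) : ∃ f, Irreducible f ∧ f ∣ R ∧ p ∈ zeroSet f := by
  induction R using WfDvdMonoid.induction_on_irreducible with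
  | zero => exact (hR rfl).elim
  | unit u hu => exact ((hu.map (eval p.rep)).ne_zero hp).elim
  | mul a i ha hi ih =>
    have h1 : eval p.rep (i * a) = 0 := hp
    rw [map_mul] at h1
    rcases mul_eq_zero.1 h1 with h | h
    · exact ⟨i, hi, dvd_mul_right _ _, h⟩
    · obtain ⟨f, hf, hfa, hpf⟩ := ih ha h
      exact ⟨f, hf, hfa.mul_left _, hpf⟩

/-- The level of a pencil through a given point. -/
lemma exists_pencil_member {P Q : MvPolynomial (Fin 3) ℂ} (p : CP2) :
    ∃ a b : ℂ, (a ≠ 0 ∨ b ≠ 0) ∧ p ∈ zeroSet (C a * P + C b * Q) := by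
  by_cases h : eval p.rep P = 0
  · exact ⟨1, 0, Or.inl one_ne_zero, by change eval p.rep _ = 0; simp [h]⟩
  · refine ⟨eval p.rep Q, -eval p.rep P, Or.inr (neg_ne_zero.2 h), ?_⟩
    change eval p.rep _ = 0
    simp
    ring

/-- The conclusion of Darboux's theorem for a foliation defined by a polynomial form: existence
of a rational first integral, and algebraicity of all leaves. -/
lemma IsDefinedBy.hasRationalFirstIntegral {A : Fin 3 → MvPolynomial (Fin 3) ℂ}
    (hA : F.IsDefinedBy A) {n : ℕ} {P Q : MvPolynomial (Fin 3) ℂ} (hP : P.IsHomogeneous n)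
    (hQ : Q.IsHomogeneous n) (hrel : IsRelPrime P Q) (hli : LinearIndependent ℂ ![P, Q])
    (h : A ⨯₃ (Q • grad P - P • grad Q) = 0) :
    F.HasRationalFirstIntegral ∧ F.algebraicLeaves = F.leaves := by
  have hhom : ∀ a b : ℂ, (C a * P + C b * Q).IsHomogeneous n := fun a b =>
    (hP.C_mul a).add (hQ.C_mul b)
  refine ⟨⟨n, P, Q, hP, hQ, hrel, hli, ?_⟩, ?_⟩
  · rintro _ ⟨p, hp, rfl⟩
    obtain ⟨a, b, hab, hpR⟩ := exists_pencil_member (P := P) (Q := Q) p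
    obtain ⟨θ, hθ⟩ := isInvariantFor_pencil hrel h hab
    exact ⟨a, b, hab, leafThrough_subset_zeroSet hA (hhom a b) hθ hp hpR⟩
  · refine Subset.antisymm (fun _ h => h.1) ?_
    rintro _ ⟨p, hp, rfl⟩
    obtain ⟨a, b, hab, hpR⟩ := exists_pencil_member (P := P) (Q := Q) p
    have hR0 : C a * P + C b * Q ≠ 0 := by
      intro h0
      have := LinearIndependent.pair_iff.1 hli a b (by simpa [smul_eq_C_mul] using h0)
      rcases hab with h1 | h1
      · exact h1 this.1
      · exact h1 this.2
    obtain ⟨f, hf, hfR, hpf⟩ := exists_irreducible_dvd hR0 hpR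
    obtain ⟨m, hfm⟩ := (hhom a b).exists_of_dvd hR0 hfR
    have hinv := (isInvariantFor_pencil hrel h hab).of_dvd hR0 hf hfR
    exact ⟨mem_image_of_mem _ hp, m, f, irreducible_degree_pos hf hfm, hf.ne_zero, hfm,
      hA.closure_leafThrough hf hfm hinv hpf hp⟩

/-- A number of invariant curves beyond which a foliation of degree `k` has a rational first
integral: one more than three times the dimension of the space of polynomials of degree at most `k`
in three variables, as a quotient of `A ∧ df` by `f` consists of three such polynomials. -/
noncomputable def darbouxBound (k : ℕ) : ℕ :=
  3 * Module.finrank ℂ (restrictTotalDegree (Fin 3) ℂ k) + 1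

/-- Darboux's theorem for a family of sets, to which pairwise different irreducible invariant curves
are attached. -/
lemma IsDefinedBy.of_encard_lt {A : Fin 3 → MvPolynomial (Fin 3) ℂ} {k : ℕ}
    (hA : F.IsDefinedBy A) (hAk : ∀ i, (A i).IsHomogeneous k) {𝒮 : Set (Set CP2)}
    (φ : 𝒮 → MvPolynomial (Fin 3) ℂ) (hirr : ∀ S, Irreducible (φ S))
    (hhom : ∀ S, ∃ n, (φ S).IsHomogeneous n) (hinv : ∀ S, IsInvariantFor A (φ S))
    (hinj : ∀ S S', Associated (φ S) (φ S') → S = S')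
    (hcard : (darbouxBound k : ℕ∞) < 𝒮.encard) :
    F.HasRationalFirstIntegral ∧ F.algebraicLeaves = F.leaves := by
  obtain ⟨𝒯, h𝒯, hcard'⟩ := exists_subset_encard_eq (Order.add_one_le_of_lt hcard)
  have hfin : 𝒯.Finite := finite_of_encard_eq_coe (k := darbouxBound k + 1) (by simpa using hcard')
  have hc : hfin.toFinset.card = darbouxBound k + 1 := by
    have h1 := hfin.encard_eq_coe_toFinset_card
    rw [hcard'] at h1
    exact_mod_cast h1.symm
  let e := (hfin.toFinset.equivFin).symm
  let s : Fin hfin.toFinset.card → 𝒮 := fun i => ⟨e i, h𝒯 (hfin.mem_toFinset.1 (e i).2)⟩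
  have hs : Function.Injective s := fun i j hij =>
    e.injective (Subtype.ext (congrArg (fun x : 𝒮 => (x : Set CP2)) hij))
  choose d hd using hhom
  obtain ⟨n, P, Q, hP, hQ, hrel, hli, h⟩ := exists_first_integral hA.form_ne_zero hAk
    (m := hfin.toFinset.card) (by rw [hc, darbouxBound]) (f := fun i => φ (s i))
    (d := fun i => d (s i)) (fun i => hirr _) (fun i => hd _)
    (fun i j hij hass => hij (hs (hinj _ _ hass))) (fun i => hinv _)
  exact hA.hasRationalFirstIntegral hP hQ hrel hli h

lemma IsDefinedBy.of_encard_algebraicLeaves {A : Fin 3 → MvPolynomial (Fin 3) ℂ} {k : ℕ}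
    (hA : F.IsDefinedBy A) (hAk : ∀ i, (A i).IsHomogeneous k)
    (hcard : (darbouxBound k : ℕ∞) < F.algebraicLeaves.encard) :
    F.HasRationalFirstIntegral ∧ F.algebraicLeaves = F.leaves := by
  choose φ n hirr hhom hinv p hps hpf hL using
    fun S : F.algebraicLeaves => hA.exists_of_mem_algebraicLeaves hAk S.2
  refine hA.of_encard_lt hAk φ hirr (fun S => ⟨n S, hhom S⟩) hinv (fun S S' hass => ?_) hcard
  apply Subtype.ext
  rw [hL S, hL S']
  exact hA.leafThrough_eq (hirr S) (hhom S) (hinv S) (hpf S) (hps S)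
    (zeroSet_eq_of_associated hass ▸ hpf S') (hps S')

lemma IsDefinedBy.of_encard_invariantCurves {A : Fin 3 → MvPolynomial (Fin 3) ℂ} {k : ℕ}
    (hA : F.IsDefinedBy A) (hAk : ∀ i, (A i).IsHomogeneous k)
    (hcard : (darbouxBound k : ℕ∞) < F.invariantCurves.encard) :
    F.HasRationalFirstIntegral ∧ F.algebraicLeaves = F.leaves := by
  choose φ n hirr hhom hinv hC using
    fun S : F.invariantCurves => hA.exists_of_mem_invariantCurves hAk S.2
  refine hA.of_encard_lt hAk φ hirr (fun S => ⟨n S, hhom S⟩) hinv (fun S S' hass => ?_) hcard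
  apply Subtype.ext
  rw [hC S, hC S', zeroSet_eq_of_associated hass]

end HolomorphicFoliation

/-! ### Forms proportional to the local forms of the foliation -/

namespace HolomorphicFoliation

open CP2 MvPolynomial
open scoped Matrix

variable (F : HolomorphicFoliation)

/-- At the point `v`, the polynomial one-form `G` is parallel to the local forms of the foliation.
In contrast to `IsDefinedBy`, both sides may vanish. -/
def IsParallel (G : Fin 3 → MvPolynomial (Fin 3) ℂ) (v : Fin 3 → ℂ) : Prop :=
  ∀ i j, v ∈ F.dom i j → evalVec G v ⨯₃ F.form i j v = 0

variable {F}

lemma isParallel_of_mem_dom {G : Fin 3 → MvPolynomial (Fin 3) ℂ} {v : Fin 3 → ℂ} {i : Fin 3}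
    {j : F.ι} (hv : v ∈ F.dom i j) (h : evalVec G v ⨯₃ F.form i j v = 0) : F.IsParallel G v := by
  intro i' j' hv'
  obtain ⟨c, -, hc⟩ := exists_form_eq_smul hv' hv
  rw [hc, map_smul, h, smul_zero]

/-- Identity theorem: proportionality on an open set implies proportionality everywhere. -/
lemma isParallel_of_eventually {G : Fin 3 → MvPolynomial (Fin 3) ℂ} {w : Fin 3 → ℂ} (hw : w ≠ 0)
    (h : ∀ᶠ v in 𝓝 w, F.IsParallel G v) {v : Fin 3 → ℂ} : F.IsParallel G v := by
  rcases eq_or_ne v 0 with rfl | hv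
  · exact fun i j hij => (hij.1 rfl).elim
  set S : Set (Fin 3 → ℂ) := {w | ∀ᶠ v in 𝓝 w, F.IsParallel G v} with hS
  have hSo : IsOpen S := isOpen_iff_mem_nhds.2 fun w hw => eventually_eventually_nhds.2 hw
  have hconn : IsPreconnected ({0}ᶜ : Set (Fin 3 → ℂ)) := by
    refine (isConnected_compl_singleton_of_one_lt_rank (E := Fin 3 → ℂ) ?_ 0).isPreconnected
    rw [← Module.finrank_eq_rank, Module.finrank_pi_fintype]
    simp
  have hsub : ({0}ᶜ : Set (Fin 3 → ℂ)) ⊆ S := by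
    refine hconn.subset_of_closure_inter_subset hSo ⟨w, hw, h⟩ ?_
    rintro u ⟨hu, hu0⟩
    obtain ⟨i, j, hij⟩ := F.exists_mem_dom hu0
    obtain ⟨r, hr, hball⟩ := Metric.isOpen_iff.1 (F.isOpen_dom i j) u hij
    obtain ⟨x, hx, hxS⟩ := mem_closure_iff_nhds.1 hu _ (Metric.ball_mem_nhds u hr)
    have han : AnalyticOnNhd ℂ (fun v => evalVec G v ⨯₃ F.form i j v) (Metric.ball u r) := by
      intro y hy
      have h1 := fun k => contDiffAt_pi.1 (contDiffAt_form (hball hy)) k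
      have h2 := fun k => (contDiff_eval (n := ω) (G k)).contDiffAt (x := y)
      refine ContDiffAt.analyticAt (contDiffAt_pi.2 fun k => ?_)
      fin_cases k
      · simpa [cross_apply, evalVec] using ((h2 1).mul (h1 2)).sub ((h2 2).mul (h1 1))
      · simpa [cross_apply, evalVec] using ((h2 2).mul (h1 0)).sub ((h2 0).mul (h1 2))
      · simpa [cross_apply, evalVec] using ((h2 0).mul (h1 1)).sub ((h2 1).mul (h1 0))
    have h0 := han.eqOn_zero_of_preconnected_of_eventuallyEq_zero
      (convex_ball u r).isPreconnected hx (by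
        filter_upwards [hxS, Metric.isOpen_ball.mem_nhds hx] with y hy hyb
        exact hy i j (hball hyb))
    filter_upwards [Metric.ball_mem_nhds u hr] with y hy
    exact isParallel_of_mem_dom (hball hy) (h0 hy)
  exact (hsub hv : ∀ᶠ v in 𝓝 v, F.IsParallel G v).self_of_nhds

/-- If infinitely many points lie on a curve, then infinitely many of them lie on one of its
irreducible components. -/
lemma _root_.CP2.exists_irreducible_dvd_infinite {R : MvPolynomial (Fin 3) ℂ} (hR : R ≠ 0)
    {Z : Set CP2} (hZ : (Z ∩ zeroSet R).Infinite) :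
    ∃ f, Irreducible f ∧ f ∣ R ∧ (Z ∩ zeroSet f).Infinite := by
  induction R using WfDvdMonoid.induction_on_irreducible with
  | zero => exact (hR rfl).elim
  | unit u hu =>
    obtain ⟨p, -, hp⟩ := hZ.nonempty
    exact ((hu.map (eval p.rep)).ne_zero hp).elim
  | mul a i ha hi ih =>
    have h1 : Z ∩ zeroSet (i * a) ⊆ (Z ∩ zeroSet i) ∪ (Z ∩ zeroSet a) := by
      rintro p ⟨hpZ, hp⟩
      have h1 : eval p.rep (i * a) = 0 := hp
      rw [map_mul] at h1
      exact (mul_eq_zero.1 h1).imp (fun h => ⟨hpZ, h⟩) fun h => ⟨hpZ, h⟩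
    rcases infinite_union.1 (hZ.mono h1) with h | h
    · exact ⟨i, hi, dvd_mul_right _ _, h⟩
    · obtain ⟨f, hf, hfa, hpf⟩ := ih ha h
      exact ⟨f, hf, hfa.mul_left _, hpf⟩

/-- A nonzero homogeneous polynomial form that is proportional to the local forms on an open set and
has minimal degree has no divisorial zeros and so defines the foliation. -/
lemma exists_hasDegree_of_eventually_isParallel {G : Fin 3 → MvPolynomial (Fin 3) ℂ} {m : ℕ}
    (hG : ∀ c, (G c).IsHomogeneous m) (hG0 : G ≠ 0) {w : Fin 3 → ℂ} (hw : w ≠ 0)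
    (h : ∀ᶠ v in 𝓝 w, F.IsParallel G v) : ∃ k, F.HasDegree k := by
  classical
  have hex : ∃ m, ∃ G : Fin 3 → MvPolynomial (Fin 3) ℂ, (∀ c, (G c).IsHomogeneous m) ∧ G ≠ 0 ∧
      ∀ v, F.IsParallel G v := ⟨m, G, hG, hG0, fun v => isParallel_of_eventually hw h⟩
  clear hG hG0 hw h G m
  obtain ⟨G, hG, hG0, hpar⟩ := Nat.find_spec hex
  set m := Nat.find hex with hm
  refine ⟨m, hasDegree_iff.2 ⟨G, hG, ?_⟩⟩
  obtain ⟨a, ha⟩ := Function.ne_iff.1 hG0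
  replace ha : G a ≠ 0 := ha
  have hcop : ∀ f, Irreducible f → ¬ ∀ c, f ∣ G c := by
    intro f hf hdvd
    choose G' hG' using hdvd
    have hGf : G = f • G' := _root_.funext hG'
    obtain ⟨n, hfn⟩ := (hG a).exists_of_dvd ha ⟨G' a, hG' a⟩
    have hn := irreducible_degree_pos hf hfn
    have ha' : G' a ≠ 0 := by
      intro h0
      rw [hG', h0, mul_zero] at ha
      exact ha rfl
    have hmn : n ≤ m := by
      have h1 := (hG a).totalDegree ha
      rw [hG', totalDegree_mul_of_isDomain hf.ne_zero ha', hfn.totalDegree hf.ne_zero] at h1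
      omega
    have hG'hom : ∀ c, (G' c).IsHomogeneous (m - n) := by
      intro c
      by_cases h0 : G' c = 0
      · rw [h0]; exact isHomogeneous_zero _ _ _
      have hc : G c ≠ 0 := by rw [hG']; exact mul_ne_zero hf.ne_zero h0
      obtain ⟨l, hl⟩ := (hG c).exists_of_dvd hc ⟨f, by rw [hG', mul_comm]⟩
      have h1 := (hG c).totalDegree hc
      rw [hG', totalDegree_mul_of_isDomain hf.ne_zero h0, hfn.totalDegree hf.ne_zero,
        hl.totalDegree h0] at h1
      rwa [show m - n = l by omega]
    obtain ⟨w, hw⟩ : ∃ w, eval w (f * MvPolynomial.X 0) ≠ 0 := by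
      by_contra! hcon
      exact mul_ne_zero hf.ne_zero (MvPolynomial.X_ne_zero 0)
        (MvPolynomial.funext fun w => by simpa using hcon w)
    rw [map_mul, eval_X, mul_ne_zero_iff] at hw
    refine Nat.find_min hex (m := m - n) (by omega) ⟨G', hG'hom, ?_, fun v =>
      isParallel_of_eventually (ne_zero_of_apply_ne_zero hw.2) ?_⟩
    · intro h0
      exact ha' (congrFun h0 a)
    · filter_upwards [(continuous_eval' f).continuousAt.eventually_ne hw.1] with u hu i j hij
      have h1 := hpar u i j hij
      rw [hGf, evalVec_smul, map_smul, LinearMap.smul_apply] at h1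
      exact (smul_eq_zero.1 h1).resolve_left hu
  intro i j v hv hs
  have hform := (form_ne_zero_iff hv).2 hs
  obtain ⟨μ, hμ⟩ := exists_eq_smul_of_cross_eq_zero hform (hpar v i j hv)
  refine ⟨μ, ?_, hμ⟩
  rintro rfl
  rw [zero_smul] at hμ
  -- if `G` vanishes at a nonsingular point, it vanishes along the zeros of one of its components
  have hp : proj v ∈ affineSet i := (proj_mem_affineSet (ne_zero_of_apply_ne_zero hv.1)).2 hv.1
  have hu : sec i (proj v) ∈ F.dom i j := by
    rw [sec_proj hv.1]; exact smul_mem_dom (inv_ne_zero hv.1) hv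
  have huform : F.form i j (sec i (proj v)) ≠ 0 := (form_ne_zero_iff hu).2 (by rwa [proj_sec hp])
  obtain ⟨c, hc⟩ := Function.ne_iff.1 huform
  have hGc : eval (sec i (proj v)) (G c) = 0 := by
    rw [sec_proj hv.1, (hG c).eval_smul]
    have : eval v (G c) = 0 := congrFun hμ c
    rw [this, mul_zero]
  have hN : {q : CP2 | q ∈ affineSet i ∧ sec i q ∈ F.dom i j ∧ F.form i j (sec i q) c ≠ 0} ∈
      𝓝 (proj (sec i (proj v))) := by
    rw [proj_sec hp]
    have h1 : ContinuousAt (sec i) (proj v) := (contMDiffAt_sec hp).continuousAt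
    have h2 : ContinuousAt (fun u => F.form i j u c) (sec i (proj v)) :=
      (contDiffAt_pi.1 (contDiffAt_form hu) c).continuousAt
    filter_upwards [(isOpen_affineSet i).mem_nhds hp, h1.eventually_mem
      ((F.isOpen_dom i j).mem_nhds hu), h1.eventually (h2.eventually_ne hc)] with q h3 h4 h5
    exact ⟨h3, h4, h5⟩
  have hinf := infinite_zeros (sec_self i (proj v)) (h := fun v => eval v (G c))
    (Eventually.of_forall fun w => (contDiff_eval (n := 1) (G c)).differentiable (by simp) w)
    hGc hN
  have hcommon : ∀ q, (q ∈ {q : CP2 | q ∈ affineSet i ∧ sec i q ∈ F.dom i j ∧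
      F.form i j (sec i q) c ≠ 0} ∧ q ∈ affineSet i ∧ eval (sec i q) (G c) = 0) →
      ∀ b, q ∈ zeroSet (G b) := by
    rintro q ⟨⟨h1, h2, h3⟩, -, h4⟩ b
    obtain ⟨μ, hμ⟩ := exists_eq_smul_of_cross_eq_zero (ne_zero_of_apply_ne_zero h3)
      (hpar _ i j h2)
    have h5 : eval (sec i q) (G c) = μ * F.form i j (sec i q) c := congrFun hμ c
    have h6 : eval (sec i q) (G b) = μ * F.form i j (sec i q) b := congrFun hμ b
    rw [h4] at h5
    rw [(mul_eq_zero.1 h5.symm).resolve_right h3, zero_mul] at h6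
    rw [← proj_sec h1, proj_mem_zeroSet (hG b) (sec_ne_zero i q)]
    exact h6
  obtain ⟨f, hf, hfa, hfinf⟩ := exists_irreducible_dvd_infinite ha
    (hinf.mono fun q hq => ⟨hq, hcommon q hq a⟩)
  obtain ⟨n, hfn⟩ := (hG a).exists_of_dvd ha hfa
  refine hcop f hf fun b => dvd_of_infinite hf hfn (hG b) (hfinf.mono ?_)
  rintro q ⟨hq, hqf⟩
  exact ⟨hqf, hcommon q hq b⟩

end HolomorphicFoliation

/-! ### Power series with polynomial coefficients that are rational on lines -/

/-- If for infinitely many values of the variable the columns of a polynomial matrix, possibly with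
infinitely many rows, satisfy a linear relation, then they satisfy a relation with polynomial
coefficients. -/
lemma Polynomial.exists_relation {ι : Type*} {n : ℕ} (M : ι → Fin n → Polynomial ℂ)
    (h : {τ : ℂ | ∃ q : Fin n → ℂ, q ≠ 0 ∧ ∀ i, ∑ j, q j * (M i j).eval τ = 0}.Infinite) :
    ∃ Q : Fin n → Polynomial ℂ, Q ≠ 0 ∧ ∀ i, ∑ j, Q j * M i j = 0 := by
  classical
  let K := FractionRing (Polynomial ℂ)
  let φ : Polynomial ℂ →+* K := algebraMap (Polynomial ℂ) K
  have hφ : Function.Injective φ := IsFractionRing.injective (Polynomial ℂ) K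
  let a : ι → Fin n → K := fun i j => φ (M i j)
  rcases eq_or_ne (Submodule.span K (range a)) ⊤ with htop | htop
  · -- a nonvanishing minor has only finitely many zeros
    exfalso
    have hn : n = Module.finrank K (Submodule.span K (range a)) := by
      rw [htop, finrank_top, Module.finrank_fin_fun]
    obtain ⟨f, hf, hli⟩ : ∃ f : Fin n → Fin n → K, (∀ i, f i ∈ range a) ∧
        LinearIndependent K f := by
      obtain ⟨f, hf, -, hli⟩ := Submodule.exists_fun_fin_finrank_span_eq K (range a)
      exact ⟨f ∘ finCongr hn, fun i => hf _, hli.comp _ (finCongr hn).injective⟩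
    choose s hs using hf
    set D : Matrix (Fin n) (Fin n) (Polynomial ℂ) := Matrix.of fun i j => M (s i) j with hD
    have h1 : IsUnit (D.map φ) := by
      rw [← Matrix.linearIndependent_rows_iff_isUnit]
      have hrow : (D.map φ).row = f := by
        funext i
        exact hs i
      rw [hrow]
      exact hli
    have h2 : D.det ≠ 0 := by
      intro h0
      have h3 := ((D.map φ).isUnit_iff_isUnit_det).1 h1
      rw [← RingHom.mapMatrix_apply, ← RingHom.map_det, h0, map_zero] at h3
      exact not_isUnit_zero h3
    apply h2
    refine Polynomial.eq_zero_of_infinite_isRoot _ (h.mono ?_)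
    rintro τ ⟨q, hq, hqM⟩
    change Polynomial.evalRingHom τ D.det = 0
    rw [RingHom.map_det, ← Matrix.exists_mulVec_eq_zero_iff]
    refine ⟨q, hq, ?_⟩
    funext i
    rw [Pi.zero_apply, ← hqM (s i)]
    simp only [Matrix.mulVec, dotProduct]
    exact Finset.sum_congr rfl fun j _ => mul_comm _ _
  · obtain ⟨ψ, hψ0, hψ⟩ := Submodule.exists_le_ker_of_lt_top _ (lt_top_iff_ne_top.2 htop)
    obtain ⟨b, hb⟩ := IsLocalization.exist_integer_multiples_of_finite
      (nonZeroDivisors (Polynomial ℂ)) (fun j : Fin n => ψ (Pi.single j 1))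
    choose Q hQ using hb
    have hb0 : φ b ≠ 0 := (map_ne_zero_iff φ hφ).2 (nonZeroDivisors.ne_zero b.2)
    have hsum : ∀ x : Fin n → K, ψ x = ∑ j, x j * ψ (Pi.single j 1) := by
      intro x
      conv_lhs => rw [← Finset.univ_sum_single x]
      rw [map_sum]
      refine Finset.sum_congr rfl fun j _ => ?_
      rw [← smul_eq_mul, ← map_smul, ← Pi.single_smul, smul_eq_mul, mul_one]
    refine ⟨Q, ?_, fun i => hφ ?_⟩
    · rintro rfl
      apply hψ0
      refine LinearMap.ext fun x => ?_
      rw [hsum, LinearMap.zero_apply]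
      refine Finset.sum_eq_zero fun j _ => ?_
      have h1 : φ 0 = (b : Polynomial ℂ) • ψ (Pi.single j 1) := hQ j
      rw [map_zero, Algebra.smul_def] at h1
      rw [(mul_eq_zero.1 h1.symm).resolve_left hb0, mul_zero]
    · have h1 : ψ (a i) = 0 := hψ (Submodule.subset_span (mem_range_self i))
      rw [map_zero, map_sum]
      have h2 : ∀ j ∈ Finset.univ, φ (Q j * M i j) = φ b * (a i j * ψ (Pi.single j 1)) := by
        intro j _
        have h1 : φ (Q j) = (b : Polynomial ℂ) • ψ (Pi.single j 1) := hQ j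
        rw [map_mul, h1, Algebra.smul_def]
        simp only [a, φ]
        ring
      rw [Finset.sum_congr rfl h2, ← Finset.mul_sum, ← hsum, h1, mul_zero]

/-- Identity theorem for power series, with the centre excluded. -/
lemma eq_zero_of_hasSum_zero {a : ℕ → ℂ}
    (h : ∀ᶠ t in 𝓝[≠] (0 : ℂ), HasSum (fun m => a m * t ^ m) 0) (m : ℕ) : a m = 0 := by
  set f : ℂ → ℂ := fun t => if t = 0 then a 0 else 0 with hf
  have h1 : HasFPowerSeriesAt f (FormalMultilinearSeries.ofScalars ℂ a) 0 := by
    rw [hasFPowerSeriesAt_iff]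
    filter_upwards [eventually_nhdsWithin_iff.1 h] with t ht
    simp only [FormalMultilinearSeries.coeff_ofScalars, zero_add, smul_eq_mul, mul_comm (t ^ _)]
    by_cases h0 : t = 0
    · subst h0
      simp only [hf, if_true]
      convert hasSum_single 0 ?_ using 1
      · simp
      · intro m hm
        simp [hm]
    · simpa [hf, h0] using ht h0
  have h2 : f 0 = 0 := by
    have h3 : Tendsto f (𝓝[≠] 0) (𝓝 (f 0)) := h1.continuousAt.tendsto.mono_left nhdsWithin_le_nhds
    refine tendsto_nhds_unique h3 (tendsto_const_nhds.congr' ?_)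
    filter_upwards [self_mem_nhdsWithin] with t ht
    simp [hf, show t ≠ 0 from ht]
  have h3 : f = 0 := by
    funext t
    by_cases h0 : t = 0
    · rw [h0, h2]; rfl
    · simp [hf, h0]
  rw [h3] at h1
  have h4 : (FormalMultilinearSeries.ofScalars ℂ a).coeff m = 0 := by rw [h1.eq_zero]; rfl
  rwa [FormalMultilinearSeries.coeff_ofScalars] at h4

/-- Cauchy product of a polynomial and a power series. -/
lemma HasSum.polynomial_mul {c : ℕ → ℂ} {t R : ℂ} (h : HasSum (fun m => c m * t ^ m) R) (K : ℕ)
    (q : ℕ → ℂ) : HasSum (fun m => (∑ j ∈ Finset.range (K + 1),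
      if j ≤ m then q j * c (m - j) else 0) * t ^ m)
      ((∑ j ∈ Finset.range (K + 1), q j * t ^ j) * R) := by
  have h1 : ∀ j ∈ Finset.range (K + 1), HasSum (fun m => (if j ≤ m then q j * c (m - j) else 0) *
      t ^ m) (q j * t ^ j * R) := by
    intro j _
    rw [← (add_left_injective j).hasSum_iff]
    · have h2 : (fun m => (if j ≤ m then q j * c (m - j) else 0) * t ^ m) ∘ (fun m => m + j) =
          fun m => q j * t ^ j * (c m * t ^ m) := by
        funext m
        simp only [Function.comp, le_add_iff_nonneg_left, zero_le, if_true, Nat.add_sub_cancel]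
        ring
      rw [h2]
      exact h.mul_left (q j * t ^ j)
    · intro m hm
      have : ¬ j ≤ m := fun hjm => hm ⟨m - j, Nat.sub_add_cancel hjm⟩
      simp [this]
  have h2 := hasSum_sum h1
  rw [← Finset.sum_mul] at h2
  convert h2 using 1
  funext m
  rw [Finset.sum_mul]

/-- A power series in `t` whose coefficients are polynomials in `τ`, and which for every `τ` is
the expansion of a rational function of `t`, is a rational function of `t` and `τ`: the degree of
the rational functions is bounded for infinitely many `τ`, and so the linear recurrence for the
coefficients has a solution that is polynomial in `τ`. -/
theorem exists_rational_of_forall_rational {c : ℕ → Polynomial ℂ} {R : ℂ → ℂ → ℂ}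
    (hc : ∀ τ, ∀ᶠ t in 𝓝 (0 : ℂ), HasSum (fun m => (c m).eval τ * t ^ m) (R t τ))
    (hR : ∀ τ, ∃ (p q : Polynomial ℂ) (B : Set ℂ), q ≠ 0 ∧ B.Finite ∧
      ∀ t ∉ B, q.eval t * R t τ = p.eval t) :
    ∃ P Q : MvPolynomial (Fin 2) ℂ, Q ≠ 0 ∧ ∀ t τ,
      HasSum (fun m => (c m).eval τ * t ^ m) (R t τ) →
        MvPolynomial.eval ![t, τ] Q * R t τ = MvPolynomial.eval ![t, τ] P := by
  -- `T K` contains the `τ` for which numerator and denominator can be chosen of degree at most `K`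
  set T : ℕ → Set ℂ := fun K => {τ : ℂ | ∃ q : Fin (K + 1) → ℂ, q ≠ 0 ∧
    ∀ i : ℕ, ∑ j, q j * (c (K + 1 + i - j)).eval τ = 0} with hT
  have hcover : ∀ τ, ∃ K, τ ∈ T K := by
    intro τ
    obtain ⟨p, q, B, hq, hB, hpq⟩ := hR τ
    set K := max p.natDegree q.natDegree with hK
    have hqs : ∀ t, q.eval t = ∑ j ∈ Finset.range (K + 1), q.coeff j * t ^ j := fun t =>
      Polynomial.eval_eq_sum_range' (Nat.lt_succ_of_le (le_max_right _ _)) t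
    have hps : ∀ t, HasSum (fun m => p.coeff m * t ^ m) (p.eval t) := by
      intro t
      rw [Polynomial.eval_eq_sum_range' (n := K + 1) (Nat.lt_succ_of_le (le_max_left _ _)) t]
      refine hasSum_sum_of_ne_finset_zero fun m hm => ?_
      rw [Polynomial.coeff_eq_zero_of_natDegree_lt, zero_mul]
      have : K + 1 ≤ m := by simpa using hm
      exact lt_of_le_of_lt (le_max_left _ _) this
    have h0 : ∀ᶠ t in 𝓝[≠] (0 : ℂ), HasSum (fun m => ((∑ j ∈ Finset.range (K + 1),
        if j ≤ m then q.coeff j * (c (m - j)).eval τ else 0) - p.coeff m) * t ^ m) 0 := by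
      have h1 : ∀ᶠ t in 𝓝 (0 : ℂ), t ∉ B \ {0} :=
        (hB.sdiff (t := {0})).isClosed.isOpen_compl.mem_nhds (by simp)
      filter_upwards [nhdsWithin_le_nhds (hc τ), nhdsWithin_le_nhds h1, self_mem_nhdsWithin]
        with t ht1 ht2 ht3
      have ht4 : t ∉ B := fun h => ht2 ⟨h, ht3⟩
      have h2 := (ht1.polynomial_mul K q.coeff).sub (hps t)
      rw [← hqs, hpq t ht4, sub_self] at h2
      simpa only [sub_mul] using h2
    have h1 := eq_zero_of_hasSum_zero h0
    refine ⟨K, fun j => q.coeff j, ?_, fun i => ?_⟩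
    · intro hq0
      apply hq
      refine Polynomial.ext fun m => ?_
      rw [Polynomial.coeff_zero]
      by_cases hm : m < K + 1
      · exact congrFun hq0 ⟨m, hm⟩
      · exact Polynomial.coeff_eq_zero_of_natDegree_lt
          (lt_of_le_of_lt (le_max_right p.natDegree _) (by omega))
    · have h2 := h1 (K + 1 + i)
      rw [Polynomial.coeff_eq_zero_of_natDegree_lt (lt_of_le_of_lt (le_max_left _ q.natDegree)
        (by omega)), sub_zero, Finset.sum_range] at h2
      rw [← h2]
      refine Finset.sum_congr rfl fun j _ => ?_
      rw [if_pos (by omega)]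
  -- the field `ℂ` is uncountable
  obtain ⟨K, hKinf⟩ : ∃ K, (T K).Infinite := by
    by_contra! hcon
    refine not_countable_complex ((countable_iUnion fun K => (hcon K).countable).mono ?_)
    exact fun τ _ => mem_iUnion.2 (hcover τ)
  obtain ⟨Q, hQ0, hQ⟩ := Polynomial.exists_relation
    (fun (i : ℕ) (j : Fin (K + 1)) => c (K + 1 + i - j)) hKinf
  set Q' : ℕ → Polynomial ℂ := fun j => if h : j < K + 1 then Q ⟨j, h⟩ else 0 with hQ'
  have hQQ : ∀ j : Fin (K + 1), Q' j = Q j := fun j => by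
    simp only [hQ', j.2, dif_pos]
  have haeval : ∀ (w : Fin 2 → ℂ) (p : Polynomial ℂ), MvPolynomial.eval w
      (Polynomial.aeval (MvPolynomial.X 1 : MvPolynomial (Fin 2) ℂ) p) = p.eval (w 1) := by
    intro w p
    induction p using Polynomial.induction_on' with
    | add p q hp hq => simp [hp, hq]
    | monomial k a => simp [Polynomial.aeval_monomial]
  set Qm : MvPolynomial (Fin 2) ℂ := ∑ j ∈ Finset.range (K + 1),
    Polynomial.aeval (MvPolynomial.X 1) (Q' j) * MvPolynomial.X 0 ^ j with hQm
  have hQme : ∀ t τ, MvPolynomial.eval ![t, τ] Qm =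
      ∑ j ∈ Finset.range (K + 1), (Q' j).eval τ * t ^ j := by
    intro t τ
    simp [hQm, haeval]
  refine ⟨∑ m ∈ Finset.range (K + 1), (∑ j ∈ Finset.range (K + 1),
    if j ≤ m then Polynomial.aeval (MvPolynomial.X 1) (Q' j * c (m - j)) else 0) *
      MvPolynomial.X 0 ^ m, Qm, ?_, fun t τ hs => ?_⟩
  · intro h0
    apply hQ0
    funext j
    refine Polynomial.funext fun τ => ?_
    have h1 : ∑ j ∈ Finset.range (K + 1), Polynomial.C ((Q' j).eval τ) * Polynomial.X ^ j = 0 := by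
      refine Polynomial.funext fun t => ?_
      have h2 := hQme t τ
      rw [h0, map_zero] at h2
      simp [Polynomial.eval_finsetSum, ← h2]
    have h2 := congrArg (fun p => p.coeff j) h1
    simp only [Polynomial.finsetSum_coeff, Polynomial.coeff_C_mul_X_pow, Polynomial.coeff_zero]
      at h2
    rw [Finset.sum_ite_eq, if_pos (Finset.mem_range.2 j.2), hQQ] at h2
    simpa using h2
  · have h1 := hs.polynomial_mul K (fun j => (Q' j).eval τ)
    rw [← hQme] at h1
    have h2 := h1.unique (hasSum_sum_of_ne_finset_zero (s := Finset.range (K + 1)) fun m hm => ?_)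
    · rw [h2, map_sum]
      refine Finset.sum_congr rfl fun m _ => ?_
      rw [map_mul, map_sum]
      simp only [map_pow, MvPolynomial.eval_X, Matrix.cons_val_zero]
      congr 1
      refine Finset.sum_congr rfl fun j _ => ?_
      split_ifs
      · rw [haeval]; simp
      · simp
    · obtain ⟨i, rfl⟩ : ∃ i, m = K + 1 + i := ⟨m - (K + 1), by
        have : K + 1 ≤ m := by simpa using hm
        omega⟩
      have h3 := congrArg (Polynomial.eval τ) (hQ i)
      rw [Polynomial.eval_finsetSum, Polynomial.eval_zero] at h3
      rw [Finset.sum_range, mul_eq_zero]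
      left
      refine (Finset.sum_congr rfl fun j _ => ?_).trans h3
      rw [if_pos (by omega), hQQ, Polynomial.eval_mul]

/-! ### Holomorphic foliations of the projective plane are algebraic -/

/-- The restriction of a homogeneous polynomial map to an affine line is a polynomial. -/
lemma ContinuousMultilinearMap.exists_polynomial_line {E : Type*} [NormedAddCommGroup E]
    [NormedSpace ℂ E] {m : ℕ} (p : ContinuousMultilinearMap ℂ (fun _ : Fin m => E) ℂ) (a b : E) :
    ∃ c : Polynomial ℂ, ∀ τ : ℂ, p (fun _ => a + τ • b) = c.eval τ := by
  classical
  refine ⟨∑ s : Finset (Fin m), Polynomial.C (p (s.piecewise (fun _ => b) fun _ => a)) *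
    Polynomial.X ^ s.card, fun τ => ?_⟩
  have h := p.toMultilinearMap.map_add_univ (fun _ => τ • b) (fun _ => a)
  have h1 : (fun _ : Fin m => a + τ • b) = (fun _ => τ • b) + fun _ => a := by
    funext i
    simp [add_comm]
  rw [h1]
  refine h.trans ?_
  rw [Polynomial.eval_finsetSum]
  refine Finset.sum_congr rfl fun s _ => ?_
  have h2 := p.toMultilinearMap.map_piecewise_smul (fun _ => τ)
    (s.piecewise (fun _ => b) fun _ => a) s
  have h3 : (s.piecewise (fun i => τ • s.piecewise (fun _ => b) (fun _ => a) i)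
      (s.piecewise (fun _ => b) fun _ => a) : Fin m → E) =
        s.piecewise (fun _ => τ • b) fun _ => a := by
    funext i
    by_cases hi : i ∈ s <;> simp [hi]
  rw [h3, Finset.prod_const] at h2
  rw [h2]
  simp only [Polynomial.eval_mul, Polynomial.eval_C, Polynomial.eval_pow, Polynomial.eval_X,
    smul_eq_mul]
  exact mul_comm _ _

namespace HolomorphicFoliation

open CP2 MvPolynomial
open scoped Matrix

variable (F : HolomorphicFoliation)

open Classical in
/-- The quotient of two components of the local forms of the foliation. It does not depend on the
choice of the local form. At the origin, and where the denominator vanishes, its value is `0`. -/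
noncomputable def ratio (c₀ c : Fin 3) (v : Fin 3 → ℂ) : ℂ :=
  if h : v ≠ 0 then F.form (F.exists_mem_dom h).choose (F.exists_mem_dom h).choose_spec.choose v c /
    F.form (F.exists_mem_dom h).choose (F.exists_mem_dom h).choose_spec.choose v c₀ else 0

variable {F}

lemma ratio_eq {c₀ c : Fin 3} {i : Fin 3} {j : F.ι} {v : Fin 3 → ℂ} (hv : v ∈ F.dom i j) :
    F.ratio c₀ c v = F.form i j v c / F.form i j v c₀ := by
  have h0 := ne_zero_of_apply_ne_zero hv.1
  rw [ratio, dif_pos h0]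
  obtain ⟨a, ha, h⟩ := exists_form_eq_smul (F.exists_mem_dom h0).choose_spec.choose_spec hv
  rw [h, Pi.smul_apply, Pi.smul_apply, smul_eq_mul, smul_eq_mul, mul_div_mul_left _ _ ha]

lemma ratio_smul {c₀ c : Fin 3} {v : Fin 3 → ℂ} (hv : v ≠ 0) {a : ℂ} (ha : a ≠ 0) :
    F.ratio c₀ c (a • v) = F.ratio c₀ c v := by
  obtain ⟨i, j, hij⟩ := F.exists_mem_dom hv
  rw [ratio_eq hij, ratio_eq (smul_mem_dom ha hij)]
  have h1 : F.form i j (a • v) = a • F.form i j v := by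
    rw [form, field_congr (proj_smul ha hv), map_smul]
    rfl
  rw [h1, Pi.smul_apply, Pi.smul_apply, smul_eq_mul, smul_eq_mul, mul_div_mul_left _ _ ha]

lemma ratio_eventuallyEq {c₀ c : Fin 3} {i : Fin 3} {j : F.ι} {v : Fin 3 → ℂ}
    (hv : v ∈ F.dom i j) :
    F.ratio c₀ c =ᶠ[𝓝 v] fun w => F.form i j w c / F.form i j w c₀ := by
  filter_upwards [(F.isOpen_dom i j).mem_nhds hv] with w hw
  exact ratio_eq hw

lemma analyticAt_form {c : Fin 3} {i : Fin 3} {j : F.ι} {v : Fin 3 → ℂ} (hv : v ∈ F.dom i j) :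
    AnalyticAt ℂ (fun w => F.form i j w c) v :=
  (contDiffAt_pi.1 (contDiffAt_form hv) c).analyticAt

lemma meromorphicAt_ratio {c₀ c : Fin 3} {σ : ℂ → Fin 3 → ℂ} {t : ℂ} (hσ : AnalyticAt ℂ σ t)
    (h0 : σ t ≠ 0) : MeromorphicAt (fun t => F.ratio c₀ c (σ t)) t := by
  obtain ⟨i, j, hij⟩ := F.exists_mem_dom h0
  have h1 : ∀ c, AnalyticAt ℂ (fun t => F.form i j (σ t) c) t := fun c =>
    AnalyticAt.comp (g := fun w => F.form i j w c) (analyticAt_form hij) hσ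
  refine ((h1 c).meromorphicAt.div (h1 c₀).meromorphicAt).congr ?_
  refine Filter.EventuallyEq.filter_mono ?_ nhdsWithin_le_nhds
  exact (hσ.continuousAt.eventually (ratio_eventuallyEq hij)).mono fun _ h => h.symm

/-- Every foliation with isolated singularities of the projective plane is defined by a homogeneous
polynomial one-form. -/
theorem exists_hasDegree (F : HolomorphicFoliation) : ∃ k, F.HasDegree k := by
  classical
  obtain ⟨p₀, hp₀⟩ := F.finite_sing.infinite_compl.nonempty
  obtain ⟨i, j, hi, hd⟩ := exists_dom_of_point (F := F) p₀
  obtain ⟨c₀, hc₀⟩ := Function.ne_iff.1 ((form_ne_zero_iff hd).2 (by rwa [proj_sec hi]))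
  obtain ⟨b, ℓ, hb2, hℓ, hbℓ, hℓb⟩ := exists_linear_coordinates (sec_ne_zero i p₀)
  rw [← hb2] at hd hc₀
  -- points in the affine plane through the base point, and on the lines through it
  set π : ℂ × ℂ → Fin 3 → ℂ := fun y => b 2 + y.1 • b 0 + y.2 • b 1 with hπ
  have hℓπ : ∀ y, eval (π y) (ℓ 0) = y.1 ∧ eval (π y) (ℓ 1) = y.2 ∧ eval (π y) (ℓ 2) = 1 := by
    intro y
    have h1 := hℓb y.1 y.2 1
    rw [show y.1 • b 0 + y.2 • b 1 + (1 : ℂ) • b 2 = π y by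
      rw [hπ, one_smul, add_comm, ← add_assoc]] at h1
    exact h1
  have hne : ∀ {v : Fin 3 → ℂ} {k : Fin 3}, eval v (ℓ k) ≠ 0 → v ≠ 0 := by
    rintro v k h rfl
    have h2 := (hℓ k).eval_smul 0 (0 : Fin 3 → ℂ)
    rw [zero_smul, pow_one, zero_mul] at h2
    exact h h2
  have hπ0 : ∀ y, π y ≠ 0 := fun y => hne (k := 2) (by rw [(hℓπ y).2.2]; exact one_ne_zero)
  have hπ00 : π 0 = b 2 := by simp [hπ]
  have hπd : ContDiff ℂ ω π := by
    rw [hπ]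
    exact (contDiff_const.add (contDiff_fst.smul contDiff_const)).add
      (contDiff_snd.smul contDiff_const)
  -- expansion of the ratios at the base point
  have hρan : ∀ c, AnalyticAt ℂ (fun y => F.ratio c₀ c (π y)) 0 := by
    intro c
    have h1 : AnalyticAt ℂ (F.ratio c₀ c) (π 0) := by
      rw [hπ00]
      exact ((analyticAt_form hd).div (analyticAt_form hd) hc₀).congr
        (ratio_eventuallyEq hd).symm
    exact AnalyticAt.comp (g := F.ratio c₀ c) h1 hπd.contDiffAt.analyticAt
  choose p hp using hρan
  choose q hq using fun (c : Fin 3) (m : ℕ) =>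
    ContinuousMultilinearMap.exists_polynomial_line (p c m) ((1, 0) : ℂ × ℂ) (0, 1)
  have hsum : ∀ c, ∀ᶠ y in 𝓝 (0 : ℂ × ℂ), ∀ t τ : ℂ, y = (t, t * τ) →
      HasSum (fun m => (q c m).eval τ * t ^ m) (F.ratio c₀ c (π (t, t * τ))) := by
    intro c
    filter_upwards [(hp c).eventually_hasSum] with y hy t τ hyt
    rw [zero_add, hyt] at hy
    have e : (fun m => (q c m).eval τ * t ^ m) = fun m => p c m fun _ => (t, t * τ) := by
      funext m
      have h1 : (t, t * τ) = t • ((1, 0) + τ • ((0, 1) : ℂ × ℂ)) := by simp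
      have h2 := (p c m).map_smul_univ (fun _ => t) (fun _ => (1, 0) + τ • ((0, 1) : ℂ × ℂ))
      rw [h1, ← hq, h2, Finset.prod_const, Finset.card_univ, Fintype.card_fin, smul_eq_mul,
        mul_comm]
    rw [e]
    exact hy
  have hlin : ∀ τ : ℂ, Tendsto (fun t : ℂ => (t, t * τ)) (𝓝 0) (𝓝 (0 : ℂ × ℂ)) := by
    intro τ
    have : Continuous fun t : ℂ => (t, t * τ) := by fun_prop
    have h := this.tendsto 0
    simp only [zero_mul] at h
    exact h
  have hrat : ∀ c, ∃ P Q : MvPolynomial (Fin 2) ℂ, Q ≠ 0 ∧ ∀ t τ,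
      HasSum (fun m => (q c m).eval τ * t ^ m) (F.ratio c₀ c (π (t, t * τ))) →
        eval ![t, τ] Q * F.ratio c₀ c (π (t, t * τ)) = eval ![t, τ] P := by
    intro c
    refine exists_rational_of_forall_rational (R := fun t τ => F.ratio c₀ c (π (t, t * τ)))
      (fun τ => ?_) fun τ => ?_
    · filter_upwards [(hlin τ).eventually (hsum c)] with t ht
      exact ht t τ rfl
    · refine exists_polynomial_mul_eq_of_meromorphic (fun t => ?_) ?_
      · refine meromorphicAt_ratio (σ := fun t => π (t, t * τ)) ?_ (hπ0 _)
        exact (hπd.comp (contDiff_id.prodMk (contDiff_id.mul contDiff_const))).contDiffAt.analyticAt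
      · -- the behaviour at infinity, in homogeneous coordinates
        have h1 : (b 0 + τ • b 1) ≠ 0 := hne (k := 0) (by
          have := (hℓb 1 τ 0).1
          rw [one_smul, zero_smul, add_zero] at this
          rw [this]
          exact one_ne_zero)
        refine (meromorphicAt_ratio (c₀ := c₀) (c := c) (F := F)
          (σ := fun s : ℂ => s • b 2 + (b 0 + τ • b 1)) (t := 0) ?_ (by simpa using h1)).congr ?_
        · exact ((contDiff_id.smul contDiff_const).add contDiff_const).contDiffAt.analyticAt
        · filter_upwards [self_mem_nhdsWithin] with s hs
          replace hs : s ≠ 0 := hs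
          rw [← ratio_smul (hπ0 _) hs]
          congr 1
          simp only [hπ, smul_add, smul_smul, mul_inv_cancel₀ hs, ← mul_assoc, one_smul, one_mul,
            add_assoc]
  choose P Q hQ0 hPQ using hrat
  -- common denominator, and homogenization with `t = ℓ 0 / ℓ 2` and `τ = ℓ 1 / ℓ 0`, both written
  -- over the denominator `ℓ 0 * ℓ 2`
  set Qa : MvPolynomial (Fin 2) ℂ := ∏ c, Q c with hQa
  set B : Fin 3 → MvPolynomial (Fin 2) ℂ := fun c => P c * ∏ c' ∈ Finset.univ.erase c, Q c' with hB
  have hMhom : (ℓ 0 * ℓ 2).IsHomogeneous 2 := (hℓ 0).mul (hℓ 2)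
  have hNhom : ∀ k, ((![ℓ 0 * ℓ 0, ℓ 1 * ℓ 2] : Fin 2 → MvPolynomial (Fin 3) ℂ) k).IsHomogeneous
      2 := by
    intro k
    fin_cases k
    · exact (hℓ 0).mul (hℓ 0)
    · exact (hℓ 1).mul (hℓ 2)
  choose D hD using fun c => exists_homogenization hMhom hNhom (B c)
  choose G hGhom hG using fun c => hD c (∑ c, D c) (Finset.single_le_sum (fun _ _ => Nat.zero_le _)
    (Finset.mem_univ c))
  set d := ∑ c, D c with hd'
  -- a neighbourhood of the base point on which everything converges
  obtain ⟨W, hW, hWo, hW0⟩ : ∃ W : Set (ℂ × ℂ), (∀ y ∈ W, (∀ c, ∀ t τ : ℂ, y = (t, t * τ) →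
      HasSum (fun m => (q c m).eval τ * t ^ m) (F.ratio c₀ c (π (t, t * τ)))) ∧
      F.ratio c₀ c₀ (π y) = 1) ∧ IsOpen W ∧ 0 ∈ W := by
    have h1 : ∀ᶠ y in 𝓝 (0 : ℂ × ℂ), F.ratio c₀ c₀ (π y) = 1 := by
      have h2 : ∀ᶠ v in 𝓝 (π 0), F.ratio c₀ c₀ v = 1 := by
        rw [hπ00]
        filter_upwards [ratio_eventuallyEq (c₀ := c₀) (c := c₀) hd,
          (analyticAt_form (c := c₀) hd).continuousAt.eventually_ne hc₀] with v hv hv0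
        rw [hv, div_self hv0]
      exact hπd.continuous.continuousAt.eventually h2
    exact eventually_nhds_iff.1 ((eventually_all.2 hsum).and h1)
  have hBval : ∀ t τ, (t, t * τ) ∈ W → ∀ c,
      eval ![t, τ] (B c) = eval ![t, τ] Qa * F.ratio c₀ c (π (t, t * τ)) := by
    intro t τ hW' c
    have h1 := hPQ c t τ ((hW _ hW').1 c t τ rfl)
    rw [hB, hQa, ← Finset.mul_prod_erase _ _ (Finset.mem_univ c), map_mul, map_mul, ← h1]
    ring
  have hGval : ∀ v, eval v (ℓ 0) ≠ 0 → eval v (ℓ 2) ≠ 0 →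
      (eval v (ℓ 0) / eval v (ℓ 2), eval v (ℓ 1) / eval v (ℓ 2)) ∈ W →
      ∀ c, eval v (G c) = (eval v (ℓ 0) * eval v (ℓ 2)) ^ d * eval ![eval v (ℓ 0) / eval v (ℓ 2),
        eval v (ℓ 1) / eval v (ℓ 0)] Qa * F.ratio c₀ c v := by
    intro v h0 h2 hvW c
    set t := eval v (ℓ 0) / eval v (ℓ 2) with ht
    set τ := eval v (ℓ 1) / eval v (ℓ 0) with hτ
    have h3 : eval v (ℓ 1) / eval v (ℓ 2) = t * τ := by
      rw [ht, hτ]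
      field_simp
    rw [h3] at hvW
    have h4 : v = eval v (ℓ 2) • π (t, t * τ) := by
      have e1 : eval v (ℓ 2) * t = eval v (ℓ 0) := by rw [ht, mul_div_cancel₀ _ h2]
      have e2 : eval v (ℓ 2) * (t * τ) = eval v (ℓ 1) := by rw [← h3, mul_div_cancel₀ _ h2]
      conv_lhs => rw [← hbℓ v]
      simp only [hπ, smul_add, smul_smul, e1, e2]
      abel
    have h5 : F.ratio c₀ c v = F.ratio c₀ c (π (t, t * τ)) := by
      conv_lhs => rw [h4]
      exact ratio_smul (hπ0 _) h2
    have h6 : (fun k => eval v ((![ℓ 0 * ℓ 0, ℓ 1 * ℓ 2] : Fin 2 → MvPolynomial (Fin 3) ℂ) k) /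
        eval v (ℓ 0 * ℓ 2)) = ![t, τ] := by
      funext k
      fin_cases k
      · simp only [ht, map_mul, Fin.zero_eta, Matrix.cons_val_zero]
        field_simp
      · simp only [hτ, map_mul, Fin.mk_one, Matrix.cons_val_one, Matrix.cons_val_fin_one]
        field_simp
    rw [hG c v (by rw [map_mul]; exact mul_ne_zero h0 h2), h6, hBval t τ hvW, h5, map_mul]
    ring
  -- a point where the common denominator does not vanish
  obtain ⟨x, hx0, hxQ, hxW⟩ : ∃ x : Fin 2 → ℂ, x 0 ≠ 0 ∧ eval x Qa ≠ 0 ∧ (x 0, x 0 * x 1) ∈ W := by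
    by_contra! hcon
    have h1 : ∀ᶠ x in 𝓝 (0 : Fin 2 → ℂ), (x 0, x 0 * x 1) ∈ W := by
      have h2 : Continuous fun x : Fin 2 → ℂ => (x 0, x 0 * x 1) := by fun_prop
      exact h2.continuousAt.eventually_mem (hWo.mem_nhds (by
        simp only [Pi.zero_apply, zero_mul]
        exact hW0))
    obtain ⟨r, hr, hball⟩ := Metric.eventually_nhds_iff_ball.1 h1
    have h3 : MvPolynomial.X 0 * Qa = 0 := by
      refine MvPolynomial.funext_set (fun _ => Metric.ball (0 : ℂ) r)
        (fun _ => infinite_of_mem_nhds 0 (Metric.ball_mem_nhds 0 hr)) fun x hx => ?_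
      rw [map_mul, eval_X, map_zero, mul_eq_zero]
      by_contra! h4
      refine hcon x h4.1 h4.2 (hball x ?_)
      rw [ball_pi _ hr]
      exact hx
    exact mul_ne_zero (MvPolynomial.X_ne_zero 0) (Finset.prod_ne_zero_iff.2 fun c _ => hQ0 c) h3
  set w := π (x 0, x 0 * x 1) with hw
  have hw0 : eval w (ℓ 0) = x 0 := (hℓπ _).1
  have hw1 : eval w (ℓ 1) = x 0 * x 1 := (hℓπ _).2.1
  have hw2 : eval w (ℓ 2) = 1 := (hℓπ _).2.2
  refine exists_hasDegree_of_eventually_isParallel (G := G) (m := 2 * d) hGhom ?_ (hπ0 _ : w ≠ 0) ?_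
  · intro hG0
    have h1 := hGval w (by rw [hw0]; exact hx0) (by rw [hw2]; exact one_ne_zero)
      (by rw [hw0, hw1, hw2, div_one, div_one]; exact hxW) c₀
    have h2 : eval w (G c₀) = 0 := by rw [hG0]; simp
    have h3 : (![x 0, x 1] : Fin 2 → ℂ) = x := by
      funext k
      fin_cases k <;> rfl
    rw [h2, hw0, hw1, hw2, div_one, mul_div_cancel_left₀ _ hx0, h3, (hW _ hxW).2, mul_one,
      mul_one] at h1
    exact mul_ne_zero (pow_ne_zero _ hx0) hxQ h1.symm
  · have hcont : ∀ k, ContinuousAt (fun v => eval v (ℓ k)) w := fun k =>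
      (continuous_eval' (ℓ k)).continuousAt
    have h2 : eval w (ℓ 2) ≠ 0 := by rw [hw2]; exact one_ne_zero
    have h3 : ContinuousAt (fun v => (eval v (ℓ 0) / eval v (ℓ 2), eval v (ℓ 1) / eval v (ℓ 2)))
        w := ((hcont 0).div (hcont 2) h2).prodMk ((hcont 1).div (hcont 2) h2)
    filter_upwards [(hcont 0).eventually_ne (by rw [hw0]; exact hx0), (hcont 2).eventually_ne h2,
      h3.eventually_mem (hWo.mem_nhds (by
        rw [hw0, hw1, hw2, div_one, div_one]; exact hxW))] with v hv0 hv2 hvW i' j' hij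
    have h4 : evalVec G v = (((eval v (ℓ 0) * eval v (ℓ 2)) ^ d *
        eval ![eval v (ℓ 0) / eval v (ℓ 2), eval v (ℓ 1) / eval v (ℓ 0)] Qa) *
          (F.form i' j' v c₀)⁻¹) • F.form i' j' v := by
      funext c
      rw [evalVec, hGval v hv0 hv2 hvW c, ratio_eq hij, Pi.smul_apply, smul_eq_mul]
      ring
    rw [h4, map_smul, LinearMap.smul_apply, cross_self, smul_zero]

end HolomorphicFoliation

theorem mainTheorem4 :
    (∀ F : HolomorphicFoliation, F.algebraicLeaves.Infinite →
      F.HasRationalFirstIntegral ∧ F.algebraicLeaves = F.leaves) ∧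
    (∀ k : ℕ, ∃ N : ℕ, ∀ F : HolomorphicFoliation, F.HasDegree k →
      ((N : ℕ∞) < F.algebraicLeaves.encard ∨ (N : ℕ∞) < F.invariantCurves.encard) →
        F.HasRationalFirstIntegral) := by
  refine ⟨fun F hinf => ?_, fun k => ⟨HolomorphicFoliation.darbouxBound k, fun F hk h => ?_⟩⟩
  · obtain ⟨k, hk⟩ := F.exists_hasDegree
    obtain ⟨A, hAk, hA⟩ := HolomorphicFoliation.hasDegree_iff.1 hk
    exact hA.of_encard_algebraicLeaves hAk (by
      rw [hinf.encard_eq]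
      exact ENat.natCast_lt_top _)
  · obtain ⟨A, hAk, hA⟩ := HolomorphicFoliation.hasDegree_iff.1 hk
    rcases h with h | h
    · exact (hA.of_encard_algebraicLeaves hAk h).1
    · exact (hA.of_encard_invariantCurves hAk h).1
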